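/- Let $\mathcal X$ be the space of nonsingular homogeneous polynomials $F(x,y,z)$ of degree $3$ over $\mathbb C$ modulo $\mathbb C^\times$, an open submanifold of $\mathbb{CP}^9$, and let $$\widetilde{\mathcal X}_{\mathrm{flex}}=\{(F,p)\in\mathcal X\times\mathbb{CP}^2 : p \text{ is a flex point of the curve } F=0\},$$ where a flex point is a point at which the curve meets its tangent line with multiplicity at least $3$. The group $\mathrm{PGL}_3(\mathbb C)=\mathrm{GL}_3(\mathbb C)/\mathbb C^\times$ acts on $\mathcal X$ by $(g\cdot F)(v)=F(g^{-1}v)$ and on $\mathbb{CP}^2$ in the natural way. Let $\mathcal H=\{\lambda\in\mathbb C:\lambda^3\neq 1\}$, and for $\lambda\in\mathcal H$ let $F_\lambda=x^3+y^3+z^3-3\lambda xyz$, so that $F_\lambda\in\mathcal X$. Let $p_0=[1:-1:0]$. Let $\Gamma$ be the Hessian group $$\Gamma=\{g\in\mathrm{PGL}_3(\mathbb C): \text{for every } \lambda\in\mathcal H \text{ there is } \mu\in\mathcal H \text{ with } g\cdot F_\lambda=F_\mu\},$$ acting on $\mathcal H$ by $F_{\gamma\cdot\lambda}=\gamma\cdot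 F_\lambda$, and let $\Gamma_0\le\Gamma$ be the subgroup fixing $p_0$. For $K=\Gamma$ or $K=\Gamma_0$, let $\mathrm{PGL}_3(\mathbb C)\times_K\mathcal H$ be the quotient of $\mathrm{PGL}_3(\mathbb C)\times\mathcal H$ by the free diagonal action $\gamma\cdot(g,\lambda)=(g\gamma^{-1},\gamma\cdot\lambda)$ of $K$, with its quotient manifold structure. Then $\widetilde{\mathcal X}_{\mathrm{flex}}$ is a smooth embedded submanifold of $\mathcal X\times\mathbb{CP}^2$, and the formulas $$\phi[g,\lambda]=g\cdot F_\lambda,\qquad \psi[g,\lambda]=(g\cdot F_\lambda,\ g\cdot p_0)$$ give well-defined diffeomorphisms $$\phi:\mathrm{PGL}_3(\mathbb C)\times_\Gamma\mathcal H\to\mathcal X,\qquad \psi:\mathrm{PGL}_3(\mathbb C)\times_{\Gamma_0}\mathcal H\to\widetilde{\mathcal X}_{\mathrm{flex}}.$$ The projection $\widetilde{\mathcal X}_{\mathrm{flex}}\to\mathcal X$, $(F,p)\mapsto F$, and the natural map $\mathrm{PGL}_3(\mathbb C)\times_{\Gamma_0}\mathcal H\to\mathrm{PGL}_3(\mathbb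 C)\times_\Gamma\mathcal H$ are smooth ($C^\infty$, locally diffeomorphic) $9$-to-$1$ covering maps, and they commute with $\psi$ and $\phi$: the projection of $\psi(y)$ to $\mathcal X$ is $\phi$ of the image of $y$, for every $y\in\mathrm{PGL}_3(\mathbb C)\times_{\Gamma_0}\mathcal H$. -/

import Mathlib

open scoped LinearAlgebra.Projectivization MatrixGroups Manifold ContDiff

noncomputable section

namespace FlexCover

/-! ### Projective spaces as smooth manifolds -/

section Projective

/-- The quotient topology on a projective space. -/
instance instTopologicalSpaceProj {V : Type*} [AddCommGroup V] [Module ℂ V] [TopologicalSpace V] :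
    TopologicalSpace (ℙ ℂ V) :=
  inferInstanceAs (TopologicalSpace (Quotient (projectivizationSetoid ℂ V)))

theorem isOpenQuotientMap_mk' {V : Type*} [AddCommGroup V] [Module ℂ V] [TopologicalSpace V]
    [ContinuousConstSMul ℂ V] :
    IsOpenQuotientMap (Projectivization.mk' ℂ : {v : V // v ≠ 0} → ℙ ℂ V) := by
  refine ⟨Quotient.mk_surjective, continuous_quotient_mk', fun U hU => ?_⟩
  have h : (Projectivization.mk' ℂ : {v : V // v ≠ 0} → ℙ ℂ V) ⁻¹'
      (Projectivization.mk' ℂ '' U) = ⋃ a : ℂˣ,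
        (fun v : {v : V // v ≠ 0} => (⟨a • v.1, (smul_ne_zero_iff_ne a).2 v.2⟩ :
          {v : V // v ≠ 0})) ⁻¹' U := by
    ext v
    simp only [Set.mem_preimage, Set.mem_image, Set.mem_iUnion]
    constructor
    · rintro ⟨u, hu, huv⟩
      obtain ⟨a, ha⟩ := (Projectivization.mk_eq_mk_iff ℂ u.1 v.1 u.2 v.2).1 huv
      exact ⟨a, by convert hu⟩
    · rintro ⟨a, ha⟩
      exact ⟨_, ha, (Projectivization.mk_eq_mk_iff ℂ _ _ _ _).2 ⟨a, rfl⟩⟩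
  refine isOpen_coinduced.2 ?_
  change IsOpen ((Projectivization.mk' ℂ : {v : V // v ≠ 0} → ℙ ℂ V) ⁻¹'
      (Projectivization.mk' ℂ '' U))
  rw [h]
  exact isOpen_iUnion fun a => hU.preimage
    ((continuous_subtype_val.const_smul a).subtype_mk _)

variable (ι : Type) [Inhabited ι] [DecidableEq ι]

/-- The model space of affine charts of `ℙ ℂ (ι → ℂ)`: all coordinates but one. -/
abbrev AffineModel : Type := {j : ι // j ≠ default} → ℂ

variable {ι}

/-- The homogeneous coordinate vector, with `i`-th coordinate `1`, of the point whose affine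
coordinates in the `i`-th affine chart are `w`. (The transposition of `i` and `default` makes
all the charts take values in the same model space.) -/
def affineVec (i : ι) (w : AffineModel ι) (k : ι) : ℂ :=
  if h : Equiv.swap i default k = default then 1 else w ⟨Equiv.swap i default k, h⟩

theorem affineVec_self (i : ι) (w : AffineModel ι) : affineVec i w i = 1 := by
  simp [affineVec]

theorem affineVec_swap (i : ι) (w : AffineModel ι) (j : {j : ι // j ≠ default}) :
    affineVec i w (Equiv.swap i default j) = w j := by
  simp [affineVec, j.2]

theorem affineVec_ne_zero (i : ι) (w : AffineModel ι) : affineVec i w ≠ 0 := fun h => by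
  simpa [affineVec_self] using congrFun h i

/-- The affine coordinates `v_k / v_i`, `k ≠ i`, of the point `[v]` of `ℙ ℂ (ι → ℂ)`. -/
def affineCoord (i : ι) (p : ℙ ℂ (ι → ℂ)) : AffineModel ι :=
  fun j => p.rep (Equiv.swap i default j) / p.rep i

theorem rep_apply_eq_zero_iff {ι : Type} {v : ι → ℂ} (hv : v ≠ 0) (i : ι) :
    (Projectivization.mk ℂ v hv).rep i = 0 ↔ v i = 0 := by
  obtain ⟨a, ha⟩ := Projectivization.exists_smul_eq_mk_rep ℂ v hv
  rw [← ha]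
  simp [Units.smul_def]

theorem affineCoord_mk (i : ι) {v : ι → ℂ} (hv : v ≠ 0) (j : {j : ι // j ≠ default}) :
    affineCoord i (Projectivization.mk ℂ v hv) j = v (Equiv.swap i default j) / v i := by
  obtain ⟨a, ha⟩ := Projectivization.exists_smul_eq_mk_rep ℂ v hv
  rw [affineCoord, ← ha]
  simp [Units.smul_def, mul_div_mul_left]

theorem isOpen_affineChart_source {ι : Type} (i : ι) :
    IsOpen {p : ℙ ℂ (ι → ℂ) | p.rep i ≠ 0} := by
  refine (isOpenQuotientMap_mk' (V := ι → ℂ)).isQuotientMap.isOpen_preimage.1 ?_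
  have : (Projectivization.mk' ℂ : {v : ι → ℂ // v ≠ 0} → _) ⁻¹' {p | p.rep i ≠ 0} =
      {v | v.1 i ≠ 0} := by
    ext v
    simp [rep_apply_eq_zero_iff]
  rw [this]
  exact isOpen_ne_fun ((continuous_apply i).comp continuous_subtype_val) continuous_const

/-- The standard affine chart `{v_i ≠ 0} → ℂⁿ`, `[v] ↦ (v_k / v_i)_{k ≠ i}`. -/
def affineChart (i : ι) : OpenPartialHomeomorph (ℙ ℂ (ι → ℂ)) (AffineModel ι) where
  toFun := affineCoord i
  invFun w := Projectivization.mk ℂ (affineVec i w) (affineVec_ne_zero i w)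
  source := {p | p.rep i ≠ 0}
  target := Set.univ
  map_source' _ _ := Set.mem_univ _
  map_target' w _ := by
    simp [rep_apply_eq_zero_iff, affineVec_self]
  left_inv' p hp := by
    induction p using Projectivization.ind with
    | h v hv =>
      have hvi : v i ≠ 0 := by simpa [rep_apply_eq_zero_iff] using hp
      refine (Projectivization.mk_eq_mk_iff' ℂ _ _ _ _).2 ⟨(v i)⁻¹, ?_⟩
      ext k
      by_cases hk : Equiv.swap i default k = default
      · have : k = i := by
          have := congrArg (Equiv.swap i default) hk
          simpa using this
        subst this
        simp [affineVec_self, hvi]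
      · simp only [affineVec, hk, dite_false, affineCoord_mk, Pi.smul_apply, smul_eq_mul]
        simp [div_eq_inv_mul]
  right_inv' w _ := by
    ext j
    rw [affineCoord_mk, affineVec_swap, affineVec_self, div_one]
  open_source := isOpen_affineChart_source i
  open_target := isOpen_univ
  continuousOn_toFun := by
    refine ((isOpenQuotientMap_mk' (V := ι → ℂ)).isQuotientMap.continuousOn_isOpen_iff
      (isOpen_affineChart_source i)).2 ?_
    refine continuousOn_pi.2 fun j => ?_
    have h : ∀ v : {v : ι → ℂ // v ≠ 0}, (affineCoord i ∘ Projectivization.mk' ℂ) v j =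
        v.1 (Equiv.swap i default j) / v.1 i := fun v => affineCoord_mk i v.2 j
    simp only [h]
    refine ContinuousOn.div ?_ ?_ fun v hv => ?_
    · exact ((continuous_apply _).comp continuous_subtype_val).continuousOn
    · exact ((continuous_apply _).comp continuous_subtype_val).continuousOn
    · simpa [rep_apply_eq_zero_iff] using hv
  continuousOn_invFun := by
    refine Continuous.continuousOn ?_
    refine (isOpenQuotientMap_mk' (V := ι → ℂ)).continuous.comp
      (f := fun w => (⟨affineVec i w, affineVec_ne_zero i w⟩ : {v : ι → ℂ // v ≠ 0})) ?_
    refine Continuous.subtype_mk (continuous_pi fun k => ?_) _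
    unfold affineVec
    split_ifs <;> fun_prop

theorem exists_rep_ne_zero {ι : Type} (p : ℙ ℂ (ι → ℂ)) : ∃ i, p.rep i ≠ 0 :=
  Function.ne_iff.1 p.rep_nonzero

/-- Projective space with its atlas of standard affine charts. -/
instance instChartedSpaceProj : ChartedSpace (AffineModel ι) (ℙ ℂ (ι → ℂ)) where
  atlas := Set.range affineChart
  chartAt p := affineChart (exists_rep_ne_zero p).choose
  mem_chart_source p := (exists_rep_ne_zero p).choose_spec
  chart_mem_atlas _ := Set.mem_range_self _

instance instIsManifoldProj [Fintype ι] :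
    IsManifold 𝓘(ℝ, AffineModel ι) ∞ (ℙ ℂ (ι → ℂ)) := by
  refine isManifold_of_contDiffOn _ _ _ ?_
  rintro _ _ ⟨i, rfl⟩ ⟨j, rfl⟩
  have hv : ∀ k : ι, ContDiff ℝ ∞ fun w : AffineModel ι => affineVec i w k := fun k => by
    unfold affineVec
    split_ifs <;> fun_prop
  refine contDiffOn_pi.2 fun k => ?_
  have h : ∀ w : AffineModel ι, (𝓘(ℝ, AffineModel ι) ∘ ((affineChart i).symm ≫ₕ affineChart j) ∘
      (𝓘(ℝ, AffineModel ι)).symm) w k =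
      affineVec i w (Equiv.swap j default k) * (affineVec i w j)⁻¹ := fun w => by
    rw [← div_eq_mul_inv]
    exact affineCoord_mk j (affineVec_ne_zero i w) k
  refine ContDiffOn.congr ?_ fun w _ => h w
  refine (hv _).contDiffOn.mul ((hv _).contDiffOn.inv fun w hw => ?_)
  have hw' : (Projectivization.mk ℂ (affineVec i w) (affineVec_ne_zero i w)).rep j ≠ 0 := by
    simpa [affineChart] using hw
  simpa [rep_apply_eq_zero_iff] using hw'

end Projective

section Pullback

variable {H M N : Type*} [TopologicalSpace H] [TopologicalSpace M] [TopologicalSpace N]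
  [ChartedSpace H N] {f : M → N}

/-- The restriction of a chart of `N` to `M`, for an open embedding `f : M → N`. -/
def pullbackChart (hf : Topology.IsOpenEmbedding f) (x : M) : OpenPartialHomeomorph M H :=
  haveI : Nonempty M := ⟨x⟩
  (hf.toOpenPartialHomeomorph f).trans (chartAt H (f x))

/-- The manifold structure that `M` inherits from an open embedding into a manifold `N`. -/
@[reducible]
def pullbackChartedSpace (hf : Topology.IsOpenEmbedding f) : ChartedSpace H M where
  atlas := Set.range (pullbackChart hf)
  chartAt := pullbackChart hf
  mem_chart_source x := by simp [pullbackChart]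
  chart_mem_atlas x := Set.mem_range_self x

theorem pullback_isManifold {E : Type*} [NormedAddCommGroup E] [NormedSpace ℝ E]
    (I : ModelWithCorners ℝ E H) [IsManifold I ∞ N] (hf : Topology.IsOpenEmbedding f) :
    letI := pullbackChartedSpace (H := H) hf
    IsManifold I ∞ M := by
  let := pullbackChartedSpace (H := H) hf
  refine @IsManifold.mk' _ _ _ _ _ _ _ I ∞ M _ _ ⟨?_⟩
  rintro _ _ ⟨x, rfl⟩ ⟨y, rfl⟩
  have : Nonempty M := ⟨x⟩
  let φ := hf.toOpenPartialHomeomorph f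
  let c := chartAt H (f x)
  have hU : IsOpen (c.symm.source ∩ c.symm ⁻¹' Set.range f) :=
    c.symm.isOpen_inter_preimage hf.isOpen_range
  refine (contDiffGroupoid ∞ I).mem_of_eqOnSource
    (closedUnderRestriction' ((contDiffGroupoid ∞ I).compatible
      (chart_mem_atlas H (f x)) (chart_mem_atlas H (f y))) hU) ⟨?_, ?_⟩
  · ext z
    rw [OpenPartialHomeomorph.restr_source, hU.interior_eq]
    by_cases hr : c.symm z ∈ Set.range f
    · have h : f (φ.symm (c.symm z)) = c.symm z := by
        obtain ⟨m, hm⟩ := hr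
        exact φ.right_inv (by simp [φ, ← hm])
      simp only [c, φ] at h hr
      simp [pullbackChart, c, h]
      tauto
    · simp only [c, Set.mem_range] at hr
      simp [pullbackChart, c, hr]
  · intro z hz
    have hz' : c.symm z ∈ Set.range f := by
      simp only [pullbackChart, OpenPartialHomeomorph.trans_symm_eq_symm_trans_symm,
        OpenPartialHomeomorph.trans_source, OpenPartialHomeomorph.symm_source] at hz
      simpa [c] using hz.1.2
    obtain ⟨m, hm⟩ := hz'
    have h : φ (φ.symm (c.symm z)) = c.symm z := φ.right_inv (by simp [φ, ← hm])
    have h2 : (pullbackChart (H := H) hf x).symm z = φ.symm (c.symm z) := rfl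
    change chartAt H (f y) (φ (φ.symm (c.symm z))) = chartAt H (f y) (c.symm z)
    rw [h]

end Pullback

/-! ### The group `PGL₃(ℂ)` as a manifold -/

section PGL

/-- The quotient topology on `PGL₃(ℂ) = GL₃(ℂ) / ℂˣ`. -/
instance instTopologicalSpacePGL : TopologicalSpace PGL(3, ℂ) :=
  inferInstanceAs (TopologicalSpace (GL (Fin 3) ℂ ⧸ Subgroup.center (GL (Fin 3) ℂ)))

instance instIsTopologicalGroupPGL : IsTopologicalGroup PGL(3, ℂ) :=
  inferInstanceAs (IsTopologicalGroup (GL (Fin 3) ℂ ⧸ Subgroup.center (GL (Fin 3) ℂ)))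

theorem isClosed_center : IsClosed (Subgroup.center (GL (Fin 3) ℂ) : Set (GL (Fin 3) ℂ)) := by
  have : (Subgroup.center (GL (Fin 3) ℂ) : Set (GL (Fin 3) ℂ)) = ⋂ h, {g | h * g = g * h} := by
    ext g
    simp [Subgroup.mem_center_iff]
  rw [this]
  exact isClosed_iInter fun h => isClosed_eq (by fun_prop) (by fun_prop)

theorem isOpenEmbedding_coe_GL :
    Topology.IsOpenEmbedding (fun g : GL (Fin 3) ℂ => (g : Matrix (Fin 3) (Fin 3) ℂ)) := by
  let := Matrix.linftyOpNormedRing (n := Fin 3) (α := ℂ)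
  let := Matrix.linftyOpNormedAlgebra (n := Fin 3) (R := ℂ) (α := ℂ)
  have : CompleteSpace (Matrix (Fin 3) (Fin 3) ℂ) := FiniteDimensional.complete ℂ _
  exact Units.isOpenEmbedding_val

instance instT2SpacePGL : T2Space PGL(3, ℂ) := by
  have := isClosed_center
  exact inferInstanceAs (T2Space (GL (Fin 3) ℂ ⧸ Subgroup.center (GL (Fin 3) ℂ)))

instance instLocallyCompactSpacePGL : LocallyCompactSpace PGL(3, ℂ) := by
  have : LocallyCompactSpace (Matrix (Fin 3) (Fin 3) ℂ) :=
    inferInstanceAs (LocallyCompactSpace (Fin 3 → Fin 3 → ℂ))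
  have : LocallyCompactSpace (GL (Fin 3) ℂ) := isOpenEmbedding_coe_GL.locallyCompactSpace
  exact inferInstanceAs (LocallyCompactSpace (GL (Fin 3) ℂ ⧸ Subgroup.center (GL (Fin 3) ℂ)))

/-- The entries of an invertible matrix. -/
def entries (g : GL (Fin 3) ℂ) : {v : Fin 3 × Fin 3 → ℂ // v ≠ 0} :=
  ⟨fun k => g k.1 k.2, fun h => g.ne_zero (by ext i j; exact congrFun h (i, j))⟩

theorem isOpenEmbedding_entries : Topology.IsOpenEmbedding entries := by
  let e : Matrix (Fin 3) (Fin 3) ℂ ≃ₜ (Fin 3 × Fin 3 → ℂ) :=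
    { toFun := fun m k => m k.1 k.2
      invFun := fun v => Matrix.of fun i j => v (i, j)
      left_inv := fun _ => rfl
      right_inv := fun _ => rfl
      continuous_toFun := by fun_prop
      continuous_invFun := by fun_prop }
  exact Topology.IsOpenEmbedding.of_comp entries (isOpen_ne.isOpenEmbedding_subtypeVal)
    (e.isOpenEmbedding.comp isOpenEmbedding_coe_GL)

theorem mk'_entries_eq_iff (g h : GL (Fin 3) ℂ) :
    Projectivization.mk' ℂ (entries g) = Projectivization.mk' ℂ (entries h) ↔
      Matrix.ProjGenLinGroup.mk g = Matrix.ProjGenLinGroup.mk h := by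
  rw [eq_comm, Matrix.ProjGenLinGroup.mk_eq_mk_iff]
  refine (Projectivization.mk_eq_mk_iff ℂ _ _ (entries h).2 (entries g).2).trans
    (exists_congr fun a => ?_)
  rw [Units.ext_iff, ← Matrix.ext_iff]
  simp only [funext_iff, Prod.forall]
  refine forall₂_congr fun i j => ?_
  simp [entries, Units.smul_def, mul_comm]

/-- `PGL₃(ℂ)` as a subset of the projective space of `3 × 3` matrices. -/
def pglToProj : PGL(3, ℂ) → ℙ ℂ (Fin 3 × Fin 3 → ℂ) :=
  Quotient.lift (s := QuotientGroup.leftRel _) (fun g => Projectivization.mk' ℂ (entries g)) <| by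
    intro g h hgh
    exact (mk'_entries_eq_iff g h).2 (Quotient.sound hgh)

theorem pglToProj_mk (g : GL (Fin 3) ℂ) :
    pglToProj (Matrix.ProjGenLinGroup.mk g) = Projectivization.mk' ℂ (entries g) := rfl

theorem isOpenEmbedding_pglToProj : Topology.IsOpenEmbedding pglToProj := by
  have hmk : IsOpenQuotientMap (Matrix.ProjGenLinGroup.mk : GL (Fin 3) ℂ → PGL(3, ℂ)) :=
    QuotientGroup.isOpenQuotientMap_mk
  have h1 : Continuous (pglToProj ∘ Matrix.ProjGenLinGroup.mk) :=
    isOpenQuotientMap_mk'.continuous.comp isOpenEmbedding_entries.continuous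
  have h2 : IsOpenMap (pglToProj ∘ Matrix.ProjGenLinGroup.mk) :=
    isOpenQuotientMap_mk'.isOpenMap.comp isOpenEmbedding_entries.isOpenMap
  refine .of_continuous_injective_isOpenMap (hmk.isQuotientMap.continuous_iff.2 h1) ?_
    (.of_comp hmk.continuous hmk.surjective h2)
  intro g h hgh
  induction g using Matrix.ProjGenLinGroup.induction_on with | mk g =>
  induction h using Matrix.ProjGenLinGroup.induction_on with | mk h =>
  exact (mk'_entries_eq_iff g h).1 hgh

/-- `PGL₃(ℂ)` carries the manifold structure of an open subset of the projective space of
`3 × 3` matrices; this is the quotient manifold structure of `GL₃(ℂ) / ℂˣ`. -/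
instance instChartedSpacePGL : ChartedSpace (AffineModel (Fin 3 × Fin 3)) PGL(3, ℂ) :=
  pullbackChartedSpace isOpenEmbedding_pglToProj

instance instIsManifoldPGL : IsManifold 𝓘(ℝ, AffineModel (Fin 3 × Fin 3)) ∞ PGL(3, ℂ) :=
  pullback_isManifold _ isOpenEmbedding_pglToProj

end PGL

/-! ### Ternary cubic forms and smooth cubic plane curves -/

section Cubics

open MvPolynomial

/-- Ternary cubic forms: homogeneous polynomials of degree `3` in three variables over `ℂ`. -/
def CubicForm : Type := ↥(homogeneousSubmodule (Fin 3) ℂ 3)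

instance : AddCommGroup CubicForm := inferInstanceAs (AddCommGroup ↥(homogeneousSubmodule _ _ _))

instance : Module ℂ CubicForm := inferInstanceAs (Module ℂ ↥(homogeneousSubmodule _ _ _))

/-- The polynomial underlying a cubic form. -/
def CubicForm.poly : CubicForm →ₗ[ℂ] MvPolynomial (Fin 3) ℂ := (homogeneousSubmodule _ _ _).subtype

theorem CubicForm.isHomogeneous (F : CubicForm) : F.poly.IsHomogeneous 3 := F.2

theorem CubicForm.poly_injective : Function.Injective CubicForm.poly := Subtype.val_injective

/-- Exponents of the ten monomials of degree `3` in three variables. -/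
abbrev CubicExponent : Type := {m : Fin 3 →₀ ℕ // m.degree = 3}

instance : Fintype CubicExponent :=
  Fintype.subtype (Finset.finsuppAntidiag Finset.univ 3) fun m => by
    simp [Finset.mem_finsuppAntidiag, Finsupp.degree_eq_sum]

/-- The exponent of `x³` is taken as the distinguished one. -/
instance : Inhabited CubicExponent := ⟨⟨Finsupp.single 0 3, by simp⟩⟩

/-- The coefficients of a cubic form. -/
def coeffs : CubicForm ≃ₗ[ℂ] (CubicExponent → ℂ) where
  toFun F m := F.poly.coeff m.1
  map_add' F G := by ext; simp
  map_smul' a F := by ext; simp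
  invFun c := ⟨∑ m, monomial m.1 (c m), by
    refine Submodule.sum_mem _ fun m _ => ?_
    exact isHomogeneous_monomial _ m.2⟩
  left_inv F := by
    apply CubicForm.poly_injective
    ext d
    change coeff d (∑ m : CubicExponent, monomial m.1 (F.poly.coeff m.1)) = F.poly.coeff d
    rw [coeff_sum]
    simp only [coeff_monomial]
    by_cases hd : d.degree = 3
    · rw [Finset.sum_eq_single (⟨d, hd⟩ : CubicExponent)]
      · simp
      · intro m _ hm
        rw [if_neg]
        rintro rfl
        exact hm rfl
      · simp
    · rw [F.isHomogeneous.coeff_eq_zero hd]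
      refine Finset.sum_eq_zero fun m _ => ?_
      rw [if_neg]
      rintro rfl
      exact hd m.2
  right_inv c := by
    ext m
    change coeff m.1 (∑ m : CubicExponent, monomial m.1 (c m)) = c m
    rw [coeff_sum]
    simp only [coeff_monomial]
    rw [Finset.sum_eq_single m]
    · simp
    · intro k _ hk
      rw [if_neg]
      exact fun h => hk (Subtype.ext h)
    · simp

/-- Cubic forms are topologized by their coefficients. -/
instance : TopologicalSpace CubicForm := .induced coeffs inferInstance

theorem isInducing_coeffs : Topology.IsInducing coeffs := ⟨rfl⟩

/-- `coeffs` as a homeomorphism. -/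
def coeffsHomeomorph : CubicForm ≃ₜ (CubicExponent → ℂ) :=
  coeffs.toEquiv.toHomeomorphOfIsInducing isInducing_coeffs

instance : T2Space CubicForm := coeffsHomeomorph.symm.t2Space

instance : IsTopologicalAddGroup CubicForm := topologicalAddGroup_induced coeffs

instance : ContinuousSMul ℂ CubicForm := continuousSMul_induced coeffs

instance : FiniteDimensional ℂ CubicForm := .of_injective coeffs.toLinearMap coeffs.injective

/-- The point of `ℂℙ⁹` given by the coefficients of a cubic form. -/
def coeffsProj : ℙ ℂ CubicForm → ℙ ℂ (CubicExponent → ℂ) :=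
  Projectivization.map coeffs.toLinearMap coeffs.injective

theorem isOpenEmbedding_coeffsProj : Topology.IsOpenEmbedding coeffsProj := by
  have h : coeffsProj ∘ Projectivization.mk' ℂ = Projectivization.mk' ℂ ∘
      fun F : {F : CubicForm // F ≠ 0} => (⟨coeffs F.1, coeffs.map_ne_zero_iff.2 F.2⟩ :
        {v : CubicExponent → ℂ // v ≠ 0}) := rfl
  have hq := isOpenQuotientMap_mk' (V := CubicForm)
  have hq' := isOpenQuotientMap_mk' (V := CubicExponent → ℂ)
  have he : Topology.IsOpenEmbedding fun F : {F : CubicForm // F ≠ 0} =>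
      (⟨coeffs F.1, coeffs.map_ne_zero_iff.2 F.2⟩ : {v : CubicExponent → ℂ // v ≠ 0}) :=
    .of_comp _ (isOpen_ne.isOpenEmbedding_subtypeVal)
      (coeffsHomeomorph.isOpenEmbedding.comp isOpen_ne.isOpenEmbedding_subtypeVal)
  refine .of_continuous_injective_isOpenMap (hq.isQuotientMap.continuous_iff.2 ?_)
    (Projectivization.map_injective _ _) (.of_comp hq.continuous hq.surjective ?_)
  · rw [h]
    exact hq'.continuous.comp he.continuous
  · rw [h]
    exact hq'.isOpenMap.comp he.isOpenMap

/-- The projective space `ℂℙ⁹` of plane cubic curves, as a manifold. -/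
instance : ChartedSpace (AffineModel CubicExponent) (ℙ ℂ CubicForm) :=
  pullbackChartedSpace isOpenEmbedding_coeffsProj

instance : IsManifold 𝓘(ℝ, AffineModel CubicExponent) ∞ (ℙ ℂ CubicForm) :=
  pullback_isManifold _ isOpenEmbedding_coeffsProj

/-! #### Linear changes of coordinates -/

/-- The change of coordinates `(g · f)(x) = f(g⁻¹ x)`. -/
def changeCoord (g : GL (Fin 3) ℂ) : MvPolynomial (Fin 3) ℂ →ₐ[ℂ] MvPolynomial (Fin 3) ℂ :=
  aeval fun i => ∑ j, C ((g⁻¹ : GL (Fin 3) ℂ) i j) * X j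

theorem eval_changeCoord (g : GL (Fin 3) ℂ) (f : MvPolynomial (Fin 3) ℂ) (v : Fin 3 → ℂ) :
    eval v (changeCoord g f) = eval (g⁻¹ • v) f := by
  induction f using MvPolynomial.induction_on with
  | C a => simp [changeCoord]
  | add p q hp hq => simp [hp, hq]
  | mul_X p i hp =>
    rw [map_mul, map_mul, map_mul, hp]
    simp [changeCoord, Units.smul_def, Matrix.smul_eq_mulVec, Matrix.mulVec, dotProduct]

theorem isHomogeneous_changeCoord (g : GL (Fin 3) ℂ) {f : MvPolynomial (Fin 3) ℂ}
    (hf : f.IsHomogeneous 3) : (changeCoord g f).IsHomogeneous 3 := by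
  have hL : ∀ i, (∑ j, C ((g⁻¹ : GL (Fin 3) ℂ) i j) * X (R := ℂ) (σ := Fin 3) j).IsHomogeneous 1 :=
    fun i => IsHomogeneous.sum _ _ _ fun j _ => isHomogeneous_C_mul_X _ j
  exact hf.aeval _ hL

theorem changeCoord_one (f : MvPolynomial (Fin 3) ℂ) : changeCoord 1 f = f :=
  funext fun v => by simp [eval_changeCoord]

theorem changeCoord_mul (g h : GL (Fin 3) ℂ) (f : MvPolynomial (Fin 3) ℂ) :
    changeCoord (g * h) f = changeCoord g (changeCoord h f) :=
  funext fun v => by simp [eval_changeCoord, mul_smul]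

/-- `GL₃(ℂ)` acts on cubic forms by `(g • F)(x) = F(g⁻¹ x)`. -/
instance : DistribMulAction (GL (Fin 3) ℂ) CubicForm where
  smul g F := ⟨changeCoord g F.poly, isHomogeneous_changeCoord g F.isHomogeneous⟩
  one_smul _ := Subtype.ext (changeCoord_one _)
  mul_smul g h _ := Subtype.ext (changeCoord_mul g h _)
  smul_zero _ := Subtype.ext (map_zero _)
  smul_add _ _ _ := Subtype.ext (map_add _ _ _)

theorem poly_smul (g : GL (Fin 3) ℂ) (F : CubicForm) : (g • F).poly = changeCoord g F.poly := rfl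

instance : SMulCommClass (GL (Fin 3) ℂ) ℂ CubicForm where
  smul_comm g a F := CubicForm.poly_injective (by simp [poly_smul])

theorem eval_smul_of_isHomogeneous {f : MvPolynomial (Fin 3) ℂ} {n : ℕ} (hf : f.IsHomogeneous n)
    (a : ℂ) (v : Fin 3 → ℂ) : eval (a • v) f = a ^ n * eval v f := by
  rw [eval_eq, eval_eq, Finset.mul_sum]
  refine Finset.sum_congr rfl fun d hd => ?_
  have hd' : d.degree = n := by
    by_contra h
    exact (mem_support_iff.1 hd) (hf.coeff_eq_zero h)
  simp only [Pi.smul_apply, smul_eq_mul, mul_pow, Finset.prod_mul_distrib,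
    Finset.prod_pow_eq_pow_sum]
  rw [← hd', Finsupp.degree_apply]
  ring

/-- `PGL₃(ℂ)` acts on the projective space of plane cubic curves. -/
instance : MulAction PGL(3, ℂ) (ℙ ℂ CubicForm) :=
  Matrix.ProjGenLinGroup.mulActionOfGL fun u => Projectivization.ind fun F hF => by
    rw [Projectivization.smul_mk, Projectivization.mk_eq_mk_iff']
    refine ⟨(u⁻¹ : ℂˣ) ^ 3, CubicForm.poly_injective (funext fun v => ?_)⟩
    rw [poly_smul, eval_changeCoord, map_smul, smul_eval]
    have : (Matrix.GeneralLinearGroup.scalar (Fin 3) u)⁻¹ • v = ((u⁻¹ : ℂˣ) : ℂ) • v := by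
      ext i
      rw [← map_inv, Units.smul_def, Matrix.GeneralLinearGroup.coe_scalar,
        Matrix.smul_eq_mulVec, Matrix.scalar_apply, Matrix.mulVec_diagonal]
      rfl
    rw [this, eval_smul_of_isHomogeneous F.isHomogeneous]

theorem mk_smul_mk (g : GL (Fin 3) ℂ) {F : CubicForm} (hF : F ≠ 0) :
    Matrix.ProjGenLinGroup.mk g • Projectivization.mk ℂ F hF =
      Projectivization.mk ℂ (g • F) ((smul_ne_zero_iff_ne g).2 hF) := rfl

theorem continuous_smul_proj (g : PGL(3, ℂ)) : Continuous fun F : ℙ ℂ CubicForm => g • F := by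
  induction g using Matrix.ProjGenLinGroup.induction_on with | mk g =>
  refine isOpenQuotientMap_mk'.isQuotientMap.continuous_iff.2 ?_
  let L : CubicForm →ₗ[ℂ] CubicForm := DistribSMul.toLinearMap ℂ CubicForm g
  have hL : Continuous L := L.continuous_of_finiteDimensional
  exact isOpenQuotientMap_mk'.continuous.comp
    (Continuous.subtype_mk (hL.comp continuous_subtype_val)
      fun F => (smul_ne_zero_iff_ne g).2 F.2)

/-! #### Nonsingular cubics -/

/-- A ternary form `f` is nonsingular if the plane curve `f = 0` has no singular point. -/
def IsNonsingular (f : MvPolynomial (Fin 3) ℂ) : Prop :=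
  ∀ v : Fin 3 → ℂ, v ≠ 0 → eval v f = 0 → ∃ i, eval v (pderiv i f) ≠ 0

theorem pderiv_changeCoord (g : GL (Fin 3) ℂ) (i : Fin 3) (f : MvPolynomial (Fin 3) ℂ) :
    pderiv i (changeCoord g f) =
      ∑ k, changeCoord g (pderiv k f) * C ((g⁻¹ : GL (Fin 3) ℂ) k i) := by
  induction f using MvPolynomial.induction_on with
  | C a => simp [changeCoord]
  | add p q hp hq => simp [hp, hq, add_mul, Finset.sum_add_distrib]
  | mul_X p l hp =>
    have hX : pderiv i (changeCoord g (X l)) = C ((g⁻¹ : GL (Fin 3) ℂ) l i) := by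
      simp [changeCoord, pderiv_X, Pi.single_apply]
    rw [map_mul, Derivation.leibniz, hX, hp]
    simp only [Derivation.leibniz, pderiv_X, map_add, smul_eq_mul, map_mul, add_mul,
      Finset.sum_add_distrib]
    congr 1
    · rw [Finset.sum_eq_single l] <;> simp +contextual
    · rw [Finset.mul_sum]
      exact Finset.sum_congr rfl fun k _ => by ring

theorem IsNonsingular.changeCoord {f : MvPolynomial (Fin 3) ℂ} (hf : IsNonsingular f)
    (g : GL (Fin 3) ℂ) : IsNonsingular (changeCoord g f) := by
  intro v hv hfv
  by_contra! hsing
  obtain ⟨k, hk⟩ := hf (g⁻¹ • v) ((smul_ne_zero_iff_ne _).2 hv) (by rwa [← eval_changeCoord])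
  have h : Matrix.vecMul (fun k => eval (g⁻¹ • v) (pderiv k f)) (g⁻¹ : GL (Fin 3) ℂ).1 = 0 := by
    ext i
    have := hsing i
    rw [pderiv_changeCoord] at this
    simpa [eval_changeCoord, Matrix.vecMul, dotProduct] using this
  have h2 := congrArg (fun w => Matrix.vecMul w g.1) h
  simp only [Matrix.vecMul_vecMul, Units.inv_mul, Matrix.vecMul_one, Matrix.zero_vecMul] at h2
  exact hk (congrFun h2 k)

theorem isNonsingular_smul_iff (f : MvPolynomial (Fin 3) ℂ) {a : ℂ} (ha : a ≠ 0) :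
    IsNonsingular (a • f) ↔ IsNonsingular f := by
  simp [IsNonsingular, ha, smul_eval]

theorem isNonsingular_rep_mk {F : CubicForm} (hF : F ≠ 0) :
    IsNonsingular (Projectivization.mk ℂ F hF).rep.poly ↔ IsNonsingular F.poly := by
  obtain ⟨a, ha⟩ := Projectivization.exists_smul_eq_mk_rep ℂ F hF
  rw [← ha, Units.smul_def, map_smul, isNonsingular_smul_iff _ a.ne_zero]

theorem isOpen_isNonsingular : IsOpen {F : ℙ ℂ CubicForm | IsNonsingular F.rep.poly} := by
  refine isOpenQuotientMap_mk'.isQuotientMap.isOpen_preimage.1 ?_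
  let Z : Set (Metric.sphere (0 : Fin 3 → ℂ) 1 × CubicForm) :=
    {q | eval q.1.1 q.2.poly = 0 ∧ ∀ i, eval q.1.1 (pderiv i q.2.poly) = 0}
  have hcont : ∀ L : MvPolynomial (Fin 3) ℂ →ₗ[ℂ] MvPolynomial (Fin 3) ℂ,
      Continuous fun q : Metric.sphere (0 : Fin 3 → ℂ) 1 × CubicForm =>
        eval q.1.1 (L q.2.poly) := fun L => by
    have h : ∀ q : Metric.sphere (0 : Fin 3 → ℂ) 1 × CubicForm, eval q.1.1 (L q.2.poly) =
        ∑ m, coeffs q.2 m * eval q.1.1 (L (monomial m.1 1)) := fun q => by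
      have hq : q.2.poly = ∑ m, coeffs q.2 m • monomial m.1 (1 : ℂ) := by
        simp only [smul_monomial, smul_eq_mul, mul_one]
        exact congrArg CubicForm.poly (coeffs.symm_apply_apply q.2).symm
      conv_lhs => rw [hq]
      simp [smul_eval]
    simp only [h]
    refine continuous_finsetSum _ fun m _ => ?_
    exact (((continuous_apply m).comp isInducing_coeffs.continuous).comp continuous_snd).mul
      ((continuous_eval _).comp (continuous_subtype_val.comp continuous_fst))
  have hZ : IsClosed Z := by
    refine IsClosed.inter (isClosed_eq (hcont LinearMap.id) continuous_const) ?_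
    have : {q : Metric.sphere (0 : Fin 3 → ℂ) 1 × CubicForm |
        ∀ i, eval q.1.1 (pderiv i q.2.poly) = 0} =
        ⋂ i, {q | eval q.1.1 (pderiv i q.2.poly) = 0} := by ext; simp
    change IsClosed {q : Metric.sphere (0 : Fin 3 → ℂ) 1 × CubicForm |
        ∀ i, eval q.1.1 (pderiv i q.2.poly) = 0}
    rw [this]
    exact isClosed_iInter fun i => isClosed_eq (hcont (pderiv i).toLinearMap) continuous_const
  have hZ' : IsClosed (Prod.snd '' Z) := isClosedMap_snd_of_compactSpace _ hZ
  have h : (Projectivization.mk' ℂ : {F : CubicForm // F ≠ 0} → _) ⁻¹'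
      {F | IsNonsingular F.rep.poly} = Subtype.val ⁻¹' (Prod.snd '' Z)ᶜ := by
    ext ⟨F, hF⟩
    simp only [Set.mem_preimage, Projectivization.mk'_eq_mk, Set.mem_ofPred_eq,
      isNonsingular_rep_mk, Set.mem_compl_iff, Set.mem_image, not_exists, not_and]
    constructor
    · rintro h ⟨v, G⟩ ⟨h0, h1⟩ rfl
      obtain ⟨i, hi⟩ := h v.1 (by rintro hv; simpa [hv] using v.2) h0
      exact hi (h1 i)
    · intro h v hv h0
      by_contra! h1
      have hn : ‖v‖ ≠ 0 := norm_ne_zero_iff.2 hv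
      refine h (⟨((‖v‖⁻¹ : ℝ) : ℂ) • v, ?_⟩, F) ⟨?_, fun i => ?_⟩ rfl
      · simp [norm_smul, hn]
      · simp [eval_smul_of_isHomogeneous F.isHomogeneous, h0]
      · simp [eval_smul_of_isHomogeneous F.isHomogeneous.pderiv, h1]
  rw [h]
  exact hZ'.isOpen_compl.preimage continuous_subtype_val

/-- The space of smooth cubic plane curves: nonsingular ternary cubic forms up to scalars.
It is an open subset of `ℂℙ⁹`, from which it inherits its topology and manifold structure. -/
def SmoothCubics : TopologicalSpace.Opens (ℙ ℂ CubicForm) :=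
  ⟨{F | IsNonsingular F.rep.poly}, isOpen_isNonsingular⟩

/-- `PGL₃(ℂ)` acts on smooth cubic curves by changes of coordinates. -/
instance : MulAction PGL(3, ℂ) SmoothCubics where
  smul g F := ⟨g • F.1, by
    obtain ⟨F, hF⟩ := F
    induction g using Matrix.ProjGenLinGroup.induction_on with | mk g =>
    induction F using Projectivization.ind with | h F hF0 =>
    change IsNonsingular _ at hF
    change IsNonsingular _
    rw [isNonsingular_rep_mk] at hF
    rw [mk_smul_mk, isNonsingular_rep_mk]
    exact hF.changeCoord g⟩
  one_smul F := Subtype.ext (one_smul _ _)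
  mul_smul g h F := Subtype.ext (mul_smul _ _ _)

end Cubics

/-! ### Flex points -/

section Flex

open MvPolynomial

/-- `v` represents a flex point of the plane curve `f = 0`: it lies on the curve, and every line
`t ↦ v + t w` through `v` contained in the tangent line `∑ i, ∂ᵢf(v) xᵢ = 0` meets the curve with
multiplicity at least `3` at `t = 0`. -/
def IsFlex (f : MvPolynomial (Fin 3) ℂ) (v : Fin 3 → ℂ) : Prop :=
  eval v f = 0 ∧ ∀ w : Fin 3 → ℂ, ∑ i, eval v (pderiv i f) * w i = 0 →
    Polynomial.X ^ 3 ∣ aeval (fun i => Polynomial.C (v i) + Polynomial.C (w i) * Polynomial.X) f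

/-- The space of pairs `(F, p)` of a smooth cubic plane curve `F` and a flex point `p` of `F`. -/
def FlexPairs : Set (SmoothCubics × ℙ ℂ (Fin 3 → ℂ)) := {q | IsFlex q.1.1.rep.poly q.2.rep}

/-- The projection `(F, p) ↦ F`. -/
def flexProj (q : FlexPairs) : SmoothCubics := q.1.1

end Flex

/-! ### The Hesse pencil and the Hessian group -/

section Hesse

open MvPolynomial

/-- The parameter space `{λ | λ³ ≠ 1}` of the smooth members of the Hesse pencil. -/
def HesseParam : TopologicalSpace.Opens ℂ :=
  ⟨{l | l ^ 3 ≠ 1}, isOpen_ne_fun (by fun_prop) continuous_const⟩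

/-- The cubic form `x³ + y³ + z³ - 3λxyz`. -/
def hesseForm (l : ℂ) : CubicForm :=
  ⟨X 0 ^ 3 + X 1 ^ 3 + X 2 ^ 3 - C (3 * l) * (X 0 * X 1 * X 2), by
    have h : ∀ i : Fin 3, (X i ^ 3 : MvPolynomial (Fin 3) ℂ).IsHomogeneous 3 := fun i => by
      simpa using (isHomogeneous_X ℂ i).pow 3
    have h' : (X 0 * X 1 * X 2 : MvPolynomial (Fin 3) ℂ).IsHomogeneous 3 :=
      ((isHomogeneous_X ℂ _).mul (isHomogeneous_X ℂ _)).mul (isHomogeneous_X ℂ _)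
    exact (((h 0).add (h 1)).add (h 2)).sub (h'.C_mul _)⟩

theorem poly_hesseForm (l : ℂ) : (hesseForm l).poly =
    X 0 ^ 3 + X 1 ^ 3 + X 2 ^ 3 - C (3 * l) * (X 0 * X 1 * X 2) := rfl

theorem eval_hesseForm (l : ℂ) (v : Fin 3 → ℂ) : eval v (hesseForm l).poly =
    v 0 ^ 3 + v 1 ^ 3 + v 2 ^ 3 - 3 * l * (v 0 * v 1 * v 2) := by
  simp [poly_hesseForm]

theorem hesseForm_ne_zero (l : ℂ) : hesseForm l ≠ 0 := fun h => by
  have := eval_hesseForm l ![1, 0, 0]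
  simp [h] at this

theorem isNonsingular_hesseForm {l : ℂ} (hl : l ^ 3 ≠ 1) : IsNonsingular (hesseForm l).poly := by
  intro v hv _
  by_contra! h
  have h0 := h 0
  have h1 := h 1
  have h2 := h 2
  simp [poly_hesseForm, pderiv_X] at h0 h1 h2
  have e0 : v 0 ^ 2 = l * v 1 * v 2 := by linear_combination h0 / 3
  have e1 : v 1 ^ 2 = l * v 0 * v 2 := by linear_combination h1 / 3
  have e2 : v 2 ^ 2 = l * v 0 * v 1 := by linear_combination h2 / 3
  have hp : v 0 * v 1 * v 2 = 0 := by
    have : (l ^ 3 - 1) * (v 0 * v 1 * v 2) ^ 2 = 0 := by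
      linear_combination -(v 1 ^ 2 * v 2 ^ 2) * e0 - (l * v 1 * v 2 * v 2 ^ 2) * e1
        - (l * v 1 * v 2 * (l * v 0 * v 2)) * e2
    simpa [sub_eq_zero, hl] using this
  have hz : v 0 = 0 ∧ v 1 = 0 ∧ v 2 = 0 := by
    rcases mul_eq_zero.1 hp with h | h
    · rcases mul_eq_zero.1 h with h | h <;> simp_all
    · simp_all
  exact hv (funext fun i => by fin_cases i <;> simp [hz])

/-- The smooth cubic curve `F_λ : x³ + y³ + z³ - 3λxyz = 0`, for `λ³ ≠ 1`. -/
def hesse (l : HesseParam) : SmoothCubics :=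
  ⟨Projectivization.mk ℂ (hesseForm l) (hesseForm_ne_zero _),
    (isNonsingular_rep_mk _).2 (isNonsingular_hesseForm l.2)⟩

theorem hesse_injective : Function.Injective hesse := by
  intro l m h
  obtain ⟨a, ha⟩ := (Projectivization.mk_eq_mk_iff' ℂ _ _ _ _).1 (congrArg Subtype.val h)
  have h1 := congrArg (fun F => eval ![1, 0, 0] (CubicForm.poly F)) ha
  have h2 := congrArg (fun F => eval ![1, 1, 1] (CubicForm.poly F)) ha
  simp only [map_smul, smul_eval, eval_hesseForm] at h1 h2
  simp at h1 h2
  subst h1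
  refine Subtype.ext ?_
  linear_combination h2 / 3

theorem continuous_hesse : Continuous hesse := by
  let P : CubicForm := hesseForm 1 - hesseForm 0
  have h : ∀ l, hesseForm l = hesseForm 0 + l • P := fun l => by
    refine CubicForm.poly_injective (funext fun v => ?_)
    simp only [P, map_add, map_smul, map_sub, smul_eval, eval_hesseForm]
    ring
  have hc : Continuous hesseForm := by
    rw [funext h]
    fun_prop
  exact (isOpenQuotientMap_mk'.continuous.comp
    ((hc.comp continuous_subtype_val).subtype_mk fun _ => hesseForm_ne_zero _)).subtype_mk _

/-- The parameter of a member of the Hesse pencil, as a function of its form. -/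
def hesseInv (F : SmoothCubics) : ℂ :=
  1 - eval ![1, 1, 1] F.1.rep.poly / (3 * eval ![1, 0, 0] F.1.rep.poly)

theorem hesseInv_hesse (l : HesseParam) : hesseInv (hesse l) = l := by
  obtain ⟨a, ha⟩ := Projectivization.exists_smul_eq_mk_rep ℂ _ (hesseForm_ne_zero l)
  have ha0 := a.ne_zero
  rw [hesseInv, hesse, ← ha, Units.smul_def]
  simp only [map_smul, smul_eval, eval_hesseForm]
  simp
  field_simp
  ring

theorem continuousAt_hesseInv (l : HesseParam) : ContinuousAt hesseInv (hesse l) := by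
  let N : ℙ ℂ CubicForm → ℂ := fun F =>
    1 - eval ![1, 1, 1] F.rep.poly / (3 * eval ![1, 0, 0] F.rep.poly)
  have hev : ∀ v : Fin 3 → ℂ, Continuous fun F : {F : CubicForm // F ≠ 0} =>
      eval v F.1.poly := fun v => by
    let L : CubicForm →ₗ[ℂ] ℂ := (aeval (R := ℂ) v).toLinearMap ∘ₗ CubicForm.poly
    exact L.continuous_of_finiteDimensional.comp continuous_subtype_val
  let W : Set {F : CubicForm // F ≠ 0} := {F | eval ![1, 0, 0] F.1.poly ≠ 0}
  have hW : IsOpen W := isOpen_ne_fun (hev _) continuous_const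
  have hN : ContinuousOn N (Projectivization.mk' ℂ '' W) := by
    refine (isOpenQuotientMap_mk'.isQuotientMap.continuousOn_isOpen_iff
      (isOpenQuotientMap_mk'.isOpenMap _ hW)).2 ?_
    have hN' : ∀ F, (N ∘ Projectivization.mk' ℂ) F =
        1 - eval ![1, 1, 1] F.1.poly / (3 * eval ![1, 0, 0] F.1.poly) := fun F => by
      obtain ⟨a, ha⟩ := Projectivization.exists_smul_eq_mk_rep ℂ F.1 F.2
      have ha0 := a.ne_zero
      simp only [N, Function.comp, Projectivization.mk'_eq_mk, ← ha, Units.smul_def, map_smul,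
        smul_eval]
      rw [mul_left_comm, mul_div_mul_left _ _ ha0]
    refine ContinuousOn.congr (f := fun F : {F : CubicForm // F ≠ 0} =>
      1 - eval ![1, 1, 1] F.1.poly / (3 * eval ![1, 0, 0] F.1.poly)) ?_ fun F _ => hN' F
    refine continuousOn_const.sub ((hev _).continuousOn.div
      (continuousOn_const.mul (hev _).continuousOn) ?_)
    rintro F ⟨G, hG, hGF⟩
    obtain ⟨a, ha⟩ := (Projectivization.mk_eq_mk_iff ℂ _ _ G.2 F.2).1 hGF
    intro h
    refine hG ?_
    rw [← ha, Units.smul_def, map_smul, smul_eval]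
    simpa using h
  have hmem : (hesse l).1 ∈ Projectivization.mk' ℂ '' W :=
    ⟨⟨hesseForm l, hesseForm_ne_zero _⟩, by simp [W, eval_hesseForm], rfl⟩
  exact (hN.continuousAt ((isOpenQuotientMap_mk'.isOpenMap _ hW).mem_nhds hmem)).comp
    continuous_subtype_val.continuousAt

theorem continuous_smul_smoothCubics (g : PGL(3, ℂ)) :
    Continuous fun F : SmoothCubics => g • F :=
  ((continuous_smul_proj g).comp continuous_subtype_val).subtype_mk _

/-- `v` lies on all members of the Hesse pencil. -/
def IsBasePoint (v : Fin 3 → ℂ) : Prop := v 0 ^ 3 + v 1 ^ 3 + v 2 ^ 3 = 0 ∧ v 0 * v 1 * v 2 = 0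

/-- The elements of `PGL₃(ℂ)` mapping each smooth member of the Hesse pencil to such a member. -/
def pencilStabilizer : Submonoid PGL(3, ℂ) where
  carrier := {g | ∀ l, ∃ m, g • hesse l = hesse m}
  one_mem' l := ⟨l, one_smul _ _⟩
  mul_mem' {g h} hg hh l := by
    obtain ⟨m, hm⟩ := hh l
    obtain ⟨k, hk⟩ := hg m
    exact ⟨k, by rw [mul_smul, hm, hk]⟩

theorem IsBasePoint.smul {g : GL (Fin 3) ℂ} (hg : Matrix.ProjGenLinGroup.mk g ∈ pencilStabilizer)
    {v : Fin 3 → ℂ} (hv : IsBasePoint v) : IsBasePoint (g • v) := by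
  have key : ∀ l : HesseParam, ∃ m : HesseParam, Matrix.ProjGenLinGroup.mk g • hesse l = hesse m ∧
      eval (g • v) (hesseForm m).poly = 0 := fun l => by
    obtain ⟨m, hm⟩ := hg l
    refine ⟨m, hm, ?_⟩
    obtain ⟨a, ha⟩ := (Projectivization.mk_eq_mk_iff ℂ _ _ _ _).1 (congrArg Subtype.val hm)
    have ha0 := a.ne_zero
    change a.1 • hesseForm m = g • hesseForm l at ha
    have h := congrArg (fun F => eval (g • v) (CubicForm.poly F)) ha
    simp only [map_smul, smul_eval, poly_smul, eval_changeCoord,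
      inv_smul_smul, eval_hesseForm l, hv.1, hv.2] at h
    simpa [ha0] using h
  obtain ⟨m₀, h₀, e₀⟩ := key ⟨0, by simp [HesseParam]⟩
  obtain ⟨m₂, h₂, e₂⟩ := key ⟨2, by norm_num [HesseParam]⟩
  have hm : (m₂ : ℂ) - m₀ ≠ 0 := fun h => by
    have h' : m₂ = m₀ := Subtype.ext (sub_eq_zero.1 h)
    rw [h', ← h₀] at h₂
    simpa using congrArg Subtype.val (hesse_injective (smul_left_cancel _ h₂))
  rw [eval_hesseForm] at e₀ e₂
  have h : (g • v) 0 * (g • v) 1 * (g • v) 2 = 0 := by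
    refine (mul_eq_zero.1 ?_).resolve_left hm
    linear_combination (e₀ - e₂) / 3
  exact ⟨by linear_combination e₀ + 3 * (m₀ : ℂ) * h, h⟩

/-- The base points of the Hesse pencil. -/
def basePoints : Set (ℙ ℂ (Fin 3 → ℂ)) := {p | IsBasePoint p.rep}

theorem isBasePoint_rep_mk {v : Fin 3 → ℂ} (hv : v ≠ 0) :
    IsBasePoint (Projectivization.mk ℂ v hv).rep ↔ IsBasePoint v := by
  obtain ⟨a, ha⟩ := Projectivization.exists_smul_eq_mk_rep ℂ v hv
  have ha0 := a.ne_zero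
  rw [← ha, Units.smul_def, IsBasePoint, IsBasePoint]
  simp only [Pi.smul_apply, smul_eq_mul, mul_pow, ← mul_add]
  simp [ha0]

theorem finite_basePoints : basePoints.Finite := by
  let b : Fin 3 → ℂ → Fin 3 → ℂ := ![fun t => ![0, 1, -t], fun t => ![1, 0, -t], fun t => ![1, -t, 0]]
  have hb : ∀ k t, b k t ≠ 0 := fun k t h => by
    have h0 := congrFun h 0
    have h1 := congrFun h 1
    fin_cases k <;> simp [b] at h0 h1
  have hR : {t : ℂ | t ^ 3 = 1}.Finite :=
    (Polynomial.nthRootsFinset 3 (1 : ℂ)).finite_toSet.subset fun t ht =>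
      (Polynomial.mem_nthRootsFinset (by norm_num) _).2 ht
  refine ((Set.finite_univ (α := Fin 3)).image2
    (fun k t => Projectivization.mk ℂ (b k t) (hb k t)) hR).subset fun p hp => ?_
  have key : ∀ x y : ℂ, x ^ 3 + y ^ 3 = 0 → x ≠ 0 → (-y / x) ^ 3 = 1 := fun x y h hx => by
    field_simp
    linear_combination -h
  have key' : ∀ x y : ℂ, x ^ 3 + y ^ 3 = 0 → x = 0 → y = 0 := fun x y h hx => by
    simpa [hx] using h
  induction p using Projectivization.ind with | h v hv =>
  obtain ⟨hs, hp⟩ := (isBasePoint_rep_mk hv).1 hp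
  have done : ∀ k (x y : ℂ), x ^ 3 + y ^ 3 = 0 → (x ≠ 0 → x • b k (-y / x) = v) → (x ≠ 0) →
      Projectivization.mk ℂ v hv ∈ Set.image2
        (fun k t => Projectivization.mk ℂ (b k t) (hb k t)) Set.univ {t : ℂ | t ^ 3 = 1} :=
    fun k x y hxy hx h0 => ⟨k, trivial, -y / x, key x y hxy h0,
      ((Projectivization.mk_eq_mk_iff' ℂ _ _ _ _).2 ⟨x, hx h0⟩).symm⟩
  rcases mul_eq_zero.1 hp with h | h
  · rcases mul_eq_zero.1 h with h | h
    · refine done 0 (v 1) (v 2) (by simpa [h] using hs) (fun hx => ?_) fun hx => hv ?_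
      · ext i; fin_cases i <;> simp [b, h]; field_simp
      · have := key' (v 1) (v 2) (by simpa [h] using hs) hx
        ext i; fin_cases i <;> simp [*]
    · refine done 1 (v 0) (v 2) (by simpa [h] using hs) (fun hx => ?_) fun hx => hv ?_
      · ext i; fin_cases i <;> simp [b, h]; field_simp
      · have := key' (v 0) (v 2) (by simpa [h] using hs) hx
        ext i; fin_cases i <;> simp [*]
  · refine done 2 (v 0) (v 1) (by simpa [h] using hs) (fun hx => ?_) fun hx => hv ?_
    · ext i; fin_cases i <;> simp [b, h]; field_simp
    · have := key' (v 0) (v 1) (by simpa [h] using hs) hx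
      ext i; fin_cases i <;> simp [*]

theorem smul_mem_basePoints {g : PGL(3, ℂ)} (hg : g ∈ pencilStabilizer)
    {p : ℙ ℂ (Fin 3 → ℂ)} (hp : p ∈ basePoints) : g • p ∈ basePoints := by
  induction g using Matrix.ProjGenLinGroup.induction_on with | mk g =>
  induction p using Projectivization.ind with | h v hv =>
  exact (isBasePoint_rep_mk _).2 (((isBasePoint_rep_mk hv).1 hp).smul hg)

theorem eq_one_of_fixes_basePoints {g : PGL(3, ℂ)} (hg : ∀ p ∈ basePoints, g • p = p) :
    g = 1 := by
  induction g using Matrix.ProjGenLinGroup.induction_on with | mk g =>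
  have hfix : ∀ v : Fin 3 → ℂ, v ≠ 0 → IsBasePoint v → ∃ a : ℂ, a • v = g • v :=
    fun v hv hb => (Projectivization.mk_eq_mk_iff' ℂ _ _ _ _).1
      (hg (Projectivization.mk ℂ v hv) ((isBasePoint_rep_mk hv).2 hb))
  have h0 : ∀ t : ℂ, t ^ 3 = 1 → g 0 1 - t * g 0 2 = 0 ∧
      g 2 1 - t * g 2 2 + t * (g 1 1 - t * g 1 2) = 0 := fun t ht => by
    obtain ⟨a, ha⟩ := hfix ![0, 1, -t] (fun h => by simpa using congrFun h 1)
      ⟨by simp [Odd.neg_pow (by decide : Odd 3), ht], by simp⟩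
    have e0 := congrFun ha 0
    have e1 := congrFun ha 1
    have e2 := congrFun ha 2
    simp [Units.smul_def, Matrix.mulVec, dotProduct, Fin.sum_univ_three] at e0 e1 e2
    exact ⟨by linear_combination -e0, by linear_combination -e2 - t * e1⟩
  have h1 : ∀ t : ℂ, t ^ 3 = 1 → g 1 0 - t * g 1 2 = 0 ∧
      g 2 0 - t * g 2 2 + t * (g 0 0 - t * g 0 2) = 0 := fun t ht => by
    obtain ⟨a, ha⟩ := hfix ![1, 0, -t] (fun h => by simpa using congrFun h 0)
      ⟨by simp [Odd.neg_pow (by decide : Odd 3), ht], by simp⟩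
    have e0 := congrFun ha 0
    have e1 := congrFun ha 1
    have e2 := congrFun ha 2
    simp [Units.smul_def, Matrix.mulVec, dotProduct, Fin.sum_univ_three] at e0 e1 e2
    exact ⟨by linear_combination -e1, by linear_combination -e2 - t * e0⟩
  obtain ⟨w, hw, hw1⟩ : ∃ w : ℂ, w ^ 3 = 1 ∧ w - 1 ≠ 0 := by
    have h := Complex.isPrimitiveRoot_exp 3 (by norm_num)
    exact ⟨_, h.pow_eq_one, sub_ne_zero.2 (h.ne_one (by norm_num))⟩
  have c1 := h0 1 (by simp)
  have cw := h0 w hw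
  have d1 := h1 1 (by simp)
  have dw := h1 w hw
  have g02 : g 0 2 = 0 := (mul_eq_zero.1 (by linear_combination c1.1 - cw.1 :
    (w - 1) * g 0 2 = 0)).resolve_left hw1
  have g12 : g 1 2 = 0 := (mul_eq_zero.1 (by linear_combination d1.1 - dw.1 :
    (w - 1) * g 1 2 = 0)).resolve_left hw1
  have g01 : g 0 1 = 0 := by linear_combination c1.1 + g02
  have g10 : g 1 0 = 0 := by linear_combination d1.1 + g12
  have g11 : g 1 1 = g 2 2 := sub_eq_zero.1 <| (mul_eq_zero.1 (by
    linear_combination cw.2 - c1.2 + (w ^ 2 - 1) * g12 :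
    (w - 1) * (g 1 1 - g 2 2) = 0)).resolve_left hw1
  have g00 : g 0 0 = g 2 2 := sub_eq_zero.1 <| (mul_eq_zero.1 (by
    linear_combination dw.2 - d1.2 + (w ^ 2 - 1) * g02 :
    (w - 1) * (g 0 0 - g 2 2) = 0)).resolve_left hw1
  have g21 : g 2 1 = 0 := by linear_combination c1.2 - g11 + g12
  have g20 : g 2 0 = 0 := by linear_combination d1.2 - g00 + g02
  have hu : g 2 2 ≠ 0 := fun h => g.ne_zero (by
    ext i j
    fin_cases i <;> fin_cases j <;> simp [*])
  rw [← map_one Matrix.ProjGenLinGroup.mk, eq_comm, Matrix.ProjGenLinGroup.mk_eq_mk_iff]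
  refine ⟨Units.mk0 _ hu, ?_⟩
  rw [one_mul]
  ext i j
  fin_cases i <;> fin_cases j <;> simp [*]

theorem finite_pencilStabilizer : (pencilStabilizer : Set PGL(3, ℂ)).Finite := by
  have := finite_basePoints.to_subtype
  let f : pencilStabilizer → basePoints → basePoints :=
    fun g p => ⟨g.1 • p.1, smul_mem_basePoints g.2 p.2⟩
  refine Set.finite_coe_iff.1 (Finite.of_injective f fun g h hgh => ?_)
  refine Subtype.ext (inv_mul_eq_one.1 (eq_one_of_fixes_basePoints fun p hp => ?_)).symm
  rw [mul_smul, inv_smul_eq_iff]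
  exact congrArg Subtype.val (congrFun hgh ⟨p, hp⟩)

/-- The Hessian group: the subgroup of `PGL₃(ℂ)` preserving the Hesse pencil. -/
def hessianGroup : Subgroup PGL(3, ℂ) where
  carrier := {g | ∀ l, ∃ m, g • hesse l = hesse m}
  one_mem' := pencilStabilizer.one_mem
  mul_mem' := pencilStabilizer.mul_mem
  inv_mem' {g} hg := by
    have hfin : IsOfFinOrder g := finite_powers.1
      (finite_pencilStabilizer.subset (Submonoid.powers_le.2 (show g ∈ pencilStabilizer from hg)))
    have := hfin.mem_powers_iff_mem_zpowers.2 (Subgroup.inv_mem _ (Subgroup.mem_zpowers g))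
    exact Submonoid.powers_le.2 (show g ∈ pencilStabilizer from hg) this

instance : Finite hessianGroup := finite_pencilStabilizer.to_subtype

/-- The Hessian group acts on the parameter space of the Hesse pencil, `F_{g • λ} = g • F_λ`. -/
instance : MulAction hessianGroup HesseParam where
  smul g l := (g.2 l).choose
  one_smul l := hesse_injective (by
    refine ((1 : hessianGroup).2 l).choose_spec.symm.trans (one_smul _ _))
  mul_smul g h l := hesse_injective (by
    refine ((g * h).2 l).choose_spec.symm.trans ((mul_smul g.1 h.1 _).trans ?_)
    rw [(h.2 l).choose_spec]
    exact (g.2 _).choose_spec)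

theorem hesse_smul (g : hessianGroup) (l : HesseParam) : hesse (g • l) = g.1 • hesse l :=
  (g.2 l).choose_spec.symm

instance : ContinuousConstSMul hessianGroup HesseParam where
  continuous_const_smul g := by
    refine continuous_induced_rng.2 ?_
    have h : (fun l : HesseParam => ((g • l : HesseParam) : ℂ)) =
        fun l => hesseInv (g.1 • hesse l) := funext fun l => by
      rw [← hesse_smul, hesseInv_hesse]
    change Continuous fun l : HesseParam => ((g • l : HesseParam) : ℂ)
    rw [h]
    refine continuous_iff_continuousAt.2 fun l => ?_
    refine ContinuousAt.comp (g := hesseInv) ?_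
      ((continuous_smul_smoothCubics g.1).comp continuous_hesse).continuousAt
    rw [← hesse_smul]
    exact continuousAt_hesseInv _

/-- The common flex point `p₀ = [1 : -1 : 0]` of the curves in the Hesse pencil. -/
def basePoint : ℙ ℂ (Fin 3 → ℂ) :=
  Projectivization.mk ℂ ![1, -1, 0] fun h => one_ne_zero (congrFun h 0)

/-- The subgroup of the Hessian group fixing `p₀`. -/
def hessianGroup₀ : Subgroup hessianGroup := MulAction.stabilizer hessianGroup basePoint

end Hesse

/-! ### The twisted products -/

section Twisted

/-- The product `PGL₃(ℂ) × {λ | λ³ ≠ 1}`. -/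
def TotalSpace : Type := PGL(3, ℂ) × HesseParam

namespace TotalSpace

/-- The manifold `PGL₃(ℂ) × {λ | λ³ ≠ 1}` is modelled on this space. -/
abbrev Model : Type := ModelProd (AffineModel (Fin 3 × Fin 3)) ℂ

instance : TopologicalSpace TotalSpace := inferInstanceAs (TopologicalSpace (PGL(3, ℂ) × HesseParam))

instance : T2Space TotalSpace := inferInstanceAs (T2Space (PGL(3, ℂ) × HesseParam))

instance : LocallyCompactSpace TotalSpace :=
  haveI : LocallyCompactSpace HesseParam := HesseParam.2.locallyCompactSpace
  inferInstanceAs (LocallyCompactSpace (PGL(3, ℂ) × HesseParam))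

instance : ChartedSpace Model TotalSpace :=
  inferInstanceAs (ChartedSpace Model (PGL(3, ℂ) × HesseParam))

instance : IsManifold (𝓘(ℝ, AffineModel (Fin 3 × Fin 3)).prod 𝓘(ℝ, ℂ)) ∞ TotalSpace :=
  inferInstanceAs (IsManifold _ ∞ (PGL(3, ℂ) × HesseParam))

/-- The diagonal action of the Hessian group `Γ` on `PGL₃(ℂ) × {λ | λ³ ≠ 1}`: the right
multiplication on `PGL₃(ℂ)` is turned into a left action, `γ • (g, λ) = (g γ⁻¹, γ • λ)`. -/
instance : MulAction hessianGroup TotalSpace where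
  smul c x := (x.1 * (c.1)⁻¹, c • x.2)
  one_smul x := Prod.ext (by change x.1 * 1⁻¹ = x.1; simp) (one_smul _ x.2)
  mul_smul c d x := Prod.ext
    (by change x.1 * (c.1 * d.1)⁻¹ = x.1 * d.1⁻¹ * c.1⁻¹; group) (mul_smul c d x.2)

instance : IsCancelSMul hessianGroup TotalSpace where
  left_cancel' c _ _ h := smul_left_cancel c h
  right_cancel' c d x h := by
    have h1 : x.1 * c.1⁻¹ = x.1 * d.1⁻¹ := congrArg Prod.fst h
    exact Subtype.ext (inv_injective (mul_left_cancel h1))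

instance : ContinuousConstSMul hessianGroup TotalSpace where
  continuous_const_smul c :=
    (continuous_fst.mul continuous_const).prodMk (continuous_snd.const_smul c)

instance (K : Subgroup hessianGroup) : ContinuousConstSMul K TotalSpace where
  continuous_const_smul c := continuous_const_smul c.1

end TotalSpace

/-- The twisted product `PGL₃(ℂ) ×_K {λ | λ³ ≠ 1}`: the orbit space of the diagonal action of `K`,
where `K` is the Hessian group or a subgroup of it. It carries the quotient topology, and the
manifold structure for which the quotient map is a local diffeomorphism. -/
abbrev TwistedProduct (K : Type) [Group K] [MulAction K TotalSpace] : Type :=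
  MulAction.orbitRel.Quotient K TotalSpace

/-- The class of `(g, λ)` in a twisted product. -/
def TwistedProduct.mk (K : Type) [Group K] [MulAction K TotalSpace] (g : PGL(3, ℂ))
    (l : HesseParam) : TwistedProduct K :=
  Quotient.mk _ ((g, l) : TotalSpace)

/-- The natural projection `PGL₃(ℂ) ×_{Γ₀} H → PGL₃(ℂ) ×_Γ H`. -/
def twistedProj : TwistedProduct hessianGroup₀ → TwistedProduct hessianGroup :=
  Quotient.map' id fun _ _ ⟨c, hc⟩ => ⟨c.1, hc⟩

end Twisted

/-- `ℂℙ²`, as a real smooth manifold, is modelled on `ℂ²`. -/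
abbrev modelPlane := 𝓘(ℝ, AffineModel (Fin 3))

/-- The space of smooth cubics, as a real smooth manifold, is modelled on `ℂ⁹`. -/
abbrev modelCubics := 𝓘(ℝ, AffineModel CubicExponent)

/-- `PGL₃(ℂ) × {λ | λ³ ≠ 1}`, as a real smooth manifold, is modelled on `ℂ⁸ × ℂ`. -/
abbrev modelPGLH := 𝓘(ℝ, AffineModel (Fin 3 × Fin 3)).prod 𝓘(ℝ, ℂ)

end FlexCover

end

open FlexCover

/-! Everything follows from the orbit map `(g, λ) ↦ g • F_λ` and its refinement `(g, λ) ↦ (g • F_λ,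
g • p₀)`. Both are shown to be smooth and surjective, to have smooth local sections, and to have as
fibres exactly the orbits of `Γ`, respectively `Γ₀`. Such a map induces a diffeomorphism from the
orbit space: its inverse is locally a section followed by the quotient map (`orbitDiffeomorph`).

Surjectivity is a normal form. A smooth cubic has a flex, because the cubic and its Hessian
determinant have a common zero besides the origin (`exists_isFlex`, by Krull's height theorem). A
chosen flex is put into a Weierstrass frame, and a further linear change, built from a root of the
3-division quartic, turns the cubic into some `F_λ` and the flex into `p₀`
(`exists_hesse_of_isFlex`). Because the flex is prescribed, this proves surjectivity for flex pairs
as well.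

The fibres rest on one fact: all smooth members of the Hesse pencil have the same flexes, namely the
nine base points (`isFlex_hesse_iff`). If `g • F_λ = F_μ`, then `g⁻¹` preserves this set, so each `g
• F_κ` passes through the nine points. Cubics through them form the pencil, hence `g` lies in `Γ`
(`mem_hessianGroup_of_smul_eq`).

Local sections come from the inverse function theorem. The ten coefficients of `F_μ ∘ m` depend on
the nine entries of `m` and on `μ`, and at `(1, λ)` the linearization is invertible precisely
because `λ³ ≠ 1` (`exists_hesse_frame`).

A section `s` of the orbit map over an open set `U` trivializes the flexes: `p ↦ s(F).1⁻¹ • p`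
carries the flexes of `F` to the fixed nine-point set. So `flexProj` is a 9-sheeted covering, the
space of flex pairs inherits charts from the base, and it is embedded because it is locally the
graph of the smooth map `F ↦ s(F).1 • p₀`. The projection of twisted products is conjugate to
`flexProj` under `φ` and `ψ`, so it has the same properties. -/

namespace FlexCover

open Set Filter Topology

/-! ### Manifold structures transported by partial homeomorphisms -/

section Transitions

variable {E H M N : Type*} [NormedAddCommGroup E] [NormedSpace ℝ E] [TopologicalSpace H]
  {I : ModelWithCorners ℝ E H} [TopologicalSpace M] [ChartedSpace H M] [IsManifold I ∞ M]
  [TopologicalSpace N] [ChartedSpace H N]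

/-- If the charts of `N` are obtained from charts of a manifold `M` by means of a family of partial
homeomorphisms `N → M` with smooth transition maps, then `N` is a manifold. -/
theorem isManifold_of_transitions (S : Set (OpenPartialHomeomorph N M))
    (hS : ∀ s ∈ S, ∀ t ∈ S, ContMDiffOn I I ∞ (s.symm ≫ₕ t) (s.symm ≫ₕ t).source)
    (hN : ∀ e ∈ atlas H N, ∃ s ∈ S, ∃ c ∈ atlas H M, e = s ≫ₕ c) : IsManifold I ∞ N := by
  refine isManifold_of_contDiffOn I ∞ N fun e e' he he' => ?_
  obtain ⟨s, hs, c, hc, rfl⟩ := hN e he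
  obtain ⟨t, ht, d, hd, rfl⟩ := hN e' he'
  rw [← contMDiffOn_iff_contDiffOn]
  have h1 := contMDiffOn_symm_of_mem_maximalAtlas (I := I) (n := ∞)
    (IsManifold.subset_maximalAtlas hc)
  have h2 := contMDiffOn_of_mem_maximalAtlas (I := I) (n := ∞) (IsManifold.subset_maximalAtlas hd)
  refine I.contMDiff.comp_contMDiffOn (f := ((s ≫ₕ c).symm ≫ₕ t ≫ₕ d) ∘ I.symm) ?_
  refine ContMDiffOn.comp (t := ((s ≫ₕ c).symm ≫ₕ t ≫ₕ d).source) (I' := I) ?_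
    (I.contMDiffOn_symm.mono inter_subset_right) inter_subset_left
  have h3 : ContMDiffOn I I ∞ (d ∘ (s.symm ≫ₕ t) ∘ c.symm)
      ((s ≫ₕ c).symm ≫ₕ t ≫ₕ d).source := by
    refine h2.comp ((hS s hs t ht).comp (h1.mono ?_) ?_) ?_
    · intro z hz
      simp at hz
      exact hz.1.1
    · intro z hz
      simp at hz
      simp [hz]
    · intro z hz
      simp at hz
      simp [hz]
  exact h3

/-- Locally `s` is the chart `s ≫ₕ c` of `N` followed by the inverse of the chart `c` of `M`, and
both are smooth. -/
theorem contMDiffAt_of_trans_mem_atlas [IsManifold I ∞ N] {s : OpenPartialHomeomorph N M}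
    {c : OpenPartialHomeomorph M H} (hc : c ∈ atlas H M) (hsc : s ≫ₕ c ∈ atlas H N) {y : N}
    (hy : y ∈ s.source) (hyc : s y ∈ c.source) : ContMDiffAt I I ∞ s y := by
  have h1 := contMDiffOn_symm_of_mem_maximalAtlas (I := I) (n := ∞)
    (IsManifold.subset_maximalAtlas hc)
  have h2 := contMDiffOn_of_mem_maximalAtlas (I := I) (n := ∞) (IsManifold.subset_maximalAtlas hsc)
  have hy' : y ∈ (s ≫ₕ c).source := by simp [hy, hyc]
  have h3 : ContMDiffOn I I ∞ (c.symm ∘ (s ≫ₕ c)) (s ≫ₕ c).source :=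
    h1.comp h2 fun z hz => by
      simp at hz
      exact c.map_source hz.2
  refine (h3.contMDiffAt ((s ≫ₕ c).open_source.mem_nhds hy')).congr_of_eventuallyEq ?_
  filter_upwards [(s ≫ₕ c).open_source.mem_nhds hy'] with z hz
  simp at hz
  simp [hz.2]

theorem contMDiffAt_symm_of_trans_mem_atlas [IsManifold I ∞ N] {s : OpenPartialHomeomorph N M}
    {c : OpenPartialHomeomorph M H} (hc : c ∈ atlas H M) (hsc : s ≫ₕ c ∈ atlas H N) {x : M}
    (hx : x ∈ s.target) (hxc : x ∈ c.source) : ContMDiffAt I I ∞ s.symm x := by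
  have h1 := contMDiffOn_of_mem_maximalAtlas (I := I) (n := ∞) (IsManifold.subset_maximalAtlas hc)
  have h2 := contMDiffOn_symm_of_mem_maximalAtlas (I := I) (n := ∞)
    (IsManifold.subset_maximalAtlas hsc)
  have hmem : s.target ∩ c.source ∈ 𝓝 x := (s.open_target.inter c.open_source).mem_nhds ⟨hx, hxc⟩
  have h3 : ContMDiffOn I I ∞ ((s ≫ₕ c).symm ∘ c) (s.target ∩ c.source) :=
    h2.comp (h1.mono inter_subset_right) fun z hz => by
      simp [hz.1, hz.2]
  refine (h3.contMDiffAt hmem).congr_of_eventuallyEq ?_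
  filter_upwards [hmem] with z hz
  simp [hz.2]

end Transitions

/-! ### Smooth local sections in place of the inverse function theorem -/

section LocalSections

variable {E E' H H' M N : Type*} [NormedAddCommGroup E] [NormedSpace ℝ E] [TopologicalSpace H]
  [NormedAddCommGroup E'] [NormedSpace ℝ E'] [TopologicalSpace H']
  (I : ModelWithCorners ℝ E H) (J : ModelWithCorners ℝ E' H') [TopologicalSpace M]
  [ChartedSpace H M] [TopologicalSpace N] [ChartedSpace H' N]

/-- `f` has a smooth local section through `x`. -/
def HasSmoothSectionAt (f : M → N) (x : M) : Prop :=
  ∃ s : N → M, ContMDiffAt J I ∞ s (f x) ∧ s (f x) = x ∧ ∀ᶠ y in 𝓝 (f x), f (s y) = y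

variable {I J}

/-- A local homeomorphism is injective near `x`, so its continuous local inverse must coincide with
the smooth section through `x`, and is therefore smooth. -/
theorem isLocalDiffeomorph_of_section {f : M → N} (hf : IsLocalHomeomorph f)
    (hs : ContMDiff I J ∞ f) (hsec : ∀ x, HasSmoothSectionAt I J f x) :
    IsLocalDiffeomorph I J ∞ f := by
  intro x
  obtain ⟨e, hx, rfl⟩ := hf x
  refine ⟨⟨e.toPartialEquiv, e.open_source, e.open_target, hs.contMDiffOn, ?_⟩, hx, fun _ _ => rfl⟩
  intro y hy
  obtain ⟨s, h1, h2, h3⟩ := hsec (e.symm y)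
  rw [e.right_inv hy] at h1 h2 h3
  refine ContMDiffAt.contMDiffWithinAt (h1.congr_of_eventuallyEq ?_)
  have h4 : ∀ᶠ z in 𝓝 y, s z ∈ e.source := by
    refine h1.continuousAt.eventually_mem (e.open_source.mem_nhds ?_)
    rw [h2]
    exact e.map_target hy
  filter_upwards [h3, h4] with z hz hz'
  change e.symm z = s z
  conv_lhs => rw [← hz]
  exact e.left_inv hz'

end LocalSections

/-! ### Smooth quotients by free properly discontinuous actions -/

section Quotient

variable {E H M G : Type*} [NormedAddCommGroup E] [NormedSpace ℝ E] [TopologicalSpace H]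
  {I : ModelWithCorners ℝ E H} [TopologicalSpace M] [ChartedSpace H M] [Group G] [MulAction G M]

open MulAction

/-- Two local inverses of the quotient map differ at `x` by some group element `g`. By continuity `g
• z` stays in the target of `t`, so the same `g` works for all `z` near `x` and the transition is
locally the action of `g`. -/
theorem contMDiffOn_transition_of_quotientMk
    (hsmooth : ∀ g : G, ContMDiff I I ∞ fun x : M => g • x)
    {s t : OpenPartialHomeomorph (orbitRel.Quotient G M) M}
    (hs : ⇑s.symm = Quotient.mk _) (ht : ⇑t.symm = Quotient.mk _) :
    ContMDiffOn I I ∞ (s.symm ≫ₕ t) (s.symm ≫ₕ t).source := by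
  intro x hx
  refine ContMDiffAt.contMDiffWithinAt ?_
  have hx' : s.symm x ∈ t.source := by
    simp only [OpenPartialHomeomorph.trans_source, OpenPartialHomeomorph.symm_source] at hx
    exact hx.2
  have h1 : (Quotient.mk _ (t (s.symm x)) : orbitRel.Quotient G M) = Quotient.mk _ x := by
    rw [← congrFun ht, t.left_inv hx', hs]
  obtain ⟨g, hg⟩ := Quotient.exact h1
  replace hg : g • x = t (s.symm x) := hg
  refine ((hsmooth g).contMDiffAt (x := x)).congr_of_eventuallyEq ?_
  have h2 : ∀ᶠ z in 𝓝 x, g • z ∈ t.target := by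
    refine (hsmooth g).continuous.continuousAt.eventually_mem (t.open_target.mem_nhds ?_)
    simp only [hg]
    exact t.map_source hx'
  filter_upwards [h2] with z hz
  have h3 : s.symm z = t.symm (g • z) := by
    rw [hs, ht]
    exact (Quotient.sound ⟨g, rfl⟩ :
      (Quotient.mk _ (g • z) : orbitRel.Quotient G M) = Quotient.mk _ z).symm
  simp [h3, t.right_inv hz]

variable [ProperlyDiscontinuousSMul G M] [ContinuousConstSMul G M] [IsCancelSMul G M] [T2Space M]
  [LocallyCompactSpace M]

variable (M G) in
theorem isLocalHomeomorph_quotientMk :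
    IsLocalHomeomorph (Quotient.mk _ : M → orbitRel.Quotient G M) :=
  (isQuotientCoveringMap_quotientMk_of_properlyDiscontinuousSMul
    (E := M) (G := G)).isCoveringMap.isLocalHomeomorph

variable [IsManifold I ∞ M]

theorem isManifold_quotient (hsmooth : ∀ g : G, ContMDiff I I ∞ fun x : M => g • x) :
    IsManifold I ∞ (orbitRel.Quotient G M) := by
  refine isManifold_of_transitions (M := M)
    {s | ⇑s.symm = (Quotient.mk _ : M → orbitRel.Quotient G M)}
    (fun s hs t ht => contMDiffOn_transition_of_quotientMk hsmooth hs ht) ?_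
  rintro e ⟨q, rfl⟩
  exact ⟨_, IsLocalHomeomorph.localInverseAt_symm _ _, _, chart_mem_atlas _ _, rfl⟩

/-- Unfolds the chart of the quotient at `q`: a local inverse of the quotient map at a chosen
representative `x`, followed by the chart of `M` at `x`. The representative is not under control, so
its users correct by a group element. -/
theorem exists_atlas_quotient (q : orbitRel.Quotient G M) :
    ∃ s : OpenPartialHomeomorph (orbitRel.Quotient G M) M, ∃ x : M, Quotient.mk _ x = q ∧
      ⇑s.symm = (Quotient.mk _ : M → orbitRel.Quotient G M) ∧ q ∈ s.source ∧ s q = x ∧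
      s ≫ₕ chartAt H x ∈ atlas H (orbitRel.Quotient G M) := by
  have hsurj : Function.Surjective (Quotient.mk _ : M → orbitRel.Quotient G M) :=
    Quotient.mk_surjective
  have hx := hsurj.hasRightInverse.choose_spec q
  have hf := isLocalHomeomorph_quotientMk M G
  have h1 := hf.apply_self_mem_localInverseAt_source (x := hsurj.hasRightInverse.choose q)
  have h2 := hf.localInverseAt_apply_self (x := hsurj.hasRightInverse.choose q)
  rw [hx] at h1 h2
  exact ⟨_, _, hx, hf.localInverseAt_symm _, h1, h2, q, rfl⟩

/-- The local inverse underlying the chart passes through the chosen representative `g • x`;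
translating it by `g⁻¹` makes it pass through `x`. -/
theorem hasSmoothSectionAt_quotientMk (hsmooth : ∀ g : G, ContMDiff I I ∞ fun x : M => g • x)
    (x : M) : HasSmoothSectionAt I I (Quotient.mk _ : M → orbitRel.Quotient G M) x := by
  have := isManifold_quotient hsmooth
  obtain ⟨s, x', hx', hs, hq, hsq, hat⟩ := exists_atlas_quotient (H := H)
    (Quotient.mk _ x : orbitRel.Quotient G M)
  obtain ⟨g, hg⟩ := Quotient.exact hx'
  replace hg : g • x = x' := hg
  have h1 : ContMDiffAt I I ∞ s (Quotient.mk _ x) :=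
    contMDiffAt_of_trans_mem_atlas (chart_mem_atlas _ _) hat hq
      (by rw [hsq]; exact mem_chart_source _ _)
  refine ⟨fun y => g⁻¹ • s y, (hsmooth g⁻¹).contMDiffAt.comp _ h1, ?_, ?_⟩
  · simp [hsq, ← hg]
  · filter_upwards [s.open_source.mem_nhds hq] with y hy
    refine (Quotient.sound ⟨g⁻¹, rfl⟩ : (Quotient.mk _ (g⁻¹ • s y) : orbitRel.Quotient G M) =
      Quotient.mk _ (s y)).trans ?_
    rw [← hs, s.left_inv hy]

theorem contMDiff_quotientMk (hsmooth : ∀ g : G, ContMDiff I I ∞ fun x : M => g • x) :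
    ContMDiff I I ∞ (Quotient.mk _ : M → orbitRel.Quotient G M) := by
  have := isManifold_quotient hsmooth
  intro x
  obtain ⟨s, x', hx', hs, hq, hsq, hat⟩ := exists_atlas_quotient (H := H)
    (Quotient.mk _ x : orbitRel.Quotient G M)
  obtain ⟨g, hg⟩ := Quotient.exact hx'
  replace hg : g • x = x' := hg
  have h1 : ContMDiffAt I I ∞ s.symm x' :=
    contMDiffAt_symm_of_trans_mem_atlas (chart_mem_atlas _ _) hat
      (by rw [← hsq]; exact s.map_source hq) (mem_chart_source _ _)
  have h2 : (Quotient.mk _ : M → orbitRel.Quotient G M) = s.symm ∘ fun y => g • y := by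
    ext y
    rw [hs]
    exact (Quotient.sound ⟨g, rfl⟩ : (Quotient.mk _ (g • y) : orbitRel.Quotient G M) =
      Quotient.mk _ y).symm
  rw [h2]
  refine ContMDiffAt.comp x (I' := I) ?_ (hsmooth g).contMDiffAt
  rwa [hg]

end Quotient

/-! ### Smooth structure pulled back along a local homeomorphism -/

section Etale

variable {H M N : Type*} [TopologicalSpace H] [TopologicalSpace M] [TopologicalSpace N]
  [ChartedSpace H N] {f : M → N}

/-- The charted space structure pulled back along a local homeomorphism. -/
@[reducible]
noncomputable def etaleChartedSpace (hf : IsLocalHomeomorph f) : ChartedSpace H M where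
  atlas := Set.range fun x => (hf x).choose ≫ₕ chartAt H (f x)
  chartAt x := (hf x).choose ≫ₕ chartAt H (f x)
  mem_chart_source x := by
    have h := (hf x).choose_spec
    simp only [OpenPartialHomeomorph.trans_source, mem_inter_iff, mem_preimage]
    refine ⟨h.1, ?_⟩
    rw [← h.2]
    exact mem_chart_source _ _
  chart_mem_atlas x := mem_range_self x

variable {E : Type*} [NormedAddCommGroup E] [NormedSpace ℝ E] {I : ModelWithCorners ℝ E H}
  [IsManifold I ∞ N]

/-- The partial homeomorphisms from `M` to `N` used here are all restrictions of the one map `f`, so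
the transitions between them are identities. -/
theorem etale_isManifold (hf : IsLocalHomeomorph f) :
    letI := etaleChartedSpace (H := H) hf
    IsManifold I ∞ M := by
  let := etaleChartedSpace (H := H) hf
  refine isManifold_of_transitions (M := N) {s : OpenPartialHomeomorph M N | ⇑s = f} ?_ ?_
  · rintro s hs t ht y hy
    refine ContMDiffAt.contMDiffWithinAt (contMDiffAt_id.congr_of_eventuallyEq ?_)
    filter_upwards [(s.symm ≫ₕ t).open_source.mem_nhds hy] with z hz
    simp only [OpenPartialHomeomorph.trans_source, OpenPartialHomeomorph.symm_source] at hz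
    change t (s.symm z) = z
    rw [ht, ← congrFun hs, s.right_inv hz.1]
  · rintro _ ⟨x, rfl⟩
    exact ⟨_, (hf x).choose_spec.2.symm, _, chart_mem_atlas _ _, rfl⟩

theorem etale_contMDiff (hf : IsLocalHomeomorph f) :
    letI := etaleChartedSpace (H := H) hf
    ContMDiff I I ∞ f := by
  let := etaleChartedSpace (H := H) hf
  have := etale_isManifold (I := I) hf
  intro x
  have h := (hf x).choose_spec
  have h1 := contMDiffAt_of_trans_mem_atlas (I := I) (chart_mem_atlas H (f x)) (mem_range_self x :
    (hf x).choose ≫ₕ chartAt H (f x) ∈ atlas H M) h.1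
    (by rw [← h.2]; exact mem_chart_source _ _)
  rwa [← h.2] at h1

theorem etale_hasSmoothSectionAt (hf : IsLocalHomeomorph f) (x : M) :
    letI := etaleChartedSpace (H := H) hf
    HasSmoothSectionAt I I f x := by
  let := etaleChartedSpace (H := H) hf
  have := etale_isManifold (I := I) hf
  have h := (hf x).choose_spec
  have h0 : f x = (hf x).choose x := congrFun h.2 x
  have hm : f x ∈ (hf x).choose.target := by
    rw [h0]
    exact (hf x).choose.map_source h.1
  have h1 := contMDiffAt_symm_of_trans_mem_atlas (I := I) (chart_mem_atlas H (f x))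
    (mem_range_self x : (hf x).choose ≫ₕ chartAt H (f x) ∈ atlas H M) hm (mem_chart_source _ _)
  refine ⟨_, h1, ?_, ?_⟩
  · rw [h0]
    exact (hf x).choose.left_inv h.1
  · filter_upwards [(hf x).choose.open_target.mem_nhds hm] with y hy
    rw [congrFun h.2]
    exact (hf x).choose.right_inv hy

/-- A map into `M` is smooth as soon as it is continuous and its composition with `f` is smooth. -/
theorem etale_contMDiffAt {E' H' P : Type*} [NormedAddCommGroup E'] [NormedSpace ℝ E']
    [TopologicalSpace H'] {J : ModelWithCorners ℝ E' H'} [TopologicalSpace P] [ChartedSpace H' P]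
    (hf : IsLocalHomeomorph f) {k : P → M} {p : P} (hk : ContinuousAt k p)
    (hfk : ContMDiffAt J I ∞ (fun q => f (k q)) p) :
    letI := etaleChartedSpace (H := H) hf
    ContMDiffAt J I ∞ k p := by
  let := etaleChartedSpace (H := H) hf
  obtain ⟨e, he, hfe⟩ := hf (k p)
  obtain ⟨s, h1, h2, h3⟩ := etale_hasSmoothSectionAt (I := I) hf (k p)
  refine ((h1.comp p hfk)).congr_of_eventuallyEq ?_
  -- Both `k` and the smooth map `s ∘ f ∘ k` stay in a set on which `f` is injective, and they have
  -- the same image under `f`; hence they agree near `p`.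
  have h4 : ∀ᶠ q in 𝓝 p, s (f (k q)) ∈ e.source := by
    refine (h1.comp p hfk).continuousAt.eventually_mem (e.open_source.mem_nhds ?_)
    simpa [h2] using he
  filter_upwards [hk.eventually_mem (e.open_source.mem_nhds he), h4,
    hfk.continuousAt.eventually h3] with q hq hq' hq''
  refine e.injOn hq hq' ?_
  rw [← hfe]
  exact hq''.symm

end Etale

/-! ### Graphs over an étale projection are immersed -/

section Graph

variable {E F : Type*} {M N P : Type*} [NormedAddCommGroup E] [NormedSpace ℝ E]
  [NormedAddCommGroup F] [NormedSpace ℝ F] [TopologicalSpace M] [TopologicalSpace N]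
  [TopologicalSpace P] [ChartedSpace E N] [ChartedSpace F P] [ChartedSpace E M]
  [IsManifold 𝓘(ℝ, E) ∞ M] [IsManifold 𝓘(ℝ, E) ∞ N] [IsManifold 𝓘(ℝ, F) ∞ P]

/-- The shear `(u, v) ↦ (u, v - κ u)` over an open set. -/
def shear {U : Set E} (hU : IsOpen U) (κ : E → F) (hκ : ContinuousOn κ U) :
    OpenPartialHomeomorph (E × F) (E × F) where
  toFun q := (q.1, q.2 - κ q.1)
  invFun q := (q.1, q.2 + κ q.1)
  source := U ×ˢ univ
  target := U ×ˢ univ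
  map_source' q hq := ⟨hq.1, trivial⟩
  map_target' q hq := ⟨hq.1, trivial⟩
  left_inv' q _ := by simp
  right_inv' q _ := by simp
  open_source := hU.prod isOpen_univ
  open_target := hU.prod isOpen_univ
  continuousOn_toFun := continuousOn_fst.prodMk
    (continuousOn_snd.sub (hκ.comp continuousOn_fst fun q hq => hq.1))
  continuousOn_invFun := continuousOn_fst.prodMk
    (continuousOn_snd.add (hκ.comp continuousOn_fst fun q hq => hq.1))

/-- A smooth map whose first component is étale is an immersion. -/
theorem isImmersionAtOfComplement_of_etale_fst {h : M → N} {k : M → P} {x : M}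
    {e : OpenPartialHomeomorph M N} (hx : x ∈ e.source) (he : ⇑e = h)
    {c : OpenPartialHomeomorph N E} (hc : c ∈ atlas E N) (hxc : h x ∈ c.source)
    (hec : e ≫ₕ c ∈ atlas E M) (hk : ContMDiff 𝓘(ℝ, E) 𝓘(ℝ, F) ∞ k) :
    Manifold.IsImmersionAtOfComplement F 𝓘(ℝ, E) (𝓘(ℝ, E).prod 𝓘(ℝ, F)) ∞
      (fun y => (h y, k y)) x := by
  let d := chartAt F (k x)
  -- The restriction makes `k` readable in the single chart `d`. In the charts `D` and `c.prod d`
  -- the map becomes `z ↦ (z, κ z)`, and the shear by `κ = d ∘ k ∘ D.symm` straightens it to `z ↦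
  -- (z, 0)`, the normal form of an immersion.
  let D := (e ≫ₕ c).restr (k ⁻¹' d.source)
  have hopen : IsOpen (k ⁻¹' d.source) := d.open_source.preimage hk.continuous
  have hDmem : D ∈ IsManifold.maximalAtlas 𝓘(ℝ, E) ∞ M :=
    restr_mem_maximalAtlas _ (IsManifold.subset_maximalAtlas hec) hopen
  have hDs : D.source = (e ≫ₕ c).source ∩ k ⁻¹' d.source := by
    simp only [D, OpenPartialHomeomorph.restr_source, hopen.interior_eq]
  have hxD : x ∈ D.source := by
    rw [hDs]
    refine ⟨⟨hx, ?_⟩, mem_chart_source _ _⟩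
    change e x ∈ c.source
    rwa [he]
  have hκ : ContDiffOn ℝ ∞ (d ∘ k ∘ D.symm) D.target := by
    rw [← contMDiffOn_iff_contDiffOn]
    refine (contMDiffOn_chart (I := 𝓘(ℝ, F)) (x := k x)).comp
      (hk.comp_contMDiffOn (contMDiffOn_symm_of_mem_maximalAtlas hDmem)) fun z hz => ?_
    have := D.map_target hz
    rw [hDs] at this
    exact this.2
  let sh : OpenPartialHomeomorph (ModelProd E F) (ModelProd E F) :=
    shear D.open_target (d ∘ k ∘ D.symm) hκ.continuousOn
  have hκ' : ContMDiffOn (𝓘(ℝ, E).prod 𝓘(ℝ, F)) 𝓘(ℝ, F) ∞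
      (fun q : E × F => (d ∘ k ∘ D.symm) q.1) (D.target ×ˢ univ) :=
    hκ.contMDiffOn.comp contMDiffOn_fst fun q hq => hq.1
  have hsh : ContMDiffOn (𝓘(ℝ, E).prod 𝓘(ℝ, F)) (𝓘(ℝ, E).prod 𝓘(ℝ, F)) ∞
      (fun q : E × F => (q.1, q.2 - (d ∘ k ∘ D.symm) q.1)) (D.target ×ˢ univ) :=
    contMDiffOn_fst.prodMk (contMDiffOn_snd.sub hκ')
  have hsh' : ContMDiffOn (𝓘(ℝ, E).prod 𝓘(ℝ, F)) (𝓘(ℝ, E).prod 𝓘(ℝ, F)) ∞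
      (fun q : E × F => (q.1, q.2 + (d ∘ k ∘ D.symm) q.1)) (D.target ×ˢ univ) :=
    contMDiffOn_fst.prodMk (contMDiffOn_snd.add hκ')
  rw [chartedSpaceSelf_prod] at hsh hsh'
  have hs1 : ContMDiffOn (𝓘(ℝ, E).prod 𝓘(ℝ, F)) (𝓘(ℝ, E).prod 𝓘(ℝ, F)) ∞ sh sh.source := hsh
  have hs2 : ContMDiffOn (𝓘(ℝ, E).prod 𝓘(ℝ, F)) (𝓘(ℝ, E).prod 𝓘(ℝ, F)) ∞ sh.symm sh.target := hsh'
  have hcd : c.prod d ∈ IsManifold.maximalAtlas (𝓘(ℝ, E).prod 𝓘(ℝ, F)) ∞ (N × P) :=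
    IsManifold.mem_maximalAtlas_prod (IsManifold.subset_maximalAtlas hc)
      (IsManifold.chart_mem_maximalAtlas _)
  let C : OpenPartialHomeomorph (N × P) (ModelProd E F) := (c.prod d) ≫ₕ sh
  have hC : C ∈ IsManifold.maximalAtlas (𝓘(ℝ, E).prod 𝓘(ℝ, F)) ∞ (N × P) := by
    refine C.mem_maximalAtlas_of_contMDiffOn ?_ ?_
    · exact hs1.comp ((contMDiffOn_of_mem_maximalAtlas hcd).mono fun z hz => hz.1) fun z hz => hz.2
    · exact (contMDiffOn_symm_of_mem_maximalAtlas hcd).comp (hs2.mono fun z hz => hz.1)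
        fun z hz => hz.2
  have hh : ∀ z ∈ D.target, c (h (D.symm z)) = z := fun z hz => by
    have h1 : z ∈ (e ≫ₕ c).target := by
      have := D.map_target hz
      rw [hDs] at this
      have h2 := (e ≫ₕ c).map_source this.1
      have h3 : (e ≫ₕ c) (D.symm z) = z := D.right_inv hz
      rwa [h3] at h2
    have h2 := (e ≫ₕ c).right_inv h1
    rw [← he]
    exact h2
  have hsource : D.source ⊆ (fun y => (h y, k y)) ⁻¹' C.source := fun y hy => by
    have hy' := hy
    rw [hDs] at hy'
    refine ⟨⟨?_, hy'.2⟩, ?_, trivial⟩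
    · rw [← he]
      exact hy'.1.2
    · change c (h y) ∈ D.target
      rw [← he]
      exact D.map_source hy
  refine Manifold.IsImmersionAtOfComplement.mk_of_charts (ContinuousLinearEquiv.refl ℝ (E × F)) D C
    hxD ?_ hDmem hC ?_ ?_
  · exact hsource hxD
  · exact hsource
  · intro z hz
    replace hz : z ∈ D.target := by simpa using hz
    have h1 : (D.extend 𝓘(ℝ, E)).symm z = D.symm z := rfl
    have h2 : ∀ q, C.extend (𝓘(ℝ, E).prod 𝓘(ℝ, F)) q = sh (c q.1, d q.2) := fun q => rfl
    simp only [Function.comp_apply, h1, h2, hh z hz]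
    simp [sh, shear]

end Graph

/-! ### Smoothness for structures induced by open embeddings -/

section Pullback

variable {E H M N : Type*} [NormedAddCommGroup E] [NormedSpace ℝ E] [TopologicalSpace H]
  {I : ModelWithCorners ℝ E H} [TopologicalSpace M] [TopologicalSpace N] [ChartedSpace H N]
  [IsManifold I ∞ N] {f : M → N}

theorem pullback_contMDiff (hf : IsOpenEmbedding f) :
    letI := pullbackChartedSpace (H := H) hf
    ContMDiff I I ∞ f := by
  let := pullbackChartedSpace (H := H) hf
  have := pullback_isManifold I hf
  intro x
  have : Nonempty M := ⟨x⟩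
  exact contMDiffAt_of_trans_mem_atlas (s := hf.toOpenPartialHomeomorph f)
    (chart_mem_atlas H (f x)) (mem_range_self x) (by simp) (by simp)

theorem pullback_contMDiffAt_symm (hf : IsOpenEmbedding f) [Nonempty M] (x : M) :
    letI := pullbackChartedSpace (H := H) hf
    ContMDiffAt I I ∞ (hf.toOpenPartialHomeomorph f).symm (f x) := by
  let := pullbackChartedSpace (H := H) hf
  have := pullback_isManifold I hf
  exact contMDiffAt_symm_of_trans_mem_atlas (s := hf.toOpenPartialHomeomorph f)
    (chart_mem_atlas H (f x)) (mem_range_self x) (by simp) (by simp)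

theorem pullback_contMDiffAt {E' H' P : Type*} [NormedAddCommGroup E'] [NormedSpace ℝ E']
    [TopologicalSpace H'] {J : ModelWithCorners ℝ E' H'} [TopologicalSpace P] [ChartedSpace H' P]
    (hf : IsOpenEmbedding f) {k : P → M} {p : P}
    (hfk : ContMDiffAt J I ∞ (fun q => f (k q)) p) :
    letI := pullbackChartedSpace (H := H) hf
    ContMDiffAt J I ∞ k p := by
  let := pullbackChartedSpace (H := H) hf
  have : Nonempty M := ⟨k p⟩
  refine ((pullback_contMDiffAt_symm hf (k p)).comp p hfk).congr_of_eventuallyEq ?_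
  refine Eventually.of_forall fun q => ?_
  exact ((hf.toOpenPartialHomeomorph f).left_inv (by simp)).symm

end Pullback

/-! ### Smooth lifts to and from projective spaces -/

section ProjectiveMaps

variable {E H P : Type*} [NormedAddCommGroup E] [NormedSpace ℝ E] [TopologicalSpace H]
  {J : ModelWithCorners ℝ E H} [TopologicalSpace P] [ChartedSpace H P]
  {ι : Type} [Inhabited ι] [DecidableEq ι]

theorem mk_affineVec_affineCoord {i : ι} {p : ℙ ℂ (ι → ℂ)} (hp : p.rep i ≠ 0) :
    Projectivization.mk ℂ (affineVec i (affineCoord i p)) (affineVec_ne_zero _ _) = p :=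
  (affineChart i).left_inv hp

variable [Fintype ι]

/-- A map to a projective space with a smooth lift is smooth. -/
theorem contMDiffAt_proj_of_lift {k : P → ℙ ℂ (ι → ℂ)} {u : P → ι → ℂ} {p : P}
    (hu : ContMDiffAt J 𝓘(ℝ, ι → ℂ) ∞ u p)
    (h : ∀ᶠ q in 𝓝 p, ∃ hq, k q = Projectivization.mk ℂ (u q) hq) :
    ContMDiffAt J 𝓘(ℝ, AffineModel ι) ∞ k p := by
  obtain ⟨hp, -⟩ := h.self_of_nhds
  obtain ⟨i, hi⟩ := Function.ne_iff.1 hp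
  have hu' : ∀ j, ContMDiffAt J 𝓘(ℝ, ℂ) ∞ (fun q => u q j) p := contMDiffAt_pi_space.1 hu
  have hw : ContMDiffAt J 𝓘(ℝ, AffineModel ι) ∞
      (fun q (j : {j : ι // j ≠ default}) => u q (Equiv.swap i default j) * (u q i)⁻¹) p := by
    have hd : ContDiffAt ℝ ∞ (fun (x : ι → ℂ) (j : {j : ι // j ≠ default}) =>
        x (Equiv.swap i default j) * (x i)⁻¹) (u p) :=
      contDiffAt_pi.2 fun j => (contDiff_apply ℝ ℂ _).contDiffAt.mul
        ((contDiff_apply ℝ ℂ _).contDiffAt.inv hi)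
    exact hd.contMDiffAt.comp p hu
  have hc : affineChart i ∈ atlas (AffineModel ι) (ℙ ℂ (ι → ℂ)) := mem_range_self i
  have hs : ContMDiff 𝓘(ℝ, AffineModel ι) 𝓘(ℝ, AffineModel ι) ∞ (affineChart i).symm :=
    contMDiffOn_univ.1 (contMDiffOn_symm_of_mem_maximalAtlas (IsManifold.subset_maximalAtlas hc))
  refine (hs.contMDiffAt.comp p hw).congr_of_eventuallyEq ?_
  filter_upwards [h, (hu' i).continuousAt.eventually_ne hi] with q ⟨hq, hkq⟩ hqi
  have hmem : k q ∈ (affineChart i).source := by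
    rw [hkq]
    exact (rep_apply_eq_zero_iff hq i).not.2 hqi
  rw [← (affineChart i).left_inv hmem]
  refine congrArg (affineChart i).symm (funext fun j => ?_)
  change affineCoord i (k q) j = _
  rw [hkq, affineCoord_mk, div_eq_mul_inv]

/-- Near every point, a projective space has smooth lifts to the vector space. -/
theorem exists_lift_proj {v : ι → ℂ} (hv : v ≠ 0) :
    ∃ σ : ℙ ℂ (ι → ℂ) → ι → ℂ, ContMDiffAt 𝓘(ℝ, AffineModel ι) 𝓘(ℝ, ι → ℂ) ∞ σ
      (Projectivization.mk ℂ v hv) ∧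
      σ (Projectivization.mk ℂ v hv) = v ∧
      ∀ᶠ p in 𝓝 (Projectivization.mk ℂ v hv), ∃ hp, p = Projectivization.mk ℂ (σ p) hp := by
  obtain ⟨i, hi⟩ := Function.ne_iff.1 hv
  have hsrc : Projectivization.mk ℂ v hv ∈ (affineChart i).source :=
    (rep_apply_eq_zero_iff hv i).not.2 hi
  have hmem : ∀ᶠ p in 𝓝 (Projectivization.mk ℂ v hv), p ∈ (affineChart i).source :=
    (affineChart i).open_source.mem_nhds hsrc
  have hc : ContMDiffAt 𝓘(ℝ, AffineModel ι) 𝓘(ℝ, AffineModel ι) ∞ (affineCoord i)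
      (Projectivization.mk ℂ v hv) :=
    contMDiffAt_of_mem_maximalAtlas (e := affineChart (ι := ι) i)
      (IsManifold.subset_maximalAtlas (mem_range_self i)) hsrc
  have hd : ContDiff ℝ ∞ fun w : AffineModel ι => v i • affineVec i w := by
    refine contDiff_pi.2 fun k => ?_
    unfold affineVec
    simp only [Pi.smul_apply]
    split_ifs <;> fun_prop
  -- The affine representative has `i`-th coordinate `1`; the constant factor `v i` makes the lift
  -- take the prescribed value `v` at `[v]`.
  refine ⟨fun p => v i • affineVec i (affineCoord i p), hd.contMDiff.contMDiffAt.comp _ hc, ?_, ?_⟩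
  · ext k
    by_cases hk : Equiv.swap i default k = default
    · have : k = i := by simpa using congrArg (Equiv.swap i default) hk
      subst this
      simp [affineVec_self]
    · simp only [Pi.smul_apply, affineVec, hk, dite_false, affineCoord_mk, smul_eq_mul]
      simp only [Pi.zero_apply] at hi
      simp [mul_div_cancel₀, hi]
  · filter_upwards [hmem] with p hp
    refine ⟨smul_ne_zero hi (affineVec_ne_zero _ _), ?_⟩
    conv_lhs => rw [← mk_affineVec_affineCoord hp]
    exact ((Projectivization.mk_eq_mk_iff' ℂ _ _ _ _).2 ⟨v i, rfl⟩).symm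

end ProjectiveMaps

/-! ### Smooth lifts for the space of cubics -/

section Cubics

variable {E H P : Type*} [NormedAddCommGroup E] [NormedSpace ℝ E] [TopologicalSpace H]
  {J : ModelWithCorners ℝ E H} [TopologicalSpace P] [ChartedSpace H P]

/-- A map to the space of smooth cubics with a smooth lift is smooth. -/
theorem contMDiffAt_cubics_of_lift {k : P → SmoothCubics} {u : P → CubicForm} {p : P}
    (hu : ContMDiffAt J 𝓘(ℝ, CubicExponent → ℂ) ∞ (fun q => coeffs (u q)) p)
    (h : ∀ᶠ q in 𝓝 p, ∃ hq, (k q).1 = Projectivization.mk ℂ (u q) hq) :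
    ContMDiffAt J modelCubics ∞ k p := by
  rw [← ContMDiffAt.subtypeVal_comp_iff]
  refine pullback_contMDiffAt isOpenEmbedding_coeffsProj
    (contMDiffAt_proj_of_lift (u := fun q => coeffs (u q)) hu ?_)
  filter_upwards [h] with q ⟨hq, hkq⟩
  refine ⟨coeffs.map_ne_zero_iff.2 hq, ?_⟩
  simp only [Function.comp_apply, hkq]
  rfl

/-- Prescribing the value `G` of the lift at `F` matters: the inverse function theorem is later
applied at a specific form, not just at its class up to scalars. -/
theorem exists_lift_cubics (F : SmoothCubics) {G : CubicForm} (hG : G ≠ 0)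
    (hF : F.1 = Projectivization.mk ℂ G hG) :
    ∃ σ : SmoothCubics → CubicForm,
      ContMDiffAt modelCubics 𝓘(ℝ, CubicExponent → ℂ) ∞ (fun F => coeffs (σ F)) F ∧
      σ F = G ∧ ∀ᶠ F' in 𝓝 F, ∃ h, F'.1 = Projectivization.mk ℂ (σ F') h := by
  obtain ⟨σ, h1, h2, h3⟩ := exists_lift_proj (coeffs.map_ne_zero_iff.2 hG)
  have hval : ContMDiff modelCubics modelCubics ∞ fun F : SmoothCubics => coeffsProj F.1 :=
    (pullback_contMDiff isOpenEmbedding_coeffsProj).comp contMDiff_subtype_val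
  have hFG : coeffsProj F.1 = Projectivization.mk ℂ (coeffs G) (coeffs.map_ne_zero_iff.2 hG) := by
    rw [hF]
    rfl
  rw [← hFG] at h1 h2 h3
  refine ⟨fun F' => coeffs.symm (σ (coeffsProj F'.1)), ?_, ?_, ?_⟩
  · simp only [LinearEquiv.apply_symm_apply]
    exact h1.comp F hval.contMDiffAt
  · simp [h2]
  · filter_upwards [hval.continuous.continuousAt.eventually h3] with F' ⟨h, hF'⟩
    refine ⟨coeffs.symm.map_ne_zero_iff.2 h, isOpenEmbedding_coeffsProj.injective ?_⟩
    refine hF'.trans ((Projectivization.mk_eq_mk_iff' ℂ _ _ _ _).2 ⟨1, ?_⟩)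
    simp

end Cubics

/-! ### Smooth lifts for the projective linear group -/

section PGL

variable {E H P : Type*} [NormedAddCommGroup E] [NormedSpace ℝ E] [TopologicalSpace H]
  {J : ModelWithCorners ℝ E H} [TopologicalSpace P] [ChartedSpace H P]

/-- The smooth structure on `PGL₃(ℂ)` is modelled on this space. -/
noncomputable abbrev modelPGL := 𝓘(ℝ, AffineModel (Fin 3 × Fin 3))

/-- A map to `PGL₃(ℂ)` whose matrix entries are smooth, up to a scalar, is smooth. -/
theorem contMDiffAt_pgl_of_lift {k : P → PGL(3, ℂ)} {u : P → Fin 3 × Fin 3 → ℂ} {p : P}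
    (hu : ContMDiffAt J 𝓘(ℝ, Fin 3 × Fin 3 → ℂ) ∞ u p)
    (h : ∀ᶠ q in 𝓝 p, ∃ g : GL (Fin 3) ℂ, k q = .mk g ∧
      ∃ a : ℂ, a ≠ 0 ∧ ∀ i, u q i = a * g i.1 i.2) :
    ContMDiffAt J modelPGL ∞ k p := by
  refine pullback_contMDiffAt isOpenEmbedding_pglToProj (contMDiffAt_proj_of_lift hu ?_)
  filter_upwards [h] with q ⟨g, hg, a, ha, hu⟩
  have hug : u q = a • (entries g).1 := by
    ext i
    exact hu i
  refine ⟨hug ▸ smul_ne_zero ha (entries g).2, ?_⟩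
  rw [hg, pglToProj_mk]
  refine ((Projectivization.mk_eq_mk_iff' ℂ _ _ _ _).2 ⟨a, ?_⟩).symm
  exact hug.symm

/-- A lift through the projective space of matrices differs from an invertible representative of `h`
by a nonzero scalar, so its values are themselves the entries of invertible matrices. -/
theorem exists_lift_pgl (g : GL (Fin 3) ℂ) :
    ∃ σ : PGL(3, ℂ) → GL (Fin 3) ℂ,
      ContMDiffAt modelPGL 𝓘(ℝ, Fin 3 × Fin 3 → ℂ) ∞ (fun h => (entries (σ h)).1) (.mk g) ∧
      ∀ᶠ h in 𝓝 (Matrix.ProjGenLinGroup.mk g), h = .mk (σ h) := by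
  classical
  obtain ⟨σ, h1, h2, h3⟩ := exists_lift_proj (entries g).2
  have hc : ContMDiff modelPGL modelPGL ∞ pglToProj := pullback_contMDiff isOpenEmbedding_pglToProj
  have h4 := hc.continuous.continuousAt (x := Matrix.ProjGenLinGroup.mk g) |>.eventually h3
  have key : ∀ᶠ h in 𝓝 (Matrix.ProjGenLinGroup.mk g), ∃ m : GL (Fin 3) ℂ, h = .mk m ∧
      (entries m).1 = σ (pglToProj h) := by
    filter_upwards [h4] with h ⟨hn, hh⟩
    induction h using Matrix.ProjGenLinGroup.induction_on with | mk m =>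
    obtain ⟨a, ha⟩ := (Projectivization.mk_eq_mk_iff ℂ _ _ hn (entries m).2).1 hh.symm
    have hs : (entries (m * Matrix.GeneralLinearGroup.scalar (Fin 3) a)).1 = a • (entries m).1 := by
      ext i
      simp [entries, Units.smul_def, mul_comm]
    refine ⟨m * Matrix.GeneralLinearGroup.scalar (Fin 3) a,
      Matrix.ProjGenLinGroup.mk_eq_mk_iff.2 ⟨a, rfl⟩, ?_⟩
    rw [hs, ha]
  -- The value `1` is only a default where no such matrix exists, which does not happen near `mk g`.
  let τ : PGL(3, ℂ) → GL (Fin 3) ℂ := fun h => if H : ∃ m : GL (Fin 3) ℂ, h = .mk m ∧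
      (entries m).1 = σ (pglToProj h) then H.choose else 1
  have hτ : ∀ᶠ h in 𝓝 (Matrix.ProjGenLinGroup.mk g), h = .mk (τ h) ∧
      (entries (τ h)).1 = σ (pglToProj h) := by
    filter_upwards [key] with h hh
    simp only [τ, dif_pos hh]
    exact hh.choose_spec
  refine ⟨τ, ?_, hτ.mono fun _ h => h.1⟩
  have h5 : ContMDiffAt modelPGL 𝓘(ℝ, Fin 3 × Fin 3 → ℂ) ∞ (σ ∘ pglToProj) (.mk g) :=
    ContMDiffAt.comp (I' := modelPGL) (Matrix.ProjGenLinGroup.mk g) h1 hc.contMDiffAt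
  exact h5.congr_of_eventuallyEq (hτ.mono fun _ h => h.2)

end PGL

end FlexCover

namespace FlexCover

open Set Filter Topology MvPolynomial

/-! ### Cubics by their ten coefficients, and the Hessian criterion for flexes -/

section ExplicitCubics

/-- The exponents of the ten ternary cubic monomials, in a fixed order. -/
def cubicExp : Fin 10 → Fin 3 → ℕ :=
  ![![3, 0, 0], ![0, 3, 0], ![0, 0, 3], ![2, 1, 0], ![0, 2, 1], ![1, 0, 2],
    ![2, 0, 1], ![1, 2, 0], ![0, 1, 2], ![1, 1, 1]]

/-- `cubicExp` as a map to exponents of degree `3`. -/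
noncomputable def cubicExponent (k : Fin 10) : CubicExponent :=
  ⟨Finsupp.equivFunOnFinite.symm (cubicExp k), by
    rw [Finsupp.degree_eq_sum, Fin.sum_univ_three]
    fin_cases k <;> rfl⟩

theorem cubicExponent_bijective : Function.Bijective cubicExponent := by
  constructor
  · intro j k h
    have h' : cubicExp j = cubicExp k := congrArg (fun m => (m.1 : Fin 3 → ℕ)) h
    have : ∀ j k, cubicExp j = cubicExp k → j = k := by decide
    exact this j k h'
  · rintro ⟨m, hm⟩
    rw [Finsupp.degree_eq_sum, Fin.sum_univ_three] at hm
    have key : ∀ a b c : Fin 4, a.1 + b.1 + c.1 = 3 → ∃ k, cubicExp k = ![a.1, b.1, c.1] := by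
      decide
    obtain ⟨k, hk⟩ := key ⟨m 0, by omega⟩ ⟨m 1, by omega⟩ ⟨m 2, by omega⟩ hm
    refine ⟨k, Subtype.ext (Finsupp.ext fun i => ?_)⟩
    change cubicExp k i = m i
    rw [hk]
    fin_cases i <;> rfl

/-- The coefficients of a cubic form, in a fixed order. -/
noncomputable def cubicCoeffs : CubicForm ≃ₗ[ℂ] (Fin 10 → ℂ) :=
  coeffs.trans (LinearEquiv.funCongrLeft ℂ ℂ (Equiv.ofBijective _ cubicExponent_bijective))

/-- The ternary cubic polynomial with given coefficients. -/
noncomputable def cubicPoly (c : Fin 10 → ℂ) : MvPolynomial (Fin 3) ℂ :=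
  C (c 0) * X 0 ^ 3 + C (c 1) * X 1 ^ 3 + C (c 2) * X 2 ^ 3 + C (c 3) * (X 0 ^ 2 * X 1) +
    C (c 4) * (X 1 ^ 2 * X 2) + C (c 5) * (X 2 ^ 2 * X 0) + C (c 6) * (X 0 ^ 2 * X 2) +
    C (c 7) * (X 1 ^ 2 * X 0) + C (c 8) * (X 2 ^ 2 * X 1) + C (c 9) * (X 0 * X 1 * X 2)

theorem poly_eq_cubicPoly (F : CubicForm) : F.poly = cubicPoly (cubicCoeffs F) := by
  have h1 : F.poly = ∑ m : CubicExponent, monomial m.1 (coeffs F m) :=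
    congrArg CubicForm.poly (coeffs.symm_apply_apply F).symm
  have h2 : ∀ (m : CubicExponent) (a : ℂ), monomial m.1 a =
      C a * (X 0 ^ m.1 0 * X 1 ^ m.1 1 * X 2 ^ m.1 2) := by
    intro m a
    rw [monomial_eq, Finsupp.prod_fintype _ _ (by simp), Fin.prod_univ_three]
  rw [h1, ← (Equiv.ofBijective _ cubicExponent_bijective).sum_comp]
  simp only [h2, Fin.sum_univ_succ, cubicPoly]
  simp [cubicCoeffs, cubicExponent, cubicExp, Fin.succ]
  ring

theorem poly_cubicCoeffs_symm (c : Fin 10 → ℂ) : (cubicCoeffs.symm c).poly = cubicPoly c := by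
  rw [poly_eq_cubicPoly, LinearEquiv.apply_symm_apply]

theorem eval_cubicPoly (c : Fin 10 → ℂ) (v : Fin 3 → ℂ) : eval v (cubicPoly c) =
    c 0 * v 0 ^ 3 + c 1 * v 1 ^ 3 + c 2 * v 2 ^ 3 + c 3 * (v 0 ^ 2 * v 1) +
    c 4 * (v 1 ^ 2 * v 2) + c 5 * (v 2 ^ 2 * v 0) + c 6 * (v 0 ^ 2 * v 2) +
    c 7 * (v 1 ^ 2 * v 0) + c 8 * (v 2 ^ 2 * v 1) + c 9 * (v 0 * v 1 * v 2) := by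
  simp [cubicPoly]

theorem eval_pderiv_cubicPoly (c : Fin 10 → ℂ) (v : Fin 3 → ℂ) (i : Fin 3) :
    eval v (pderiv i (cubicPoly c)) =
    ![3 * c 0 * v 0 ^ 2 + 2 * c 3 * v 0 * v 1 + c 5 * v 2 ^ 2 + 2 * c 6 * v 0 * v 2 +
        c 7 * v 1 ^ 2 + c 9 * v 1 * v 2,
      3 * c 1 * v 1 ^ 2 + c 3 * v 0 ^ 2 + 2 * c 4 * v 1 * v 2 + 2 * c 7 * v 1 * v 0 +
        c 8 * v 2 ^ 2 + c 9 * v 0 * v 2,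
      3 * c 2 * v 2 ^ 2 + c 4 * v 1 ^ 2 + 2 * c 5 * v 2 * v 0 + c 6 * v 0 ^ 2 +
        2 * c 8 * v 2 * v 1 + c 9 * v 0 * v 1] i := by
  fin_cases i <;> simp [cubicPoly, pderiv_X] <;> ring

/-- The second derivatives of the cubic polynomial with given coefficients. -/
noncomputable def cubicHess (c : Fin 10 → ℂ) (v : Fin 3 → ℂ) : Matrix (Fin 3) (Fin 3) ℂ :=
  !![6 * c 0 * v 0 + 2 * c 3 * v 1 + 2 * c 6 * v 2,
      2 * c 3 * v 0 + 2 * c 7 * v 1 + c 9 * v 2, 2 * c 5 * v 2 + 2 * c 6 * v 0 + c 9 * v 1;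
    2 * c 3 * v 0 + 2 * c 7 * v 1 + c 9 * v 2,
      6 * c 1 * v 1 + 2 * c 4 * v 2 + 2 * c 7 * v 0, 2 * c 4 * v 1 + 2 * c 8 * v 2 + c 9 * v 0;
    2 * c 5 * v 2 + 2 * c 6 * v 0 + c 9 * v 1, 2 * c 4 * v 1 + 2 * c 8 * v 2 + c 9 * v 0,
      6 * c 2 * v 2 + 2 * c 5 * v 0 + 2 * c 8 * v 1]

/-- Taylor expansion along the line `v + t w`. Exchanging the roles of `v` and `w` turns the
coefficient of `t²` into a first derivative, taken at `w` in the direction `v`. -/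
theorem aeval_line_cubicPoly (c : Fin 10 → ℂ) (v w : Fin 3 → ℂ) :
    aeval (fun i => Polynomial.C (v i) + Polynomial.C (w i) * Polynomial.X) (cubicPoly c) =
      Polynomial.C (eval v (cubicPoly c)) +
      Polynomial.C (∑ i, eval v (pderiv i (cubicPoly c)) * w i) * Polynomial.X +
      Polynomial.C (∑ i, eval w (pderiv i (cubicPoly c)) * v i) * Polynomial.X ^ 2 +
      Polynomial.C (eval w (cubicPoly c)) * Polynomial.X ^ 3 := by
  refine Polynomial.funext fun t => ?_
  simp only [eval_pderiv_cubicPoly, Fin.sum_univ_three, eval_cubicPoly]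
  simp [cubicPoly]
  ring

/-- On a tangent line the coefficients of `1` and `t` already vanish, so divisibility by `X ^ 3` is
the vanishing of the coefficient of `t²`. -/
theorem isFlex_iff (F : CubicForm) (v : Fin 3 → ℂ) : IsFlex F.poly v ↔ eval v F.poly = 0 ∧
    ∀ w : Fin 3 → ℂ, ∑ i, eval v (pderiv i F.poly) * w i = 0 →
      ∑ i, eval w (pderiv i F.poly) * v i = 0 := by
  rw [poly_eq_cubicPoly]
  refine and_congr_right fun h0 => forall₂_congr fun w hw => ?_
  rw [aeval_line_cubicPoly, h0, hw]
  simp only [map_zero, zero_mul, zero_add]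
  constructor
  · intro h
    have h2 := Polynomial.X_pow_dvd_iff.1 h 2 (by norm_num)
    rw [Polynomial.coeff_add, Polynomial.coeff_C_mul_X_pow, Polynomial.coeff_C_mul_X_pow] at h2
    simpa using h2
  · intro h
    rw [h]
    simp

/-- The Hessian criterion for flex points. -/
theorem isFlex_of_det_eq_zero {c : Fin 10 → ℂ} {v : Fin 3 → ℂ}
    (h0 : eval v (cubicPoly c) = 0) (h1 : ∃ i, eval v (pderiv i (cubicPoly c)) ≠ 0)
    (hdet : (cubicHess c v).det = 0) : IsFlex (cubicPoly c) v := by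
  have hv0 : v ≠ 0 := by
    rintro rfl
    obtain ⟨i, hi⟩ := h1
    rw [eval_pderiv_cubicPoly] at hi
    fin_cases i <;> simp at hi
  rw [← poly_cubicCoeffs_symm, isFlex_iff, poly_cubicCoeffs_symm]
  refine ⟨h0, fun w hw => ?_⟩
  set M := cubicHess c v with hM
  -- Euler's relation gives `M v = 2 n` with `n` the gradient, and symmetry of `M` puts the kernel
  -- vector `k` on the tangent line. Since `M v ≠ 0 = M k`, the vectors `v` and `k` span the tangent
  -- plane `n^⊥`. So `M` maps every tangent vector `w` to a multiple of `n`, and `w ⬝ᵥ M w = 0`.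
  obtain ⟨k, hk0, hk⟩ := Matrix.exists_mulVec_eq_zero_iff.2 hdet
  set n : Fin 3 → ℂ := fun i => eval v (pderiv i (cubicPoly c)) with hn
  have hMv : M.mulVec v = (2 : ℂ) • n := by
    ext i
    simp only [n, eval_pderiv_cubicPoly, M, cubicHess]
    fin_cases i <;> simp [Matrix.mulVec, dotProduct, Fin.sum_univ_three] <;> ring
  have hsym : ∀ a b : Fin 3 → ℂ, a ⬝ᵥ M.mulVec b = b ⬝ᵥ M.mulVec a := by
    intro a b
    simp [M, cubicHess, Matrix.mulVec, dotProduct, Fin.sum_univ_three]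
    ring
  have hww : ∑ i, eval w (pderiv i (cubicPoly c)) * v i = (w ⬝ᵥ M.mulVec w) / 2 := by
    simp only [eval_pderiv_cubicPoly, M, cubicHess]
    simp [Matrix.mulVec, dotProduct, Fin.sum_univ_three]
    ring
  have hnv : n ⬝ᵥ v = 0 := by
    have : n ⬝ᵥ v = 3 * eval v (cubicPoly c) := by
      simp only [n, eval_pderiv_cubicPoly, eval_cubicPoly]
      simp [dotProduct, Fin.sum_univ_three]
      ring
    rw [this, h0, mul_zero]
  have hnk : n ⬝ᵥ k = 0 := by
    have : k ⬝ᵥ M.mulVec v = 0 := by rw [hsym, hk, dotProduct_zero]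
    rw [hMv, dotProduct_smul, dotProduct_comm] at this
    simpa using this
  have hnw : n ⬝ᵥ w = 0 := hw
  -- Three vectors orthogonal to the nonzero vector `n` are linearly dependent.
  have hdep : (Matrix.of ![v, k, w]).det = 0 := by
    refine Matrix.exists_mulVec_eq_zero_iff.1 ⟨n, ?_, ?_⟩
    · obtain ⟨i, hi⟩ := h1
      exact fun h => hi (congrFun h i)
    · ext i
      rw [Matrix.mulVec, dotProduct_comm]
      fin_cases i <;> simp [hnv, hnk, hnw]
  obtain ⟨u, hu0, hu⟩ := Matrix.exists_vecMul_eq_zero_iff.2 hdep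
  have hu' : ∀ i, u 0 * v i + u 1 * k i + u 2 * w i = 0 := by
    intro i
    simpa [Matrix.vecMul, dotProduct, Fin.sum_univ_three] using congrFun hu i
  have hn0 : n ≠ 0 := by
    obtain ⟨i, hi⟩ := h1
    exact fun h => hi (congrFun h i)
  -- A relation between `v` and `k` alone would be trivial, as one sees by applying `M`.
  have hu2 : u 2 ≠ 0 := by
    intro h2
    have hz : u 0 • v + u 1 • k = 0 := by
      ext i
      simpa [h2] using hu' i
    have hz' := congrArg M.mulVec hz
    rw [Matrix.mulVec_add, Matrix.mulVec_smul, Matrix.mulVec_smul, hk, hMv] at hz'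
    have hu00 : u 0 = 0 := by simpa [hn0] using hz'
    have hu10 : u 1 = 0 := by simpa [hu00, hk0] using hz
    exact hu0 (by ext i; fin_cases i <;> simp [*])
  have hw' : u 2 • w = -(u 0 • v + u 1 • k) := by
    ext i
    simp only [Pi.smul_apply, Pi.neg_apply, Pi.add_apply, smul_eq_mul]
    linear_combination hu' i
  have hMw : u 2 • M.mulVec w = -(u 0 • (2 : ℂ) • n) := by
    rw [← Matrix.mulVec_smul, hw', Matrix.mulVec_neg, Matrix.mulVec_add, Matrix.mulVec_smul,
      Matrix.mulVec_smul, hk, hMv]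
    simp
  have : u 2 * (w ⬝ᵥ M.mulVec w) = 0 := by
    have := congrArg (fun z => w ⬝ᵥ z) hMw
    simp only [dotProduct_smul, dotProduct_neg, smul_eq_mul] at this
    rw [this, dotProduct_comm, hnw]
    simp
  rw [hww, (mul_eq_zero.1 this).resolve_left hu2, zero_div]

end ExplicitCubics

/-! ### Flexes under rescaling and changes of coordinates -/

section FlexInvariance

theorem isFlex_smul_vec_iff (F : CubicForm) {a : ℂ} (ha : a ≠ 0) (v : Fin 3 → ℂ) :
    IsFlex F.poly (a • v) ↔ IsFlex F.poly v := by
  rw [isFlex_iff, isFlex_iff, eval_smul_of_isHomogeneous F.isHomogeneous]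
  simp only [eval_smul_of_isHomogeneous F.isHomogeneous.pderiv, mul_assoc, ← Finset.mul_sum,
    Pi.smul_apply, smul_eq_mul, mul_left_comm _ a]
  simp [ha]

theorem isFlex_smul_iff (f : MvPolynomial (Fin 3) ℂ) {a : ℂ} (ha : a ≠ 0) (v : Fin 3 → ℂ) :
    IsFlex (a • f) v ↔ IsFlex f v := by
  have h : ∀ (a : ℂ) f, a ≠ 0 → IsFlex f v → IsFlex (a • f) v := by
    rintro a f ha ⟨h0, h1⟩
    refine ⟨by simp [smul_eval, h0], fun w hw => ?_⟩
    rw [map_smul, Polynomial.smul_eq_C_mul]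
    refine Dvd.dvd.mul_left (h1 w ?_) _
    simpa [smul_eval, mul_assoc, ← Finset.mul_sum, ha] using hw
  refine ⟨fun hf => ?_, h a f ha⟩
  simpa [smul_smul, ha] using h a⁻¹ _ (inv_ne_zero ha) hf

theorem isFlex_rep_iff {F : CubicForm} (hF : F ≠ 0) {v : Fin 3 → ℂ} (hv : v ≠ 0) :
    IsFlex (Projectivization.mk ℂ F hF).rep.poly (Projectivization.mk ℂ v hv).rep ↔
      IsFlex F.poly v := by
  obtain ⟨a, ha⟩ := Projectivization.exists_smul_eq_mk_rep ℂ F hF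
  obtain ⟨b, hb⟩ := Projectivization.exists_smul_eq_mk_rep ℂ v hv
  rw [← ha, ← hb, Units.smul_def, Units.smul_def, isFlex_smul_vec_iff _ b.ne_zero, map_smul,
    isFlex_smul_iff _ a.ne_zero]

theorem aeval_line_changeCoord (g : GL (Fin 3) ℂ) (f : MvPolynomial (Fin 3) ℂ) (v w : Fin 3 → ℂ) :
    aeval (fun i => Polynomial.C ((g • v) i) + Polynomial.C ((g • w) i) * Polynomial.X)
      (changeCoord g f) =
    aeval (fun i => Polynomial.C (v i) + Polynomial.C (w i) * Polynomial.X) f := by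
  refine Polynomial.funext fun t => ?_
  have h : ∀ (u z : Fin 3 → ℂ) (p : MvPolynomial (Fin 3) ℂ), Polynomial.eval t
      (aeval (fun i => Polynomial.C (u i) + Polynomial.C (z i) * Polynomial.X) p) =
      eval (u + t • z) p := by
    intro u z p
    induction p using MvPolynomial.induction_on with
    | C a => simp
    | add p q hp hq => simp [hp, hq]
    | mul_X p i hp => simp [hp, mul_comm t]
  rw [h, h, eval_changeCoord, smul_add, inv_smul_smul, smul_comm g⁻¹ t, inv_smul_smul]

/-- The restriction of `g • f` to the line through `g • v` in the direction `g • w` is that of `f`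
to `v + t w`, and the chain rule matches the two tangency conditions. -/
theorem IsFlex.changeCoord {f : MvPolynomial (Fin 3) ℂ} {v : Fin 3 → ℂ} (hf : IsFlex f v)
    (g : GL (Fin 3) ℂ) : IsFlex (changeCoord g f) (g • v) := by
  refine ⟨by rw [eval_changeCoord, inv_smul_smul, hf.1], fun w hw => ?_⟩
  obtain ⟨w, rfl⟩ : ∃ w', w = g • w' := ⟨g⁻¹ • w, by simp⟩
  rw [aeval_line_changeCoord]
  refine hf.2 w ?_
  rw [← hw]
  simp only [pderiv_changeCoord, map_sum, map_mul, eval_changeCoord, inv_smul_smul, eval_C]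
  simp_rw [Finset.sum_mul, mul_assoc]
  rw [Finset.sum_comm]
  refine Finset.sum_congr rfl fun k _ => ?_
  rw [← Finset.mul_sum]
  congr 1
  have := congrFun (inv_smul_smul g w) k
  rw [← this]
  simp only [Units.smul_def, Matrix.smul_eq_mulVec, Matrix.mulVec, dotProduct]

theorem smul_mem_FlexPairs (g : PGL(3, ℂ)) {F : SmoothCubics} {p : ℙ ℂ (Fin 3 → ℂ)}
    (h : (F, p) ∈ FlexPairs) : (g • F, g • p) ∈ FlexPairs := by
  obtain ⟨F, hF⟩ := F
  induction g using Matrix.ProjGenLinGroup.induction_on with | mk g =>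
  induction F using Projectivization.ind with | h F hF0 =>
  induction p using Projectivization.ind with | h v hv =>
  change IsFlex _ _ at h
  rw [isFlex_rep_iff] at h
  exact (isFlex_rep_iff ((smul_ne_zero_iff_ne g).2 hF0) ((smul_ne_zero_iff_ne g).2 hv)).2
    (h.changeCoord g)

theorem smul_mem_FlexPairs_iff (g : PGL(3, ℂ)) {F : SmoothCubics} {p : ℙ ℂ (Fin 3 → ℂ)} :
    (g • F, g • p) ∈ FlexPairs ↔ (F, p) ∈ FlexPairs :=
  ⟨fun h => by simpa using smul_mem_FlexPairs g⁻¹ h, smul_mem_FlexPairs g⟩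

end FlexInvariance

/-! ### The flexes of every smooth Hesse cubic are the base points -/

section HesseFlexes

theorem cubicCoeffs_symm_hesse (l : ℂ) :
    hesseForm l = cubicCoeffs.symm ![1, 1, 1, 0, 0, 0, 0, 0, 0, -3 * l] := by
  refine CubicForm.poly_injective (MvPolynomial.funext fun v => ?_)
  rw [poly_cubicCoeffs_symm, eval_cubicPoly, eval_hesseForm]
  simp
  ring

theorem poly_hesseForm_eq (l : ℂ) :
    (hesseForm l).poly = cubicPoly ![1, 1, 1, 0, 0, 0, 0, 0, 0, -3 * l] := by
  rw [cubicCoeffs_symm_hesse, poly_cubicCoeffs_symm]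

/-- The Hessian determinant of `F_l` is a combination of `x³ + y³ + z³` and `xyz`, so it vanishes at
the base points. Conversely, a single tangent direction suffices to force `xyz = 0`. -/
theorem isFlex_hesse_iff {l : ℂ} (hl : l ^ 3 ≠ 1) {v : Fin 3 → ℂ} (hv : v ≠ 0) :
    IsFlex (hesseForm l).poly v ↔ IsBasePoint v := by
  constructor
  · intro h
    obtain ⟨h0, h1⟩ := (isFlex_iff _ _).1 h
    -- This direction is tangent: its entries are `(0, n₂, -n₁)` for the gradient `3 (n₀, n₁, n₂)`.
    -- Modulo the equation of the curve, the second order condition becomes `(1 - l³) · xyz · x² =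
    -- 0`.
    have h1' := h1 ![0, v 2 ^ 2 - l * v 0 * v 1, -(v 1 ^ 2 - l * v 0 * v 2)]
    rw [poly_hesseForm_eq] at h1'
    simp only [eval_pderiv_cubicPoly, Fin.sum_univ_three] at h1'
    simp at h1'
    have h2 := h1' (by ring)
    rw [eval_hesseForm] at h0
    have h3 : (1 - l ^ 3) * (v 0 * v 1 * v 2) * (v 0 ^ 2) = 0 := by
      linear_combination -h2 / 3 + v 1 * v 2 * h0
    have h4 : v 0 * v 1 * v 2 = 0 := by
      rcases mul_eq_zero.1 h3 with h | h
      · exact (mul_eq_zero.1 h).resolve_left (sub_ne_zero.2 (Ne.symm hl))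
      · simp [pow_eq_zero_iff (two_ne_zero) |>.1 h]
    exact ⟨by linear_combination h0 + 3 * l * h4, h4⟩
  · rintro ⟨h0, h1⟩
    rw [poly_hesseForm_eq]
    refine isFlex_of_det_eq_zero ?_ ?_ ?_
    · rw [← poly_hesseForm_eq, eval_hesseForm, h0, h1]
      simp
    · rw [← poly_hesseForm_eq]
      refine isNonsingular_hesseForm hl v hv ?_
      rw [eval_hesseForm, h0, h1]
      simp
    · rw [Matrix.det_fin_three]
      simp [cubicHess]
      linear_combination (216 - 54 * l ^ 3) * h1 - 54 * l ^ 2 * h0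

end HesseFlexes

/-! ### The nine base points determine the pencil and the Hessian group -/

section HesseFlexPairs

theorem mem_FlexPairs_hesse_iff (l : HesseParam) (p : ℙ ℂ (Fin 3 → ℂ)) :
    (hesse l, p) ∈ FlexPairs ↔ p ∈ basePoints := by
  induction p using Projectivization.ind with | h v hv =>
  exact ((isFlex_rep_iff (hesseForm_ne_zero l) hv).trans (isFlex_hesse_iff l.2 hv)).trans
    (isBasePoint_rep_mk hv).symm

/-- Representatives of the base points of the Hesse pencil. -/
def basePointVec (k : Fin 3) (t : ℂ) : Fin 3 → ℂ :=
  (![![0, 1, -t], ![-t, 0, 1], ![1, -t, 0]] : Fin 3 → Fin 3 → ℂ) k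

theorem basePointVec_ne_zero (k : Fin 3) (t : ℂ) : basePointVec k t ≠ 0 := fun h => by
  have h0 := congrFun h 0
  have h1 := congrFun h 1
  have h2 := congrFun h 2
  fin_cases k <;> simp [basePointVec] at h0 h1 h2

/-- The condition `xyz = 0` puts a base point on one of the three coordinate lines; each line
carries three base points, one for each cube root of unity, and none is a vertex of the triangle, so
none is counted twice. -/
theorem ncard_basePoints : basePoints.ncard = 9 := by
  let R : Finset ℂ := Polynomial.nthRootsFinset 3 (1 : ℂ)
  have hR : ∀ t, t ∈ R ↔ t ^ 3 = 1 := fun t => Polynomial.mem_nthRootsFinset (by norm_num) _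
  let b : Fin 3 × ℂ → ℙ ℂ (Fin 3 → ℂ) := fun q =>
    Projectivization.mk ℂ (basePointVec q.1 q.2) (basePointVec_ne_zero _ _)
  have hcard : ((Finset.univ ×ˢ R : Finset (Fin 3 × ℂ)) : Set (Fin 3 × ℂ)).ncard = 9 := by
    rw [Set.ncard_coe_finset, Finset.card_product,
      (Complex.isPrimitiveRoot_exp 3 (by norm_num)).card_nthRootsFinset]
    simp
  rw [← hcard]
  have hinj : Set.InjOn b (Finset.univ ×ˢ R : Finset (Fin 3 × ℂ)) := by
    rintro ⟨j, s⟩ hs ⟨k, t⟩ ht h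
    have hs' : s ^ 3 = 1 := (hR s).1 (by simpa using hs)
    have ht' : t ^ 3 = 1 := (hR t).1 (by simpa using ht)
    have hs0 : s ≠ 0 := by rintro rfl; simp at hs'
    have ht0 : t ≠ 0 := by rintro rfl; simp at ht'
    obtain ⟨a, ha⟩ := (Projectivization.mk_eq_mk_iff' ℂ _ _ _ _).1 h
    have h0 := congrFun ha 0
    have h1 := congrFun ha 1
    have h2 := congrFun ha 2
    fin_cases j <;> fin_cases k <;> simp [basePointVec] at h0 h1 h2 <;> simp_all
  rw [← hinj.ncard_image]
  congr 1
  ext p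
  induction p using Projectivization.ind with | h v hv =>
  rw [basePoints, Set.mem_ofPred_eq, isBasePoint_rep_mk hv]
  constructor
  · rintro ⟨hs, hp⟩
    have key : ∀ x y : ℂ, x ^ 3 + y ^ 3 = 0 → x ≠ 0 → (-y / x) ^ 3 = 1 := fun x y h hx => by
      field_simp
      linear_combination -h
    have key' : ∀ x y : ℂ, x ^ 3 + y ^ 3 = 0 → x = 0 → y = 0 := fun x y h hx => by
      simpa [hx] using h
    have done : ∀ k (x y : ℂ), x ^ 3 + y ^ 3 = 0 → (x ≠ 0 → x • basePointVec k (-y / x) = v) →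
        (x ≠ 0) → Projectivization.mk ℂ v hv ∈
          b '' ((Finset.univ ×ˢ R : Finset (Fin 3 × ℂ)) : Set (Fin 3 × ℂ)) :=
      fun k x y hxy hx h0 => ⟨(k, -y / x), by simpa using (hR _).2 (key x y hxy h0),
        ((Projectivization.mk_eq_mk_iff' ℂ _ _ _ _).2 ⟨x, hx h0⟩).symm⟩
    rcases mul_eq_zero.1 hp with h | h
    · rcases mul_eq_zero.1 h with h | h
      · refine done 0 (v 1) (v 2) (by simpa [h] using hs) (fun hx => ?_) fun hx => hv ?_
        · ext i; fin_cases i <;> simp [basePointVec, h]; field_simp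
        · have := key' (v 1) (v 2) (by simpa [h] using hs) hx
          ext i; fin_cases i <;> simp [*]
      · refine done 1 (v 2) (v 0) (by simpa [h, add_comm] using hs) (fun hx => ?_) fun hx => hv ?_
        · ext i; fin_cases i <;> simp [basePointVec, h]; field_simp
        · have := key' (v 2) (v 0) (by simpa [h, add_comm] using hs) hx
          ext i; fin_cases i <;> simp [*]
    · refine done 2 (v 0) (v 1) (by simpa [h] using hs) (fun hx => ?_) fun hx => hv ?_
      · ext i; fin_cases i <;> simp [basePointVec, h]; field_simp
      · have := key' (v 0) (v 1) (by simpa [h] using hs) hx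
        ext i; fin_cases i <;> simp [*]
  · rintro ⟨⟨k, t⟩, ht, h⟩
    have ht' : t ^ 3 = 1 := (hR t).1 (by simpa using ht)
    rw [← isBasePoint_rep_mk hv, ← h, isBasePoint_rep_mk]
    fin_cases k <;> simp [IsBasePoint, basePointVec, Odd.neg_pow (by decide : Odd 3), ht']

theorem basePoint_mem_basePoints : basePoint ∈ basePoints := by
  refine (isBasePoint_rep_mk _).2 ⟨?_, ?_⟩ <;> simp [Odd.neg_pow (by decide : Odd 3)]

theorem mem_FlexPairs_smul_hesse_iff (g : PGL(3, ℂ)) (l : HesseParam) (p : ℙ ℂ (Fin 3 → ℂ)) :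
    (g • hesse l, p) ∈ FlexPairs ↔ g⁻¹ • p ∈ basePoints := by
  rw [← mem_FlexPairs_hesse_iff l, ← smul_mem_FlexPairs_iff g (p := g⁻¹ • p), smul_inv_smul]

/-- An element of `PGL₃(ℂ)` that maps one smooth member of the Hesse pencil to another is in the
Hessian group. -/
theorem mem_hessianGroup_of_smul_eq {g : PGL(3, ℂ)} {l m : HesseParam}
    (h : g • hesse l = hesse m) : g ∈ hessianGroup := by
  -- The base points are the flexes of both `F_l` and `F_m = g • F_l`.
  have hb : ∀ p ∈ basePoints, g⁻¹ • p ∈ basePoints := fun p hp => by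
    rw [← mem_FlexPairs_smul_hesse_iff g l, h, mem_FlexPairs_hesse_iff]
    exact hp
  intro k
  induction g using Matrix.ProjGenLinGroup.induction_on with | mk g =>
  set G : CubicForm := g • hesseForm k with hG
  have hG0 : G ≠ 0 := (smul_ne_zero_iff_ne g).2 (hesseForm_ne_zero k)
  have hGn : IsNonsingular G.poly := (isNonsingular_hesseForm k.2).changeCoord g
  -- The flexes of `g • F_k` are the `g`-translates of the base points, which include all base
  -- points by `hb`; in particular `G` vanishes at the nine points. What remains is that such a
  -- cubic lies in the pencil.
  have hv : ∀ j t, t ^ 3 = 1 → eval (basePointVec j t) G.poly = 0 := fun j t ht => by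
    have h1 : Projectivization.mk ℂ _ (basePointVec_ne_zero j t) ∈ basePoints := by
      refine (isBasePoint_rep_mk _).2 ?_
      fin_cases j <;> simp [IsBasePoint, basePointVec, Odd.neg_pow (by decide : Odd 3), ht]
    have h2 := (mem_FlexPairs_smul_hesse_iff (.mk g) k _).2 (hb _ h1)
    have h3 : IsFlex G.poly _ := (isFlex_rep_iff hG0 (basePointVec_ne_zero j t)).1 h2
    exact h3.1
  obtain ⟨w, hw, hw1⟩ : ∃ w : ℂ, w ^ 3 = 1 ∧ w ≠ 1 :=
    have h := Complex.isPrimitiveRoot_exp 3 (by norm_num)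
    ⟨_, h.pow_eq_one, h.ne_one (by norm_num)⟩
  have hw2 : w ^ 2 + w + 1 = 0 := (mul_eq_zero.1 (by linear_combination hw :
    (w - 1) * (w ^ 2 + w + 1) = 0)).resolve_left (sub_ne_zero.2 hw1)
  have hw2' : (w ^ 2) ^ 3 = 1 := by rw [← pow_mul, mul_comm, pow_mul, hw, one_pow]
  set c := cubicCoeffs G with hc
  rw [poly_eq_cubicPoly, ← hc] at hv hGn
  -- On the cube roots of unity `t³ = 1`, so this is a polynomial `(a + e) + b t + d t²` with three
  -- roots. The combinations below are the inverse discrete Fourier transform. It is applied to the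
  -- restriction of `G` to each of the three coordinate lines.
  have three : ∀ a b d e : ℂ, (∀ t : ℂ, t ^ 3 = 1 → a + b * t + d * t ^ 2 + e * t ^ 3 = 0) →
      a + e = 0 ∧ b = 0 ∧ d = 0 := by
    intro a b d e hab
    have h1 := hab 1 (by simp)
    have h2 := hab w hw
    have h3 := hab (w ^ 2) hw2'
    refine ⟨?_, ?_, ?_⟩
    · linear_combination (h1 + h2 + h3) / 3 - b / 3 * hw2 - d / 3 * (hw2 + w * hw)
        - e / 3 * (hw + (w ^ 3 + 1) * hw)
    · linear_combination (h1 + w ^ 2 * h2 + w * h3) / 3 - a / 3 * hw2 - b / 3 * (2 * hw)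
        - d / 3 * (hw2 + (w + w ^ 2) * hw) - e / 3 * (hw2 + w ^ 2 * hw + w * (w ^ 3 + 1) * hw)
    · linear_combination (h1 + w * h2 + w ^ 2 * h3) / 3 - a / 3 * hw2 - b / 3 * (hw2 + w * hw)
        - d / 3 * (hw + (w ^ 3 + 1) * hw) - e / 3 * (hw2 + w * hw + w ^ 2 * (w ^ 3 + 1) * hw)
  have e0 := three (c 1) (-c 4) (c 8) (-c 2) fun t ht => by
    have := hv 0 t ht
    rw [eval_cubicPoly] at this
    simp [basePointVec] at this
    linear_combination this
  have e1 := three (c 2) (-c 5) (c 6) (-c 0) fun t ht => by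
    have := hv 1 t ht
    rw [eval_cubicPoly] at this
    simp [basePointVec] at this
    linear_combination this
  have e2 := three (c 0) (-c 3) (c 7) (-c 1) fun t ht => by
    have := hv 2 t ht
    rw [eval_cubicPoly] at this
    simp [basePointVec] at this
    linear_combination this
  have hc' : c = ![c 0, c 0, c 0, 0, 0, 0, 0, 0, 0, c 9] := by
    ext i
    fin_cases i <;> simp
    · linear_combination -e2.1
    · linear_combination e1.1
    · linear_combination -e2.2.1
    · linear_combination -e0.2.1
    · linear_combination -e1.2.1
    · linear_combination e1.2.2
    · linear_combination e2.2.2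
    · linear_combination e0.2.2
  have hsing : ∀ v : Fin 3 → ℂ, v ≠ 0 → eval v (cubicPoly c) = 0 →
      ¬ ∀ i, eval v (pderiv i (cubicPoly c)) = 0 := fun v hv0 h1 h2 => by
    obtain ⟨i, hi⟩ := hGn v hv0 h1
    exact hi (h2 i)
  -- Otherwise `G` is a multiple of `xyz`, which is singular at a vertex of the triangle.
  have hc0 : c 0 ≠ 0 := fun h0 => by
    refine hsing ![1, 0, 0] (fun h => by simpa using congrFun h 0) ?_ fun i => ?_
    · rw [hc', h0, eval_cubicPoly]; simp
    · rw [hc', h0, eval_pderiv_cubicPoly]; fin_cases i <;> simp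
  set μ : ℂ := -c 9 / (3 * c 0) with hμ
  have hc9 : c 9 = -3 * c 0 * μ := by rw [hμ]; field_simp
  -- For `μ³ = 1` the member `F_μ` is a triangle, singular at `[1 : 1 : μ²]`.
  have hμ1 : μ ^ 3 ≠ 1 := fun h1 => by
    refine hsing ![1, 1, μ ^ 2] (fun h => by simpa using congrFun h 0) ?_ fun i => ?_
    · rw [hc', hc9, eval_cubicPoly]
      simp
      linear_combination c 0 * (μ ^ 3 - 2) * h1
    · rw [hc', hc9, eval_pderiv_cubicPoly]
      fin_cases i <;> simp
      · linear_combination (-3 * c 0) * h1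
      · linear_combination (-3 * c 0) * h1
      · linear_combination (3 * c 0 * μ) * h1
  refine ⟨⟨μ, hμ1⟩, Subtype.ext ?_⟩
  refine (Projectivization.mk_eq_mk_iff' ℂ _ _ _ _).2 ⟨c 0, ?_⟩
  change c 0 • hesseForm μ = G
  refine cubicCoeffs.injective ?_
  rw [← hc, hc', cubicCoeffs_symm_hesse, map_smul, LinearEquiv.apply_symm_apply, hc9]
  ext i
  fin_cases i <;> simp
  ring

end HesseFlexPairs

/-! ### Existence of a flex, by Krull's height theorem -/

section FlexExistence

/-- Setting the variables to zero one at a time gives surjections onto smaller polynomial rings,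
whose kernels form a strict chain of four primes ending inside the ideal of the origin. -/
theorem three_le_height_vanishingIdeal_zero :
    3 ≤ (vanishingIdeal ℂ {(0 : Fin 3 → ℂ)}).height := by
  let φ : (Fin 3 → MvPolynomial (Fin 3) ℂ) → Ideal (MvPolynomial (Fin 3) ℂ) := fun u =>
    RingHom.ker (aeval (R := ℂ) u)
  have hprime : ∀ u, (φ u).IsPrime := fun u => RingHom.ker_isPrime _
  have hlt : ∀ u w : Fin 3 → MvPolynomial (Fin 3) ℂ, (∃ s : Fin 3 → MvPolynomial (Fin 3) ℂ,
      ∀ i, w i = aeval s (u i)) → (∃ i, w i = 0 ∧ u i ≠ 0) → φ u < φ w := by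
    rintro u w ⟨s, hs⟩ ⟨i, hi, hi'⟩
    refine lt_of_le_of_ne (fun p hp => ?_) fun h => hi' ?_
    · have h1 : aeval w p = aeval s (aeval u p) := by
        rw [← AlgHom.comp_apply, comp_aeval]
        simp only [← hs]
      change aeval w p = 0
      rw [h1, show aeval u p = 0 from hp, map_zero]
    · have : (X i : MvPolynomial (Fin 3) ℂ) ∈ φ w := by simp [φ, hi]
      rw [← h] at this
      simpa [φ] using this
  have h1 : φ ![X 0, X 1, X 2] < φ ![0, X 1, X 2] :=
    hlt _ _ ⟨![0, X 1, X 2], fun i => by fin_cases i <;> simp⟩ ⟨0, by simp⟩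
  have h2 : φ ![0, X 1, X 2] < φ ![0, 0, X 2] :=
    hlt _ _ ⟨![0, 0, X 2], fun i => by fin_cases i <;> simp⟩ ⟨1, by simp⟩
  have h3 : φ ![0, 0, X 2] < φ 0 :=
    hlt _ _ ⟨0, fun i => by fin_cases i <;> simp⟩ ⟨2, by simp⟩
  have h4 : φ 0 ≤ vanishingIdeal ℂ {(0 : Fin 3 → ℂ)} := by
    intro p hp
    rw [mem_vanishingIdeal_singleton_iff]
    have h0 : aeval (0 : Fin 3 → MvPolynomial (Fin 3) ℂ) p = 0 := hp
    rw [aeval_zero, algebraMap_eq, C_eq_zero] at h0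
    rw [aeval_zero, h0, map_zero]
  have := hprime ![X 0, X 1, X 2]
  have := hprime ![0, X 1, X 2]
  have := hprime ![0, 0, X 2]
  have := hprime 0
  have e1 := Ideal.height_add_one_le_of_lt_of_isPrime h1
  have e2 := Ideal.height_add_one_le_of_lt_of_isPrime h2
  have e3 := Ideal.height_add_one_le_of_lt_of_isPrime h3
  have e4 := Ideal.height_mono h4
  calc (3 : ℕ∞) = 0 + 1 + 1 + 1 := by norm_num
    _ ≤ (φ ![X 0, X 1, X 2]).height + 1 + 1 + 1 := by gcongr; exact zero_le
    _ ≤ _ := (add_le_add_left (add_le_add_left e1 1) 1).trans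
      ((add_le_add_left e2 1).trans (e3.trans e4))

/-- Two ternary polynomials vanishing at the origin have another common zero. -/
theorem exists_common_zero {f h : MvPolynomial (Fin 3) ℂ} (hf : eval 0 f = 0)
    (hh : eval 0 h = 0) : ∃ v ≠ 0, eval v f = 0 ∧ eval v h = 0 := by
  by_contra! hno
  let I : Ideal (MvPolynomial (Fin 3) ℂ) := Ideal.span {f, h}
  have hz : zeroLocus ℂ I = {0} := by
    rw [zeroLocus_span]
    ext v
    simp only [Set.mem_insert_iff, Set.mem_singleton_iff, forall_eq_or_imp, forall_eq,
      Set.mem_ofPred_eq]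
    constructor
    · rintro ⟨h1, h2⟩
      by_contra hv
      exact hno v hv h1 h2
    · rintro rfl
      exact ⟨hf, hh⟩
  have hrad := vanishingIdeal_zeroLocus_eq_radical (k := ℂ) (K := ℂ) I
  rw [hz] at hrad
  -- If the origin were the only common zero, the Nullstellensatz would make its ideal the radical
  -- of `(f, h)`, hence a minimal prime over two generators. Its height would then be at most `2`.
  have hmin : vanishingIdeal ℂ {(0 : Fin 3 → ℂ)} ∈ I.minimalPrimes := by
    rw [← Ideal.radical_minimalPrimes, ← hrad, Ideal.minimalPrimes_eq_subsingleton_self]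
    rfl
  have h1 := Ideal.height_le_card_of_mem_minimalPrimes_span (Set.toFinite {f, h}) hmin
  have h2 := three_le_height_vanishingIdeal_zero.trans h1
  have h3 : ({f, h} : Set (MvPolynomial (Fin 3) ℂ)).ncard ≤ 2 :=
    (Set.ncard_insert_le f {h}).trans (by simp)
  have h4 : 3 ≤ ({f, h} : Set (MvPolynomial (Fin 3) ℂ)).ncard := by exact_mod_cast h2
  omega

/-- Every smooth plane cubic curve has a flex point. -/
theorem exists_isFlex {F : CubicForm} (hF : IsNonsingular F.poly) :
    ∃ v ≠ 0, IsFlex F.poly v := by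
  set c := cubicCoeffs F with hc
  rw [poly_eq_cubicPoly, ← hc] at hF ⊢
  let H : Matrix (Fin 3) (Fin 3) (MvPolynomial (Fin 3) ℂ) :=
    Matrix.of fun i j => pderiv i (pderiv j (cubicPoly c))
  have hH : ∀ v, eval v H.det = (cubicHess c v).det := fun v => by
    rw [RingHom.map_det]
    congr 1
    ext i j
    have e2 : ∀ i, pderiv i (2 : MvPolynomial (Fin 3) ℂ) = 0 := fun i => pderiv_C (a := 2)
    have e3 : ∀ i, pderiv i (3 : MvPolynomial (Fin 3) ℂ) = 0 := fun i => pderiv_C (a := 3)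
    fin_cases i <;> fin_cases j <;> simp [H, cubicHess, cubicPoly, pderiv_X, e2, e3] <;> ring
  have h0 : (cubicHess c 0).det = 0 := by
    simp [cubicHess, Matrix.det_fin_three]
  -- The Hessian determinant is used as a polynomial, so that the cubic and it have a common zero.
  obtain ⟨v, hv, h1, h2⟩ := exists_common_zero (f := cubicPoly c) (h := H.det)
    (by rw [eval_cubicPoly]; simp) (by rw [hH, h0])
  exact ⟨v, hv, isFlex_of_det_eq_zero h1 (hF v hv h1) (by rw [← hH, h2])⟩

end FlexExistence

/-! ### From a flex to Weierstrass form to Hesse form -/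

section NormalForm

/-- A binary cubic without double root can be expanded at a point where its Taylor coefficients
satisfy `q₁² = 4 q₀ q₂`. -/
theorem exists_expansion_point {q d e f : ℂ} (hq : q ≠ 0)
    (hdbl : ∀ t : ℂ, q * t ^ 3 + d * t ^ 2 + e * t + f = 0 → 3 * q * t ^ 2 + 2 * d * t + e ≠ 0) :
    ∃ β q0 q1 q2 : ℂ, (∀ y z : ℂ, q * (y + β * z) ^ 3 + d * (y + β * z) ^ 2 * z +
        e * (y + β * z) * z ^ 2 + f * z ^ 3 =
        q * y ^ 3 + q2 * y ^ 2 * z + q1 * y * z ^ 2 + q0 * z ^ 3) ∧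
      q1 ^ 2 = 4 * q0 * q2 ∧ q0 ≠ 0 ∧ 54 * q0 ^ 2 * q - q1 ^ 3 ≠ 0 := by
  -- For `P(y) = q y³ + d y² + e y + f` this says `P'² = 2 P P''`, the 3-division equation of `x² =
  -- P(y)`: the line `y = β z` through the flex at infinity passes through two further flexes. It is
  -- a quartic in `β` with leading coefficient `3 q²`.
  obtain ⟨β, hβ⟩ : ∃ β : ℂ, (3 * q * β ^ 2 + 2 * d * β + e) ^ 2 =
      4 * (q * β ^ 3 + d * β ^ 2 + e * β + f) * (3 * q * β + d) := by
    let p : Polynomial ℂ := Polynomial.C (3 * q ^ 2) * Polynomial.X ^ 4 +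
      Polynomial.C (4 * q * d) * Polynomial.X ^ 3 +
      Polynomial.C (6 * q * e) * Polynomial.X ^ 2 + Polynomial.C (12 * q * f) * Polynomial.X +
      Polynomial.C (4 * d * f - e ^ 2)
    have hp : p.degree = (4 : ℕ) := by
      dsimp only [p]
      compute_degree!
    obtain ⟨β, hβ⟩ := IsAlgClosed.exists_root p (by rw [hp]; norm_num)
    refine ⟨β, ?_⟩
    simp [p] at hβ
    linear_combination -hβ
  set q0 := q * β ^ 3 + d * β ^ 2 + e * β + f with hq0
  set q1 := 3 * q * β ^ 2 + 2 * d * β + e with hq1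
  set q2 := 3 * q * β + d with hq2
  have h0 : q0 ≠ 0 := fun h => hdbl β h (by
    rw [h] at hβ
    simpa using hβ)
  refine ⟨β, q0, q1, q2, fun y z => by rw [hq0, hq1, hq2]; ring, hβ, h0, fun h => ?_⟩
  have h1 : q1 ≠ 0 := by
    intro h1
    simp [h1, h0, hq] at h
  have e1 : q = q1 ^ 3 / (54 * q0 ^ 2) := by
    field_simp
    linear_combination h
  have e2 : q2 = q1 ^ 2 / (4 * q0) := by
    field_simp
    linear_combination -hβ
  have ex : ∀ y : ℂ, q * (β + y) ^ 3 + d * (β + y) ^ 2 + e * (β + y) + f =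
      q0 + q1 * y + q2 * y ^ 2 + q * y ^ 3 := fun y => by rw [hq0, hq1, hq2]; ring
  have ex' : ∀ y : ℂ, 3 * q * (β + y) ^ 2 + 2 * d * (β + y) + e =
      q1 + 2 * q2 * y + 3 * q * y ^ 2 := fun y => by rw [hq1, hq2]; ring
  -- In the excluded case, with `u = q₁ y / q₀`, the cubic is `q₀ (1 + u + u²/4 + u³/54)`, which has
  -- the double root `u = -6`.
  refine hdbl (β + -6 * q0 / q1) ?_ ?_
  · rw [ex, e1, e2]
    field_simp
    ring
  · rw [ex', e1, e2]
    field_simp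
    ring

/-- A nonsingular cubic in Weierstrass form is equivalent to a member of the Hesse pencil. -/
theorem exists_hesse_of_weierstrass {c : Fin 10 → ℂ} (hc : IsNonsingular (cubicPoly c))
    (h0 : c 0 = 0) (h3 : c 3 = 0) (h7 : c 7 = 0) (h6 : c 6 ≠ 0) :
    ∃ Q : Matrix (Fin 3) (Fin 3) ℂ, Q.det ≠ 0 ∧ ∃ l : ℂ, l ^ 3 ≠ 1 ∧ ∃ a : ℂ, a ≠ 0 ∧
      (∀ u, eval (Q.mulVec u) (cubicPoly c) = a * eval u (hesseForm l).poly) ∧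
      ∃ b : ℂ, b ≠ 0 ∧ Q.mulVec ![1, -1, 0] = b • ![1, 0, 0] := by
  have hsing : ∀ v : Fin 3 → ℂ, v ≠ 0 → eval v (cubicPoly c) = 0 →
      ¬ ∀ i, eval v (pderiv i (cubicPoly c)) = 0 := fun v hv0 h1 h2 => by
    obtain ⟨i, hi⟩ := hc v hv0 h1
    exact hi (h2 i)
  have hq : c 1 ≠ 0 := by
    intro h1
    -- If `c 1 = 0`, the line `z = 0` is a component. The point used is where it meets the residual
    -- conic `c₆ x² + c₉ x y + c₄ y² + … = 0`, found by completing the square.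
    obtain ⟨s, hs⟩ := IsAlgClosed.exists_pow_nat_eq ((c 9 ^ 2 / (4 * c 6) - c 4) / c 6) two_pos
    refine hsing ![s - c 9 / (2 * c 6), 1, 0] (fun h => by simpa using congrFun h 1) ?_ fun i => ?_
    · rw [eval_cubicPoly]
      simp [h0, h1, h3, h7]
    · rw [eval_pderiv_cubicPoly]
      field_simp at hs
      fin_cases i <;> simp [h0, h1, h3, h7]
      field_simp
      linear_combination hs
  -- Completing the square in `x` gives `c₆ z x² + c₁ y³ + d y² z + e y z² + f z³`.
  set d := c 4 - c 9 ^ 2 / (4 * c 6) with hd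
  set e := c 8 - c 9 * c 5 / (2 * c 6) with he
  set f := c 2 - c 5 ^ 2 / (4 * c 6) with hf
  have hdbl : ∀ t : ℂ, c 1 * t ^ 3 + d * t ^ 2 + e * t + f = 0 →
      3 * c 1 * t ^ 2 + 2 * d * t + e ≠ 0 := by
    intro t ht ht'
    rw [hd, he, hf] at ht
    rw [hd, he] at ht'
    field_simp at ht ht'
    -- A double root of the binary cubic is a singular point of the curve, with completed coordinate
    -- `x = 0`.
    refine hsing ![-(c 9 * t + c 5) / (2 * c 6), t, 1] (fun h => by simpa using congrFun h 2) ?_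
      fun i => ?_
    · rw [eval_cubicPoly]
      simp [h0, h3, h7]
      field_simp
      linear_combination ht / 2
    · rw [eval_pderiv_cubicPoly]
      fin_cases i <;> simp [h0, h3, h7]
      · field_simp
        ring
      · field_simp
        linear_combination ht' / 4
      · field_simp
        linear_combination (3 * ht - t * ht') / 2
  obtain ⟨β, q0, q1, q2, hexp, hq2, hq0, hne⟩ := exists_expansion_point hq hdbl
  have hne' : c 1 - q1 ^ 3 / (54 * q0 ^ 2) ≠ 0 := by
    intro h
    field_simp at h
    exact hne (by linear_combination h)
  -- With `Z = u₀ + u₁ + l u₂`, the tangent at `p₀`, and `D = u₀ - u₁`, one has `4 F_l = 3 Z D² + Z³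
  -- - 6 l Z² u₂ + 9 l² Z u₂² + 4 (1 - l³) u₂³`. Substituting `z = Z`, `y = β Z + s u₂` and `r D`
  -- for the completed coordinate, and comparing coefficients with factor `4 q₀`, determines `s`,
  -- `r` and `l`. The relation `q₁² = 4 q₀ q₂` is what makes the `Z u₂²` term agree.
  obtain ⟨s, hs⟩ := IsAlgClosed.exists_pow_nat_eq (4 * q0 / (c 1 - q1 ^ 3 / (54 * q0 ^ 2)))
    three_pos
  obtain ⟨r, hr⟩ := IsAlgClosed.exists_pow_nat_eq (3 * q0 / c 6) two_pos
  have hs0 : s ≠ 0 := by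
    rintro rfl
    have := div_ne_zero (mul_ne_zero (by norm_num : (4 : ℂ) ≠ 0) hq0) hne'
    exact this (by rw [← hs]; simp)
  have hr0 : r ≠ 0 := by
    rintro rfl
    have := div_ne_zero (mul_ne_zero (three_ne_zero' ℂ) hq0) h6
    exact this (by rw [← hr]; simp)
  have hr' : c 6 * r ^ 2 = 3 * q0 := by rw [hr]; field_simp
  obtain ⟨l, hl⟩ : ∃ l, l = -q1 * s / (6 * q0) := ⟨_, rfl⟩
  have hl' : q1 * s = -6 * q0 * l := by rw [hl]; field_simp
  have hs' : c 1 * s ^ 3 + 4 * q0 * l ^ 3 = 4 * q0 := by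
    have : (c 1 - q1 ^ 3 / (54 * q0 ^ 2)) * s ^ 3 = 4 * q0 := by
      rw [hs, mul_div_assoc', mul_div_cancel_left₀ _ hne']
    have h4 : 4 * q0 * l ^ 3 = -(q1 ^ 3 * s ^ 3) / (54 * q0 ^ 2) := by
      rw [hl]
      field_simp
      ring
    linear_combination this + h4
  have hq2' : q2 * s ^ 2 = 9 * q0 * l ^ 2 := by
    have : 4 * q0 * (q2 * s ^ 2 - 9 * q0 * l ^ 2) = 0 := by
      linear_combination -s ^ 2 * hq2 + (q1 * s - 6 * q0 * l) * hl'
    have := (mul_eq_zero.1 this).resolve_left (mul_ne_zero (by norm_num) hq0)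
    linear_combination this
  have hl1 : l ^ 3 ≠ 1 := by
    intro h
    rw [h] at hs'
    have : c 1 * s ^ 3 ≠ 0 := mul_ne_zero hq (pow_ne_zero 3 hs0)
    exact this (by linear_combination hs')
  have hform : ∀ x y z : ℂ, eval ![x - (c 9 * y + c 5 * z) / (2 * c 6), y, z] (cubicPoly c) =
      c 6 * z * x ^ 2 + (c 1 * y ^ 3 + d * y ^ 2 * z + e * y * z ^ 2 + f * z ^ 3) := by
    intro x y z
    rw [eval_cubicPoly, hd, he, hf]
    simp [h0, h3, h7]
    field_simp
    ring
  let k : ℂ := (c 9 * β + c 5) / (2 * c 6)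
  let k' : ℂ := c 9 * s / (2 * c 6)
  let Q : Matrix (Fin 3) (Fin 3) ℂ := !![r - k, -r - k, -(k' + k * l); β, β, s + β * l; 1, 1, l]
  have hQ : ∀ u, Q.mulVec u = ![r * (u 0 - u 1) - (c 9 * (s * u 2 + β * (u 0 + u 1 + l * u 2)) +
      c 5 * (u 0 + u 1 + l * u 2)) / (2 * c 6), s * u 2 + β * (u 0 + u 1 + l * u 2),
      u 0 + u 1 + l * u 2] := by
    intro u
    ext i
    fin_cases i <;> simp [Q, k, k', Matrix.mulVec, dotProduct, Fin.sum_univ_three]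
    · field_simp
      ring
    · ring
  refine ⟨Q, ?_, l, hl1, 4 * q0, mul_ne_zero (by norm_num) hq0, fun u => ?_, 2 * r,
    mul_ne_zero two_ne_zero hr0, ?_⟩
  · have : Q.det = -2 * r * s := by
      simp [Q, Matrix.det_fin_three]
      ring
    rw [this]
    exact mul_ne_zero (mul_ne_zero (by norm_num) hr0) hs0
  · rw [hQ, hform, hexp, eval_hesseForm]
    linear_combination (u 0 + u 1 + l * u 2) * (u 0 - u 1) ^ 2 * hr' + u 2 ^ 3 * hs' +
      u 2 ^ 2 * (u 0 + u 1 + l * u 2) * hq2' + u 2 * (u 0 + u 1 + l * u 2) ^ 2 * hl'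
  · rw [hQ]
    ext i
    fin_cases i <;> simp
    ring

open scoped ComplexOrder in
/-- A flex point of a smooth plane cubic can be moved to `[1 : 0 : 0]`, and its tangent line to
`z = 0`. -/
theorem exists_flex_frame {n v : Fin 3 → ℂ} (hn : n ≠ 0) (hv : v ≠ 0) (hnv : n ⬝ᵥ v = 0) :
    ∃ P : Matrix (Fin 3) (Fin 3) ℂ, P.det ≠ 0 ∧ P.mulVec ![1, 0, 0] = v ∧
      n ⬝ᵥ P.mulVec ![0, 1, 0] = 0 := by
  -- The columns are `v`, `n × v̄` and `n̄`. The second is orthogonal to `n`, and `n ⬝ᵥ v = 0`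
  -- reduces the determinant to `|n|² |v|²`.
  let P : Matrix (Fin 3) (Fin 3) ℂ := (Matrix.of ![v, crossProduct n (star v), star n]).transpose
  have hpos : ∀ u : Fin 3 → ℂ, u ≠ 0 → u ⬝ᵥ star u ≠ 0 := fun u hu h =>
    hu (dotProduct_self_star_eq_zero.1 h)
  refine ⟨P, ?_, ?_, ?_⟩
  · have h : P.det = (n ⬝ᵥ star n) * (v ⬝ᵥ star v) := by
      simp [dotProduct, Fin.sum_univ_three] at hnv
      rw [Matrix.det_transpose, Matrix.det_fin_three]
      simp [cross_apply, dotProduct, Fin.sum_univ_three]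
      linear_combination -(starRingEnd ℂ (n 0) * starRingEnd ℂ (v 0) +
        starRingEnd ℂ (n 1) * starRingEnd ℂ (v 1) + starRingEnd ℂ (n 2) * starRingEnd ℂ (v 2)) * hnv
    rw [h]
    exact mul_ne_zero (hpos n hn) (hpos v hv)
  · ext i
    fin_cases i <;> simp [P, Matrix.mulVec, dotProduct, Fin.sum_univ_three]
  · simp [P, Matrix.mulVec, dotProduct, Fin.sum_univ_three, cross_apply]
    ring

/-- Every flex of a smooth plane cubic is equivalent to the base point on a member of the Hesse
pencil. -/
theorem exists_hesse_of_isFlex {F : CubicForm} (hF : IsNonsingular F.poly) {v : Fin 3 → ℂ}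
    (hv : v ≠ 0) (hflex : IsFlex F.poly v) :
    ∃ (g : GL (Fin 3) ℂ) (l a b : ℂ), l ^ 3 ≠ 1 ∧ a ≠ 0 ∧ b ≠ 0 ∧ a • F = g • hesseForm l ∧
      b • v = g • ![1, -1, 0] := by
  let n : Fin 3 → ℂ := fun i => eval v (pderiv i F.poly)
  have hn : n ≠ 0 := fun h => by
    obtain ⟨i, hi⟩ := hF v hv hflex.1
    exact hi (congrFun h i)
  have hnv : n ⬝ᵥ v = 0 := by
    have h := hflex.1
    simp only [n, poly_eq_cubicPoly F] at h ⊢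
    rw [eval_cubicPoly] at h
    simp [eval_pderiv_cubicPoly, dotProduct, Fin.sum_univ_three]
    linear_combination 3 * h
  obtain ⟨P, hP, hPv, hPn⟩ := exists_flex_frame hn hv hnv
  let p : GL (Fin 3) ℂ := Matrix.GeneralLinearGroup.mkOfDetNeZero P hP
  have hp : ∀ u : Fin 3 → ℂ, p • u = P.mulVec u := fun u => rfl
  let G : CubicForm := p⁻¹ • F
  have hG : IsNonsingular G.poly := hF.changeCoord p⁻¹
  have hGflex : IsFlex G.poly ![1, 0, 0] := by
    have := hflex.changeCoord p⁻¹
    rwa [← hPv, ← hp, inv_smul_smul] at this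
  have hGeval : ∀ u, eval u G.poly = eval (P.mulVec u) F.poly := fun u => by
    rw [← hp, show G.poly = changeCoord p⁻¹ F.poly from rfl, eval_changeCoord, inv_inv]
  set c := cubicCoeffs G with hc
  have hGc : G.poly = cubicPoly c := poly_eq_cubicPoly G
  rw [isFlex_iff] at hGflex
  rw [hGc] at hG hGflex
  obtain ⟨h1, h2⟩ := hGflex
  -- In this frame, `c 0 = 0` says that the flex is on the curve, `c 3 = 0` that its tangent is `z =
  -- 0`, `c 7 = 0` that the contact has order at least three, and `c 6 ≠ 0` that the point is
  -- nonsingular.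
  have h0 : c 0 = 0 := by
    rw [eval_cubicPoly] at h1
    simpa using h1
  have h3 : c 3 = 0 := by
    have hd := pderiv_changeCoord p⁻¹ 1 F.poly
    have hd' := congrArg (eval ![1, 0, 0]) hd
    rw [show changeCoord p⁻¹ F.poly = G.poly from rfl, hGc] at hd'
    rw [eval_pderiv_cubicPoly] at hd'
    simp only [map_sum, map_mul, eval_changeCoord, inv_inv, hp, hPv, eval_C] at hd'
    simp at hd'
    rw [hd', ← hPn]
    simp [n, dotProduct, Matrix.mulVec, Fin.sum_univ_three, p]
  have h7 : c 7 = 0 := by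
    have := h2 ![0, 1, 0] (by simp [eval_pderiv_cubicPoly, Fin.sum_univ_three, h0, h3])
    simpa [eval_pderiv_cubicPoly, Fin.sum_univ_three] using this
  have h6 : c 6 ≠ 0 := by
    intro h6
    obtain ⟨i, hi⟩ := hG ![1, 0, 0] (fun h => by simpa using congrFun h 0) h1
    refine hi ?_
    rw [eval_pderiv_cubicPoly]
    fin_cases i <;> simp [h0, h3, h6]
  obtain ⟨Q, hQ, l, hl, a, ha, hQa, b, hb, hQb⟩ := exists_hesse_of_weierstrass hG h0 h3 h7 h6
  let q : GL (Fin 3) ℂ := Matrix.GeneralLinearGroup.mkOfDetNeZero Q hQ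
  have hq : ∀ u : Fin 3 → ℂ, q • u = Q.mulVec u := fun u => rfl
  refine ⟨p * q, l, a⁻¹, b, hl, inv_ne_zero ha, hb, ?_, ?_⟩
  · refine CubicForm.poly_injective (MvPolynomial.funext fun u => ?_)
    obtain ⟨w, rfl⟩ : ∃ w, u = (p * q) • w := ⟨(p * q)⁻¹ • u, (smul_inv_smul _ _).symm⟩
    rw [poly_smul, eval_changeCoord, inv_smul_smul, mul_smul, hq, hp, map_smul, smul_eval,
      ← hGeval, hGc, hQa]
    field_simp
  · rw [mul_smul, hq, hQb, hp, Matrix.mulVec_smul, hPv]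

end NormalForm

/-! ### Inverse function theorem: nearby cubics are coordinate changes of Hesse cubics -/

section HesseFrames

/-- The coefficient of `uₐ³` in `F_λ(m u)`. -/
noncomputable def hesseCube (m : Fin 3 × Fin 3 → ℂ) (l : ℂ) (a : Fin 3) : ℂ :=
  m (0, a) ^ 3 + m (1, a) ^ 3 + m (2, a) ^ 3 - 3 * l * (m (0, a) * m (1, a) * m (2, a))

/-- The coefficient of `uₐ² u_b` in `F_λ(m u)`, for `a ≠ b`. -/
noncomputable def hesseSq (m : Fin 3 × Fin 3 → ℂ) (l : ℂ) (a b : Fin 3) : ℂ :=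
  3 * (m (0, a) ^ 2 * m (0, b) + m (1, a) ^ 2 * m (1, b) + m (2, a) ^ 2 * m (2, b)) -
    3 * l * (m (0, a) * m (1, a) * m (2, b) + m (0, a) * m (1, b) * m (2, a) +
      m (0, b) * m (1, a) * m (2, a))

/-- The coefficient of `u₀ u₁ u₂` in `F_λ(m u)`. -/
noncomputable def hesseMix (m : Fin 3 × Fin 3 → ℂ) (l : ℂ) : ℂ :=
  6 * (m (0, 0) * m (0, 1) * m (0, 2) + m (1, 0) * m (1, 1) * m (1, 2) +
      m (2, 0) * m (2, 1) * m (2, 2)) -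
    3 * l * (m (0, 0) * m (1, 1) * m (2, 2) + m (0, 0) * m (1, 2) * m (2, 1) +
      m (0, 1) * m (1, 0) * m (2, 2) + m (0, 1) * m (1, 2) * m (2, 0) +
      m (0, 2) * m (1, 0) * m (2, 1) + m (0, 2) * m (1, 1) * m (2, 0))

/-- The coefficients of the cubic form `F_λ(m u)` in `u`. -/
noncomputable def hesseCoeffs (m : Fin 3 × Fin 3 → ℂ) (l : ℂ) : Fin 10 → ℂ :=
  ![hesseCube m l 0, hesseCube m l 1, hesseCube m l 2, hesseSq m l 0 1, hesseSq m l 1 2,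
    hesseSq m l 2 0, hesseSq m l 0 2, hesseSq m l 1 0, hesseSq m l 2 1, hesseMix m l]

theorem eval_hesseCoeffs (m : Fin 3 × Fin 3 → ℂ) (l : ℂ) (u : Fin 3 → ℂ) :
    eval u (cubicPoly (hesseCoeffs m l)) =
      eval (fun i => ∑ j, m (i, j) * u j) (hesseForm l).poly := by
  rw [eval_cubicPoly, eval_hesseForm]
  simp [hesseCoeffs, hesseCube, hesseSq, hesseMix, Fin.sum_univ_three]
  ring

theorem contDiff_hesseCoeffs : ContDiff ℝ ∞ fun q : (Fin 3 × Fin 3 → ℂ) × ℂ =>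
    hesseCoeffs q.1 q.2 := by
  refine contDiff_pi.2 fun i => ?_
  fin_cases i <;> simp [hesseCoeffs, hesseCube, hesseSq, hesseMix] <;> fun_prop

/-- The infinitesimal change of frame that achieves a given first order change `δ` of the
coefficients of `F_λ`. -/
noncomputable def frameShift (l : ℂ) (δ : Fin 10 → ℂ) : Matrix (Fin 3) (Fin 3) ℂ :=
  !![δ 0 / 3, (δ 3 + l * δ 5 + l ^ 2 * δ 4) / (3 * (1 - l ^ 3)),
      (δ 6 + l * δ 7 + l ^ 2 * δ 8) / (3 * (1 - l ^ 3));
    (δ 7 + l * δ 8 + l ^ 2 * δ 6) / (3 * (1 - l ^ 3)), δ 1 / 3,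
      (δ 4 + l * δ 3 + l ^ 2 * δ 5) / (3 * (1 - l ^ 3));
    (δ 5 + l * δ 4 + l ^ 2 * δ 3) / (3 * (1 - l ^ 3)),
      (δ 8 + l * δ 6 + l ^ 2 * δ 7) / (3 * (1 - l ^ 3)), δ 2 / 3]

/-- The infinitesimal change of parameter that achieves a given first order change `δ` of the
coefficients of `F_λ`. -/
noncomputable def paramShift (l : ℂ) (δ : Fin 10 → ℂ) : ℂ :=
  -(l * (δ 0 + δ 1 + δ 2) + δ 9) / 3

/-- The entries of `1 + A` where `A` is the infinitesimal change of frame. -/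
noncomputable def shiftedFrame (l : ℂ) (δ : Fin 10 → ℂ) (i : Fin 3 × Fin 3) : ℂ :=
  (1 : Matrix (Fin 3) (Fin 3) ℂ) i.1 i.2 + frameShift l δ i.1 i.2

theorem contDiff_shiftedFrame (l : ℂ) : ContDiff ℝ ∞ (shiftedFrame l) := by
  refine contDiff_pi.2 fun ⟨i, j⟩ => ?_
  fin_cases i <;> fin_cases j <;> simp [shiftedFrame, frameShift] <;> fun_prop

theorem contDiff_paramShift (l : ℂ) : ContDiff ℝ ∞ (paramShift l) := by
  unfold paramShift
  fun_prop

/-- To first order `F_{l+ν}((1 + A) u)` changes by `∑ ∂ᵢF_l(u) (A u)ᵢ - 3 ν u₀u₁u₂`. The cubes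
determine the diagonal of `A`, and `u₀u₁u₂` then determines `ν`. The off-diagonal entries split into
two cyclic `3 × 3` systems, one being `A₀₁ - l A₂₀ = δ₃/3`, `A₂₀ - l A₁₂ = δ₅/3`, `A₁₂ - l A₀₁ =
δ₄/3`, whose determinant is `1 - l³`. `frameShift` and `paramShift` are the solution, so the
derivative is the identity. -/
theorem hasDerivAt_hesseCoeffs {l : ℂ} (hl : l ^ 3 ≠ 1) (δ : Fin 10 → ℂ) :
    HasDerivAt
      (fun t : ℝ => hesseCoeffs (shiftedFrame l (t • δ)) (l + paramShift l (t • δ))) δ 0 := by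
  have hl' : 1 - l ^ 3 ≠ 0 := sub_ne_zero.2 (Ne.symm hl)
  have hid : HasDerivAt (fun t : ℝ => (t : ℂ)) 1 0 := Complex.ofRealCLM.hasDerivAt
  have hm : ∀ i j,
      HasDerivAt (fun t : ℝ => shiftedFrame l (t • δ) (i, j)) (frameShift l δ i j) 0 := by
    intro i j
    have h : ∀ t : ℝ, shiftedFrame l (t • δ) (i, j) =
        (1 : Matrix (Fin 3) (Fin 3) ℂ) i j + t * frameShift l δ i j := fun t => by
      simp only [shiftedFrame]
      congr 1
      fin_cases i <;> fin_cases j <;> simp [frameShift] <;> ring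
    simp only [h]
    simpa using (hid.mul_const (frameShift l δ i j)).const_add ((1 : Matrix (Fin 3) (Fin 3) ℂ) i j)
  have hp : HasDerivAt (fun t : ℝ => l + paramShift l (t • δ)) (paramShift l δ) 0 := by
    have h : ∀ t : ℝ, paramShift l (t • δ) = t * paramShift l δ := fun t => by
      simp [paramShift]
      ring
    simp only [h]
    simpa using (hid.mul_const (paramShift l δ)).const_add l
  have h0 : ∀ i j, shiftedFrame l ((0 : ℝ) • δ) (i, j) = (1 : Matrix (Fin 3) (Fin 3) ℂ) i j := by
    intro i j
    simp only [shiftedFrame]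
    fin_cases i <;> fin_cases j <;> simp [frameShift]
  have hp0 : l + paramShift l ((0 : ℝ) • δ) = l := by simp [paramShift]
  have cube : ∀ a, HasDerivAt (fun t : ℝ => hesseCube (shiftedFrame l (t • δ))
      (l + paramShift l (t • δ)) a) _ 0 := fun a =>
    ((((hm 0 a).pow 3).add ((hm 1 a).pow 3)).add ((hm 2 a).pow 3)).sub
      ((hp.const_mul 3).mul (((hm 0 a).mul (hm 1 a)).mul (hm 2 a)))
  have sq : ∀ a b, HasDerivAt (fun t : ℝ => hesseSq (shiftedFrame l (t • δ))
      (l + paramShift l (t • δ)) a b) _ 0 := fun a b =>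
    ((((((hm 0 a).pow 2).mul (hm 0 b)).add (((hm 1 a).pow 2).mul (hm 1 b))).add
      (((hm 2 a).pow 2).mul (hm 2 b))).const_mul 3).sub ((hp.const_mul 3).mul
      (((((hm 0 a).mul (hm 1 a)).mul (hm 2 b)).add (((hm 0 a).mul (hm 1 b)).mul (hm 2 a))).add
      (((hm 0 b).mul (hm 1 a)).mul (hm 2 a))))
  have mix : HasDerivAt (fun t : ℝ => hesseMix (shiftedFrame l (t • δ))
      (l + paramShift l (t • δ))) _ 0 :=
    ((((((hm 0 0).mul (hm 0 1)).mul (hm 0 2)).add (((hm 1 0).mul (hm 1 1)).mul (hm 1 2))).add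
      (((hm 2 0).mul (hm 2 1)).mul (hm 2 2))).const_mul 6).sub ((hp.const_mul 3).mul
      ((((((((hm 0 0).mul (hm 1 1)).mul (hm 2 2)).add (((hm 0 0).mul (hm 1 2)).mul (hm 2 1))).add
      (((hm 0 1).mul (hm 1 0)).mul (hm 2 2))).add (((hm 0 1).mul (hm 1 2)).mul (hm 2 0))).add
      (((hm 0 2).mul (hm 1 0)).mul (hm 2 1))).add (((hm 0 2).mul (hm 1 1)).mul (hm 2 0))))
  refine hasDerivAt_pi.2 fun i => ?_
  fin_cases i
  · refine (cube 0).congr_deriv ?_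
    simp only [Pi.mul_apply, h0, hp0]
    simp [frameShift]
    ring
  · refine (cube 1).congr_deriv ?_
    simp only [Pi.mul_apply, h0, hp0]
    simp [frameShift]
    ring
  · refine (cube 2).congr_deriv ?_
    simp only [Pi.mul_apply, h0, hp0]
    simp [frameShift]
    ring
  · refine (sq 0 1).congr_deriv ?_
    simp only [Pi.mul_apply, Pi.pow_apply, h0, hp0]
    simp [frameShift]
    field_simp
    ring
  · refine (sq 1 2).congr_deriv ?_
    simp only [Pi.mul_apply, Pi.pow_apply, h0, hp0]
    simp [frameShift]
    field_simp
    ring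
  · refine (sq 2 0).congr_deriv ?_
    simp only [Pi.mul_apply, Pi.pow_apply, h0, hp0]
    simp [frameShift]
    field_simp
    ring
  · refine (sq 0 2).congr_deriv ?_
    simp only [Pi.mul_apply, Pi.pow_apply, h0, hp0]
    simp [frameShift]
    field_simp
    ring
  · refine (sq 1 0).congr_deriv ?_
    simp only [Pi.mul_apply, Pi.pow_apply, h0, hp0]
    simp [frameShift]
    field_simp
    ring
  · refine (sq 2 1).congr_deriv ?_
    simp only [Pi.mul_apply, Pi.pow_apply, h0, hp0]
    simp [frameShift]
    field_simp
    ring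
  · refine mix.congr_deriv ?_
    simp only [Pi.mul_apply, h0, hp0]
    simp [frameShift, paramShift]
    field_simp
    ring

/-- A smooth map whose derivative at `0` is the identity has a smooth local right inverse. -/
theorem exists_smooth_right_inverse {E : Type*} [NormedAddCommGroup E] [NormedSpace ℝ E]
    [CompleteSpace E] {f : E → E} (hf : ContDiff ℝ ∞ f)
    (h : ∀ δ : E, HasDerivAt (fun t : ℝ => f (t • δ)) δ 0) :
    ∃ s : E → E, ContDiffAt ℝ ∞ s (f 0) ∧ s (f 0) = 0 ∧ ∀ᶠ c in 𝓝 (f 0), f (s c) = c := by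
  have hdiff : DifferentiableAt ℝ f 0 := (hf.differentiable (by simp)).differentiableAt
  -- Differentiability being known, the derivatives along lines through `0` identify the full
  -- derivative.
  have hd : HasFDerivAt f ((ContinuousLinearEquiv.refl ℝ E : E ≃L[ℝ] E) : E →L[ℝ] E) 0 := by
    refine hdiff.hasFDerivAt.congr_fderiv (ContinuousLinearMap.ext fun δ => ?_)
    have h2 : HasDerivAt (fun t : ℝ => t • δ) δ 0 := by
      simpa using (hasDerivAt_id (0 : ℝ)).smul_const δ
    have h3 : HasFDerivAt f (fderiv ℝ f 0) ((0 : ℝ) • δ) := by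
      rw [zero_smul]
      exact hdiff.hasFDerivAt
    exact (h3.comp_hasDerivAt 0 h2).unique (h δ)
  exact ⟨_, hf.contDiffAt.to_localInverse hd (by simp),
    hf.contDiffAt.localInverse_apply_image hd (by simp),
    (hf.contDiffAt.hasStrictFDerivAt' hd (by simp)).eventually_right_inverse⟩

/-- Every cubic close to `F_λ` is smoothly of the form `F_μ ∘ m`. -/
theorem exists_hesse_frame {l : ℂ} (hl : l ^ 3 ≠ 1) :
    ∃ (m : (Fin 10 → ℂ) → Fin 3 × Fin 3 → ℂ) (μ : (Fin 10 → ℂ) → ℂ),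
      ContDiffAt ℝ ∞ m (cubicCoeffs (hesseForm l)) ∧
      ContDiffAt ℝ ∞ μ (cubicCoeffs (hesseForm l)) ∧
      (∀ i j, m (cubicCoeffs (hesseForm l)) (i, j) = (1 : Matrix (Fin 3) (Fin 3) ℂ) i j) ∧
      μ (cubicCoeffs (hesseForm l)) = l ∧
      ∀ᶠ c in 𝓝 (cubicCoeffs (hesseForm l)), hesseCoeffs (m c) (μ c) = c := by
  let f : (Fin 10 → ℂ) → Fin 10 → ℂ := fun δ => hesseCoeffs (shiftedFrame l δ) (l + paramShift l δ)
  have hf : ContDiff ℝ ∞ f := ContDiff.comp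
    (g := fun q : (Fin 3 × Fin 3 → ℂ) × ℂ => hesseCoeffs q.1 q.2)
    (f := fun δ => (shiftedFrame l δ, l + paramShift l δ)) contDiff_hesseCoeffs
    ((contDiff_shiftedFrame l).prodMk (contDiff_const.add (contDiff_paramShift l)))
  have hS0 : ∀ i j, shiftedFrame l 0 (i, j) = (1 : Matrix (Fin 3) (Fin 3) ℂ) i j := by
    intro i j
    simp only [shiftedFrame]
    fin_cases i <;> fin_cases j <;> simp [frameShift]
  have hp0 : l + paramShift l 0 = l := by simp [paramShift]
  have hf0 : f 0 = cubicCoeffs (hesseForm l) := by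
    rw [cubicCoeffs_symm_hesse, LinearEquiv.apply_symm_apply]
    simp only [f, hp0]
    ext i
    fin_cases i <;> simp [hesseCoeffs, hesseCube, hesseSq, hesseMix, hS0]
  obtain ⟨s, hs, hs0, hev⟩ := exists_smooth_right_inverse hf (hasDerivAt_hesseCoeffs hl)
  rw [hf0] at hs hs0 hev
  refine ⟨fun c => shiftedFrame l (s c), fun c => l + paramShift l (s c),
    (contDiff_shiftedFrame l).contDiffAt.comp _ hs,
    contDiffAt_const.add ((contDiff_paramShift l).contDiffAt.comp _ hs), fun i j => ?_, ?_, hev⟩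
  · simp only [hs0, hS0]
  · simp only [hs0, hp0]

end HesseFrames

/-! ### Smoothness of the group actions and of the Hesse parameter -/

section SmoothActions

variable {E H P : Type*} [NormedAddCommGroup E] [NormedSpace ℝ E] [TopologicalSpace H]
  {J : ModelWithCorners ℝ E H} [TopologicalSpace P] [ChartedSpace H P]

/-- `PGL₃(ℂ)` acts smoothly on the projective plane. -/
theorem contMDiff_pgl_smul_proj : ContMDiff (modelPGL.prod modelPlane) modelPlane ∞
    fun q : PGL(3, ℂ) × ℙ ℂ (Fin 3 → ℂ) => q.1 • q.2 := by
  rintro ⟨g, p⟩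
  induction g using Matrix.ProjGenLinGroup.induction_on with | mk g =>
  induction p using Projectivization.ind with | h v hv =>
  obtain ⟨σ, hσ, hσ'⟩ := exists_lift_pgl g
  obtain ⟨τ, hτ, -, hτ'⟩ := exists_lift_proj hv
  let x : PGL(3, ℂ) × ℙ ℂ (Fin 3 → ℂ) := (.mk g, Projectivization.mk ℂ v hv)
  have h1 : ContMDiffAt (modelPGL.prod modelPlane) 𝓘(ℝ, Fin 3 × Fin 3 → ℂ) ∞
      (fun q : PGL(3, ℂ) × ℙ ℂ (Fin 3 → ℂ) => (entries (σ q.1)).1) x :=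
    ContMDiffAt.comp (I' := modelPGL) (g := fun h : PGL(3, ℂ) => (entries (σ h)).1)
      (f := Prod.fst) x hσ contMDiff_fst.contMDiffAt
  have h2 : ContMDiffAt (modelPGL.prod modelPlane) 𝓘(ℝ, Fin 3 → ℂ) ∞
      (fun q : PGL(3, ℂ) × ℙ ℂ (Fin 3 → ℂ) => τ q.2) x :=
    ContMDiffAt.comp (I' := modelPlane) x hτ contMDiff_snd.contMDiffAt
  have h3 : ContDiff ℝ ∞ fun z : (Fin 3 × Fin 3 → ℂ) × (Fin 3 → ℂ) =>
      fun i => ∑ j, z.1 (i, j) * z.2 j := by fun_prop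
  refine contMDiffAt_proj_of_lift (u := fun (q : PGL(3, ℂ) × ℙ ℂ (Fin 3 → ℂ)) i =>
    ∑ j, (entries (σ q.1)).1 (i, j) * τ q.2 j)
    (h3.contMDiff.contMDiffAt.comp x (h1.prodMk_space h2)) ?_
  have h4 := (continuous_fst.continuousAt (x := x)).eventually hσ'
  have h5 := (continuous_snd.continuousAt (x := x)).eventually hτ'
  filter_upwards [h4, h5] with q h6 ⟨hq, h7⟩
  refine ⟨(smul_ne_zero_iff_ne (σ q.1)).2 hq, ?_⟩
  conv_lhs => rw [h6, h7]
  rfl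

/-- Right multiplication in `PGL₃(ℂ)` is smooth. -/
theorem contMDiff_pgl_mul_right (c : PGL(3, ℂ)) :
    ContMDiff modelPGL modelPGL ∞ fun g : PGL(3, ℂ) => g * c := by
  intro g
  induction g using Matrix.ProjGenLinGroup.induction_on with | mk g =>
  induction c using Matrix.ProjGenLinGroup.induction_on with | mk c =>
  obtain ⟨σ, hσ, hσ'⟩ := exists_lift_pgl g
  have h3 : ContDiff ℝ ∞ fun z : Fin 3 × Fin 3 → ℂ =>
      fun i : Fin 3 × Fin 3 => ∑ j, z (i.1, j) * c j i.2 := by fun_prop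
  refine contMDiffAt_pgl_of_lift
    (u := fun q => fun i => ∑ j, (entries (σ q)).1 (i.1, j) * c j i.2)
    (h3.contMDiff.contMDiffAt.comp _ hσ) ?_
  filter_upwards [hσ'] with q hq
  refine ⟨σ q * c, ?_, 1, one_ne_zero, fun i => ?_⟩
  · conv_lhs => rw [hq]
    rfl
  · rw [one_mul]
    rfl

theorem contDiff_coeffs_cubicCoeffs_symm :
    ContDiff ℝ ∞ fun c : Fin 10 → ℂ => coeffs (cubicCoeffs.symm c) := by
  let L : (Fin 10 → ℂ) →ₗ[ℂ] (CubicExponent → ℂ) :=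
    coeffs.toLinearMap ∘ₗ cubicCoeffs.symm.toLinearMap
  exact (L.toContinuousLinearMap.restrictScalars ℝ).contDiff

/-- The parameter of a member of the Hesse pencil depends smoothly on the curve. -/
theorem contMDiffAt_hesseInv (l : HesseParam) :
    ContMDiffAt modelCubics 𝓘(ℝ, ℂ) ∞ hesseInv (hesse l) := by
  obtain ⟨σ, h1, h2, h3⟩ := exists_lift_cubics (hesse l) (hesseForm_ne_zero l) rfl
  let A : (Fin 3 → ℂ) → (CubicExponent → ℂ) →ₗ[ℂ] ℂ := fun v =>
    (aeval (R := ℂ) v).toLinearMap ∘ₗ CubicForm.poly ∘ₗ coeffs.symm.toLinearMap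
  have hA : ∀ v G, A v (coeffs G) = eval v (CubicForm.poly G) := fun v G => by
    simp [A]
  have hAc : ∀ v, ContDiff ℝ ∞ (A v) := fun v =>
    ((A v).toContinuousLinearMap.restrictScalars ℝ).contDiff
  have hd : ContDiffAt ℝ ∞ (fun a => 1 - A ![1, 1, 1] a * (3 * A ![1, 0, 0] a)⁻¹)
      (coeffs (hesseForm l)) := by
    refine contDiffAt_const.sub ((hAc _).contDiffAt.mul
      ((contDiffAt_const.mul (hAc _).contDiffAt).inv ?_))
    rw [hA, eval_hesseForm]
    simp
  rw [← h2] at hd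
  refine (ContMDiffAt.comp (f := fun F => coeffs (σ F)) _ hd.contMDiffAt
    h1).congr_of_eventuallyEq ?_
  filter_upwards [h3] with F ⟨hF, h⟩
  obtain ⟨a, ha⟩ := Projectivization.exists_smul_eq_mk_rep ℂ _ hF
  have ha0 := a.ne_zero
  simp only [Function.comp_apply, hA, ← div_eq_mul_inv]
  rw [hesseInv, h, ← ha, Units.smul_def]
  simp only [map_smul, smul_eval]
  rw [mul_left_comm, mul_div_mul_left _ _ ha0]

end SmoothActions

/-! ### The orbit map is smooth and has smooth local sections -/

section OrbitMap

/-- The map `(g, λ) ↦ g • F_λ` from `PGL₃(ℂ) × {λ | λ³ ≠ 1}` to smooth cubics. -/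
noncomputable def orbitMap (x : TotalSpace) : SmoothCubics := x.1 • hesse x.2

theorem contMDiff_totalSpace_fst : ContMDiff modelPGLH modelPGL ∞ fun x : TotalSpace => x.1 :=
  contMDiff_fst (M := PGL(3, ℂ)) (N := HesseParam)

theorem contMDiff_totalSpace_snd : ContMDiff modelPGLH 𝓘(ℝ, ℂ) ∞ fun x : TotalSpace => x.2 :=
  contMDiff_snd (M := PGL(3, ℂ)) (N := HesseParam)

theorem contMDiffAt_totalSpace_mk {E H P : Type*} [NormedAddCommGroup E] [NormedSpace ℝ E]
    [TopologicalSpace H] {J : ModelWithCorners ℝ E H} [TopologicalSpace P] [ChartedSpace H P]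
    {k : P → TotalSpace} {p : P} (h1 : ContMDiffAt J modelPGL ∞ (fun q => (k q).1) p)
    (h2 : ContMDiffAt J 𝓘(ℝ, ℂ) ∞ (fun q => ((k q).2 : ℂ)) p) : ContMDiffAt J modelPGLH ∞ k p :=
  ContMDiffAt.prodMk (M' := PGL(3, ℂ)) (N' := HesseParam) h1
    ((ContMDiffAt.subtypeVal_comp_iff _ _ _).1 h2)

/-- The cubic form `F_λ(adj(z) v)`, for a matrix `z`. -/
noncomputable def adjugateHesse (z : Fin 3 × Fin 3 → ℂ) (l : ℂ) : CubicForm :=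
  cubicCoeffs.symm (hesseCoeffs (fun i => (Matrix.of fun j k => z (j, k)).adjugate i.1 i.2) l)

/-- Since `adj g = det g · g⁻¹` and the form has degree three, replacing the inverse by the adjugate
costs only the factor `det³`. This gives a lift of `g • F_l` that is polynomial in the entries of
`g`. -/
theorem adjugateHesse_entries (g : GL (Fin 3) ℂ) (l : ℂ) :
    adjugateHesse (entries g).1 l = g.1.det ^ 3 • (g • hesseForm l) := by
  refine CubicForm.poly_injective (MvPolynomial.funext fun u => ?_)
  rw [adjugateHesse, poly_cubicCoeffs_symm, eval_hesseCoeffs, map_smul, smul_eval, poly_smul,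
    eval_changeCoord, ← eval_smul_of_isHomogeneous (hesseForm l).isHomogeneous]
  congr 2
  ext i
  have hdet : IsUnit g.1.det := (Matrix.isUnit_iff_isUnit_det _).1 g.isUnit
  have : g.1.adjugate = g.1.det • (g⁻¹ : GL (Fin 3) ℂ).1 := by
    rw [Matrix.coe_units_inv, Matrix.inv_def, smul_smul, Ring.mul_inverse_cancel _ hdet, one_smul]
  have hof : (Matrix.of fun j k => (entries g).1 (j, k)) = g.1 := rfl
  rw [hof, this]
  simp [Units.smul_def, Matrix.smul_eq_mulVec, Matrix.mulVec, dotProduct, Finset.mul_sum, mul_assoc]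

theorem contDiff_adjugate : ContDiff ℝ ∞ fun (z : Fin 3 × Fin 3 → ℂ) (i : Fin 3 × Fin 3) =>
    (Matrix.of fun j k => z (j, k)).adjugate i.1 i.2 := by
  refine contDiff_pi.2 fun ⟨i, j⟩ => ?_
  simp only [Matrix.adjugate_fin_three]
  fin_cases i <;> fin_cases j <;> simp <;> fun_prop

theorem contDiff_adjugateHesse : ContDiff ℝ ∞ fun z : (Fin 3 × Fin 3 → ℂ) × ℂ =>
    coeffs (adjugateHesse z.1 z.2) :=
  ContDiff.comp (g := fun c => coeffs (cubicCoeffs.symm c)) contDiff_coeffs_cubicCoeffs_symm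
    (ContDiff.comp (g := fun q : (Fin 3 × Fin 3 → ℂ) × ℂ => hesseCoeffs q.1 q.2)
      (f := fun z : (Fin 3 × Fin 3 → ℂ) × ℂ =>
        ((fun i => (Matrix.of fun j k => z.1 (j, k)).adjugate i.1 i.2 :
          Fin 3 × Fin 3 → ℂ), z.2)) contDiff_hesseCoeffs
      ((contDiff_adjugate.comp contDiff_fst).prodMk contDiff_snd))

theorem contMDiff_orbitMap : ContMDiff modelPGLH modelCubics ∞ orbitMap := by
  rintro ⟨g, l⟩
  induction g using Matrix.ProjGenLinGroup.induction_on with | mk g =>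
  obtain ⟨σ, hσ, hσ'⟩ := exists_lift_pgl g
  let x : TotalSpace := (.mk g, l)
  have h1 : ContMDiffAt modelPGLH 𝓘(ℝ, Fin 3 × Fin 3 → ℂ) ∞
      (fun q : TotalSpace => (entries (σ q.1)).1) x :=
    ContMDiffAt.comp (I' := modelPGL) (g := fun h : PGL(3, ℂ) => (entries (σ h)).1)
      (f := fun q : TotalSpace => q.1) x hσ contMDiff_totalSpace_fst.contMDiffAt
  have h2 : ContMDiffAt modelPGLH 𝓘(ℝ, ℂ) ∞ (fun q : TotalSpace => (q.2 : ℂ)) x :=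
    ContMDiffAt.comp (I' := 𝓘(ℝ, ℂ)) x contMDiff_subtype_val.contMDiffAt
      contMDiff_totalSpace_snd.contMDiffAt
  have h3 : ContMDiffAt modelPGLH 𝓘(ℝ, CubicExponent → ℂ) ∞
      (fun q : TotalSpace => coeffs (adjugateHesse (entries (σ q.1)).1 q.2)) x :=
    ContMDiffAt.comp (I' := 𝓘(ℝ, (Fin 3 × Fin 3 → ℂ) × ℂ))
      (g := fun z : (Fin 3 × Fin 3 → ℂ) × ℂ => coeffs (adjugateHesse z.1 z.2))
      (f := fun q : TotalSpace => ((entries (σ q.1)).1, (q.2 : ℂ))) x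
      contDiff_adjugateHesse.contMDiff.contMDiffAt (h1.prodMk_space h2)
  refine contMDiffAt_cubics_of_lift
    (u := fun q : TotalSpace => adjugateHesse (entries (σ q.1)).1 q.2) h3 ?_
  have h4 := (contMDiff_totalSpace_fst.continuous.continuousAt (x := x)).eventually hσ'
  filter_upwards [h4] with q hq
  have hdet : (σ q.1).1.det ≠ 0 := ((Matrix.isUnit_iff_isUnit_det _).1 (σ q.1).isUnit).ne_zero
  have hne : σ q.1 • hesseForm q.2 ≠ 0 := (smul_ne_zero_iff_ne _).2 (hesseForm_ne_zero _)
  refine ⟨?_, ?_⟩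
  · rw [adjugateHesse_entries]
    exact smul_ne_zero (pow_ne_zero 3 hdet) hne
  · have : (orbitMap q).1 = Projectivization.mk ℂ _ hne := by
      change (q.1 • hesse q.2).1 = _
      conv_lhs => rw [hq]
      rfl
    rw [this, Projectivization.mk_eq_mk_iff']
    refine ⟨((σ q.1).1.det ^ 3)⁻¹, ?_⟩
    rw [adjugateHesse_entries, smul_smul, inv_mul_cancel₀ (pow_ne_zero 3 hdet), one_smul]

/-- The orbit map has smooth local sections. -/
theorem hasSmoothSectionAt_orbitMap (x : TotalSpace) :
    HasSmoothSectionAt modelPGLH modelCubics orbitMap x := by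
  classical
  obtain ⟨g, l⟩ := x
  induction g using Matrix.ProjGenLinGroup.induction_on with | mk g =>
  set F₀ : SmoothCubics := orbitMap (.mk g, l) with hF₀
  obtain ⟨m, μ, hm, hμ, hm0, hμ0, hev⟩ := exists_hesse_frame l.2
  obtain ⟨σ, h1, h2, h3⟩ := exists_lift_cubics F₀
    ((smul_ne_zero_iff_ne g).2 (hesseForm_ne_zero l)) rfl
  -- Translating by `g⁻¹` brings `F₀` back to `F_l`, where `exists_hesse_frame` applies.
  let c : SmoothCubics → Fin 10 → ℂ := fun F => cubicCoeffs (g⁻¹ • σ F)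
  have hc0 : c F₀ = cubicCoeffs (hesseForm l) := by simp only [c, h2, inv_smul_smul]
  have hc : ContMDiffAt modelCubics 𝓘(ℝ, Fin 10 → ℂ) ∞ c F₀ := by
    let L : (CubicExponent → ℂ) →ₗ[ℂ] (Fin 10 → ℂ) := cubicCoeffs.toLinearMap ∘ₗ
      DistribSMul.toLinearMap ℂ CubicForm g⁻¹ ∘ₗ coeffs.symm.toLinearMap
    have hL : ContDiff ℝ ∞ L := (L.toContinuousLinearMap.restrictScalars ℝ).contDiff
    refine (hL.contMDiff.contMDiffAt.comp F₀ h1).congr_of_eventuallyEq (.of_forall fun F => ?_)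
    simp [L, c]
  rw [← hc0] at hm hμ hm0 hμ0 hev
  have hmc := hm.contMDiffAt.comp F₀ hc
  have hμc := hμ.contMDiffAt.comp F₀ hc
  let N : SmoothCubics → Matrix (Fin 3) (Fin 3) ℂ := fun F => Matrix.of fun i j => m (c F) (i, j)
  have hN0 : N F₀ = 1 := by
    ext i j
    exact hm0 i j
  -- If `g⁻¹ • F = F_μ ∘ N`, then `F = (g N⁻¹) • F_μ`. As `N = 1` and `μ = l` at `F₀`, the section
  -- passes through `(g, l)`, and the default branch is not met near `F₀`.
  let R : SmoothCubics → TotalSpace := fun F =>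
    if h : (N F).det ≠ 0 ∧ μ (c F) ^ 3 ≠ 1 then
      (.mk (g * (Matrix.GeneralLinearGroup.mkOfDetNeZero (N F) h.1)⁻¹), ⟨μ (c F), h.2⟩)
    else (.mk g, l)
  have hR : ∀ F (h : (N F).det ≠ 0 ∧ μ (c F) ^ 3 ≠ 1), R F =
      ((.mk (g * (Matrix.GeneralLinearGroup.mkOfDetNeZero (N F) h.1)⁻¹), ⟨μ (c F), h.2⟩) :
        TotalSpace) := fun F h => dif_pos h
  have hNdet : ContDiff ℝ ∞ fun z : Fin 3 × Fin 3 → ℂ => (Matrix.of fun j k => z (j, k)).det := by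
    simp only [Matrix.det_fin_three, Matrix.of_apply]
    fun_prop
  have hdet : ∀ᶠ F in 𝓝 F₀, (N F).det ≠ 0 := by
    have h : ContinuousAt (fun F => (N F).det) F₀ :=
      hNdet.continuous.continuousAt.comp hmc.continuousAt
    refine h.eventually_ne ?_
    simp [hN0]
  have hμ1 : ∀ᶠ F in 𝓝 F₀, μ (c F) ^ 3 ≠ 1 := by
    have h : ContinuousAt (fun F => μ (c F) ^ 3) F₀ := hμc.continuousAt.pow 3
    refine h.eventually_ne ?_
    rw [hμ0]
    exact l.2
  refine ⟨R, contMDiffAt_totalSpace_mk ?_ ?_, ?_, ?_⟩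
  -- The matrix `g · adj N` represents the same class as `g N⁻¹` and is polynomial in the entries of
  -- `N`.
  · have h4 : ContDiff ℝ ∞ fun (z : Fin 3 × Fin 3 → ℂ) (i : Fin 3 × Fin 3) =>
        ∑ j, g i.1 j * (Matrix.of fun j k => z (j, k)).adjugate j i.2 := by
      refine contDiff_pi.2 fun i => ContDiff.sum fun j _ => contDiff_const.mul ?_
      exact contDiff_pi.1 contDiff_adjugate (j, i.2)
    refine contMDiffAt_pgl_of_lift (h4.contMDiff.contMDiffAt.comp F₀ hmc) ?_
    filter_upwards [hdet, hμ1] with F hF hF'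
    refine ⟨g * (Matrix.GeneralLinearGroup.mkOfDetNeZero (N F) hF)⁻¹, ?_, (N F).det, hF,
      fun i => ?_⟩
    · rw [hR F ⟨hF, hF'⟩]
    · have : (N F).adjugate = (N F).det •
          ((Matrix.GeneralLinearGroup.mkOfDetNeZero (N F) hF)⁻¹ : GL (Fin 3) ℂ).1 := by
        rw [Matrix.coe_units_inv, Matrix.inv_def, smul_smul]
        simp [Matrix.GeneralLinearGroup.mkOfDetNeZero, hF]
      change ∑ j, g i.1 j * (N F).adjugate j i.2 = _
      rw [this]
      simp [Matrix.mul_apply, Finset.mul_sum, mul_left_comm]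
  · refine hμc.congr_of_eventuallyEq ?_
    filter_upwards [hdet, hμ1] with F hF hF'
    rw [hR F ⟨hF, hF'⟩]
    rfl
  · have h : (N F₀).det ≠ 0 ∧ μ (c F₀) ^ 3 ≠ 1 := ⟨by simp [hN0], by rw [hμ0]; exact l.2⟩
    refine (hR F₀ h).trans (Prod.ext ?_ (Subtype.ext hμ0))
    have : Matrix.GeneralLinearGroup.mkOfDetNeZero (N F₀) h.1 = 1 := Units.ext hN0
    simp only [this, inv_one, mul_one]
  · filter_upwards [hdet, hμ1, hc.continuousAt.eventually hev, h3] with F hF hF' hcF ⟨hσ, hσ'⟩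
    rw [hR F ⟨hF, hF'⟩]
    refine Subtype.ext (Eq.trans ?_ hσ'.symm)
    refine (Projectivization.mk_eq_mk_iff' ℂ _ _ _ _).2 ⟨1, ?_⟩
    rw [one_smul, eq_comm]
    set n := Matrix.GeneralLinearGroup.mkOfDetNeZero (N F) hF with hn
    change (g * n⁻¹) • hesseForm (μ (c F)) = σ F
    rw [mul_smul, ← eq_inv_smul_iff]
    refine cubicCoeffs.injective ?_
    change _ = c F
    refine Eq.trans ?_ hcF
    rw [← LinearEquiv.eq_symm_apply]
    refine CubicForm.poly_injective (MvPolynomial.funext fun u => ?_)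
    rw [poly_cubicCoeffs_symm, eval_hesseCoeffs, poly_smul, eval_changeCoord, inv_inv]
    rfl

/-- The Hessian group acts smoothly. -/
theorem contMDiff_hessianGroup_smul (γ : hessianGroup) :
    ContMDiff modelPGLH modelPGLH ∞ fun x : TotalSpace => γ • x := by
  intro x
  refine contMDiffAt_totalSpace_mk ?_ ?_
  · exact ((contMDiff_pgl_mul_right (γ.1)⁻¹).comp contMDiff_totalSpace_fst).contMDiffAt
  -- The action on the parameter is defined by choice; reading it off from the curve `γ • F_λ` shows
  -- that it is smooth.
  · have h : ∀ y : TotalSpace, ((γ • y).2 : ℂ) = hesseInv (orbitMap (γ.1, y.2)) := fun y => by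
      change ((γ • y.2 : HesseParam) : ℂ) = hesseInv (γ.1 • hesse y.2)
      rw [← hesse_smul, hesseInv_hesse]
    simp only [h]
    have h1 : ContMDiffAt modelPGLH modelPGLH ∞
        (fun y : TotalSpace => ((γ.1, y.2) : TotalSpace)) x :=
      contMDiffAt_totalSpace_mk contMDiffAt_const
        (contMDiff_subtype_val.comp contMDiff_totalSpace_snd).contMDiffAt
    have h2 : ContMDiffAt modelCubics 𝓘(ℝ, ℂ) ∞ hesseInv (orbitMap (γ.1, x.2)) := by
      have : orbitMap (γ.1, x.2) = hesse (γ • x.2) := (hesse_smul γ x.2).symm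
      rw [this]
      exact contMDiffAt_hesseInv _
    exact ContMDiffAt.comp (I' := modelCubics) (g := hesseInv)
      (f := fun y : TotalSpace => orbitMap (γ.1, y.2)) x h2
      (ContMDiffAt.comp (I' := modelPGLH) x contMDiff_orbitMap.contMDiffAt h1)

end OrbitMap

end FlexCover

namespace FlexCover

open Set Filter Topology

/-! ### Surjectivity and fibres of the orbit map -/

section Orbits

theorem orbitMap_surjective : Function.Surjective orbitMap := by
  rintro ⟨F, hF⟩
  induction F using Projectivization.ind with | h F hF0 =>
  have hF' : IsNonsingular F.poly := (isNonsingular_rep_mk hF0).1 hF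
  obtain ⟨v, hv, hflex⟩ := exists_isFlex hF'
  obtain ⟨g, l, a, b, hl, -, -, h, -⟩ := exists_hesse_of_isFlex hF' hv hflex
  exact ⟨((.mk g, ⟨l, hl⟩) : TotalSpace), Subtype.ext
    ((Projectivization.mk_eq_mk_iff' ℂ _ _ _ _).2 ⟨a, h⟩)⟩

/-- Every flex pair is of the form `(g • F_λ, g • p₀)`. -/
theorem exists_eq_of_mem_FlexPairs {F : SmoothCubics} {p : ℙ ℂ (Fin 3 → ℂ)}
    (h : (F, p) ∈ FlexPairs) : ∃ x : TotalSpace, orbitMap x = F ∧ x.1 • basePoint = p := by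
  obtain ⟨F, hF⟩ := F
  induction F using Projectivization.ind with | h F hF0 =>
  induction p using Projectivization.ind with | h v hv =>
  have hF' : IsNonsingular F.poly := (isNonsingular_rep_mk hF0).1 hF
  obtain ⟨g, l, a, b, hl, -, -, h1, h2⟩ :=
    exists_hesse_of_isFlex hF' hv ((isFlex_rep_iff hF0 hv).1 h)
  exact ⟨((.mk g, ⟨l, hl⟩) : TotalSpace), Subtype.ext
    ((Projectivization.mk_eq_mk_iff' ℂ _ _ _ _).2 ⟨a, h1⟩),
    (Projectivization.mk_eq_mk_iff' ℂ _ _ _ _).2 ⟨b, h2⟩⟩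

theorem orbitMap_smul (γ : hessianGroup) (x : TotalSpace) : orbitMap (γ • x) = orbitMap x := by
  change (x.1 * γ.1⁻¹) • hesse (γ • x.2) = x.1 • hesse x.2
  rw [hesse_smul, smul_smul, inv_mul_cancel_right]

/-- The element `x.1⁻¹ * y.1` carries one Hesse cubic to another, hence belongs to the Hessian
group. Its explicit form is recorded to decide later whether it fixes `p₀`. -/
theorem exists_smul_eq_of_orbitMap_eq {x y : TotalSpace} (h : orbitMap x = orbitMap y) :
    ∃ γ : hessianGroup, γ • y = x ∧ γ.1 = x.1⁻¹ * y.1 := by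
  have h1 : (x.1⁻¹ * y.1) • hesse y.2 = hesse x.2 := by
    rw [mul_smul, inv_smul_eq_iff]
    exact h.symm
  refine ⟨⟨x.1⁻¹ * y.1, mem_hessianGroup_of_smul_eq h1⟩, Prod.ext ?_ ?_, rfl⟩
  · change y.1 * (x.1⁻¹ * y.1)⁻¹ = x.1
    group
  · refine hesse_injective (Eq.trans ?_ h1)
    exact hesse_smul _ _

theorem mem_FlexPairs_orbitMap_iff (x : TotalSpace) (p : ℙ ℂ (Fin 3 → ℂ)) :
    (orbitMap x, p) ∈ FlexPairs ↔ x.1⁻¹ • p ∈ basePoints :=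
  mem_FlexPairs_smul_hesse_iff x.1 x.2 p

theorem smul_mem_FlexPairs_orbitMap (x : TotalSpace) {p : ℙ ℂ (Fin 3 → ℂ)}
    (hp : p ∈ basePoints) : (orbitMap x, x.1 • p) ∈ FlexPairs := by
  rw [mem_FlexPairs_orbitMap_iff, inv_smul_smul]
  exact hp

end Orbits

/-! ### The space of flex pairs is a nine-sheeted covering -/

section FlexCovering

/-- A point `[v]` is cut out by the closed conditions `wᵢ vⱼ = wⱼ vᵢ`. Closedness of points makes
the finite set of base points discrete. -/
instance : T1Space (ℙ ℂ (Fin 3 → ℂ)) := by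
  refine ⟨fun p => ?_⟩
  induction p using Projectivization.ind with | h v hv =>
  rw [← (isOpenQuotientMap_mk' (V := Fin 3 → ℂ)).isQuotientMap.isClosed_preimage]
  have h : (Projectivization.mk' ℂ : {v : Fin 3 → ℂ // v ≠ 0} → _) ⁻¹'
      {Projectivization.mk ℂ v hv} = ⋂ i, ⋂ j, {w | w.1 i * v j = w.1 j * v i} := by
    ext w
    simp only [mem_preimage, mem_singleton_iff, mem_iInter, mem_ofPred_eq,
      Projectivization.mk'_eq_mk]
    rw [Projectivization.mk_eq_mk_iff']
    constructor
    · rintro ⟨a, ha⟩ i j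
      simp only [← ha, Pi.smul_apply, smul_eq_mul]
      ring
    · intro hw
      obtain ⟨i, hi⟩ := Function.ne_iff.1 hv
      simp only [Pi.zero_apply] at hi
      refine ⟨w.1 i / v i, ?_⟩
      ext j
      simp only [Pi.smul_apply, smul_eq_mul]
      field_simp
      linear_combination hw i j
  rw [h]
  refine isClosed_iInter fun i => isClosed_iInter fun j => isClosed_eq ?_ ?_
  · exact ((continuous_apply i).comp continuous_subtype_val).mul continuous_const
  · exact ((continuous_apply j).comp continuous_subtype_val).mul continuous_const

instance : Finite basePoints := finite_basePoints.to_subtype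

/-- The orbit map has a continuous section on a neighbourhood of each point. -/
theorem exists_continuousOn_section (F : SmoothCubics) :
    ∃ (U : Set SmoothCubics) (s : SmoothCubics → TotalSpace), IsOpen U ∧ F ∈ U ∧
      ContinuousOn s U ∧ ∀ G ∈ U, orbitMap (s G) = G := by
  obtain ⟨x, rfl⟩ := orbitMap_surjective F
  obtain ⟨s, h1, -, h3⟩ := hasSmoothSectionAt_orbitMap x
  -- Regularity of finite order at a point spreads to a neighbourhood; order one is enough, as only
  -- continuity is wanted.
  have h4 : ∀ᶠ G in 𝓝 (orbitMap x), ContMDiffAt modelCubics modelPGLH 1 s G :=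
    (contMDiffAt_iff_contMDiffAt_nhds (by simp)).1 (h1.of_le (by norm_cast))
  obtain ⟨U, hU, hUo, hxU⟩ := eventually_nhds_iff.1 (h4.and h3)
  exact ⟨U, s, hUo, hxU, fun G hG => (hU G hG).1.continuousAt.continuousWithinAt,
    fun G hG => (hU G hG).2⟩

theorem continuous_pgl_smul {X : Type*} [TopologicalSpace X] {g : X → PGL(3, ℂ)}
    {p : X → ℙ ℂ (Fin 3 → ℂ)} (hg : Continuous g) (hp : Continuous p) :
    Continuous fun x => g x • p x :=
  contMDiff_pgl_smul_proj.continuous.comp (hg.prodMk hp)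

/-- Where the orbit map has a continuous section `s`, the flexes of `G` are the translates by
`s(G).1` of the base points, so `(G, p) ↦ (G, s(G).1⁻¹ • p)` trivializes the projection with fibre
`basePoints`. -/
theorem isCoveringMap_flexProj : IsCoveringMap flexProj := by
  intro F
  obtain ⟨U, s, hU, hF, hs, hsU⟩ := exists_continuousOn_section F
  have hcont : Continuous flexProj := continuous_fst.comp continuous_subtype_val
  have hs1 : Continuous fun G : U => (s G).1 :=
    contMDiff_totalSpace_fst.continuous.comp hs.domRestrict
  have hfwd : ∀ q : flexProj ⁻¹' U, (s (flexProj q.1)).1⁻¹ • q.1.1.2 ∈ basePoints := fun q => by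
    rw [← mem_FlexPairs_orbitMap_iff, hsU _ q.2]
    exact q.1.2
  have hbwd : ∀ q : U × basePoints, (q.1.1, (s q.1).1 • q.2.1) ∈ FlexPairs := fun q => by
    have := smul_mem_FlexPairs_orbitMap (s q.1) q.2.2
    rwa [hsU _ q.1.2] at this
  let H : flexProj ⁻¹' U ≃ₜ U × basePoints :=
    { toFun := fun q => (⟨flexProj q.1, q.2⟩, ⟨_, hfwd q⟩)
      invFun := fun q => ⟨⟨_, hbwd q⟩, q.1.2⟩
      left_inv := fun q => Subtype.ext (Subtype.ext (Prod.ext rfl (smul_inv_smul _ _)))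
      right_inv := fun q => Prod.ext rfl (Subtype.ext (inv_smul_smul _ _))
      continuous_toFun := by
        have h1 : Continuous fun q : flexProj ⁻¹' U => (⟨flexProj q.1, q.2⟩ : U) :=
          (hcont.comp continuous_subtype_val).subtype_mk _
        refine h1.prodMk (Continuous.subtype_mk (continuous_pgl_smul (hs1.comp h1).inv ?_) _)
        exact continuous_snd.comp (continuous_subtype_val.comp continuous_subtype_val)
      continuous_invFun := by
        refine Continuous.subtype_mk (Continuous.subtype_mk ?_ _) _
        exact (continuous_subtype_val.comp continuous_fst).prodMk
          (continuous_pgl_smul (hs1.comp continuous_fst)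
            (continuous_subtype_val.comp continuous_snd)) }
  exact IsEvenlyCovered.to_isEvenlyCovered_preimage (I := basePoints)
    ⟨inferInstance, U, hF, hU, hU.preimage hcont, H, fun _ => rfl⟩

theorem ncard_fiber_flexProj (F : SmoothCubics) : (flexProj ⁻¹' {F}).ncard = 9 := by
  obtain ⟨x, rfl⟩ := orbitMap_surjective F
  rw [← ncard_basePoints]
  refine Eq.symm (Set.ncard_congr (fun p hp => ⟨_, smul_mem_FlexPairs_orbitMap x hp⟩) ?_ ?_ ?_)
  · intro p hp
    rfl
  · intro p q hp hq h
    exact smul_left_cancel x.1 (congrArg (fun r : FlexPairs => r.1.2) h)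
  · rintro ⟨⟨G, p⟩, h⟩ hG
    obtain rfl : G = orbitMap x := hG
    exact ⟨x.1⁻¹ • p, (mem_FlexPairs_orbitMap_iff x p).1 h,
      Subtype.ext (Prod.ext rfl (smul_inv_smul _ _))⟩

end FlexCovering

/-! ### Smooth structure on flex pairs -/

section FlexManifold

/-- The smooth structure on the space of flex pairs for which the projection to the space of smooth
cubics is a local diffeomorphism. -/
noncomputable instance : ChartedSpace (AffineModel CubicExponent) FlexPairs :=
  etaleChartedSpace isCoveringMap_flexProj.isLocalHomeomorph

instance : IsManifold modelCubics ∞ FlexPairs :=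
  etale_isManifold isCoveringMap_flexProj.isLocalHomeomorph

theorem contMDiff_flexProj : ContMDiff modelCubics modelCubics ∞ flexProj :=
  etale_contMDiff isCoveringMap_flexProj.isLocalHomeomorph

theorem hasSmoothSectionAt_flexProj (q : FlexPairs) :
    HasSmoothSectionAt modelCubics modelCubics flexProj q :=
  etale_hasSmoothSectionAt isCoveringMap_flexProj.isLocalHomeomorph q

theorem isLocalDiffeomorph_flexProj : IsLocalDiffeomorph modelCubics modelCubics ∞ flexProj :=
  isLocalDiffeomorph_of_section isCoveringMap_flexProj.isLocalHomeomorph contMDiff_flexProj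
    hasSmoothSectionAt_flexProj

/-- Near a flex pair `(g₀ • F_λ, g₀ • p₀)`, the flex point is `g(F) • p₀` for a smooth
local section `F ↦ (g(F), λ(F))` of the orbit map. -/
theorem exists_section_through_flex (q : FlexPairs) :
    ∃ s : SmoothCubics → TotalSpace, ContMDiffAt modelCubics modelPGLH ∞ s (flexProj q) ∧
      ∀ᶠ r : FlexPairs in 𝓝 q, orbitMap (s (flexProj r)) = flexProj r ∧
        (s (flexProj r)).1 • basePoint = r.1.2 := by
  obtain ⟨⟨F, p⟩, hq⟩ := q
  obtain ⟨x, rfl, rfl⟩ := exists_eq_of_mem_FlexPairs hq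
  obtain ⟨s, h1, h2, h3⟩ := hasSmoothSectionAt_orbitMap x
  have hcont : Continuous flexProj := continuous_fst.comp continuous_subtype_val
  set q : FlexPairs := ⟨(orbitMap x, x.1 • basePoint), hq⟩
  refine ⟨s, h1, ?_⟩
  have hs1 : ContinuousAt (fun r : FlexPairs => (s (flexProj r)).1) q :=
    ContinuousAt.comp (g := fun y : TotalSpace => y.1)
      (contMDiff_totalSpace_fst.continuous.continuousAt)
      (ContinuousAt.comp (g := s) h1.continuousAt hcont.continuousAt)
  have hc : ContinuousAt (fun r : FlexPairs => (s (flexProj r)).1⁻¹ • r.1.2) q :=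
    ContinuousAt.comp (g := fun z : PGL(3, ℂ) × ℙ ℂ (Fin 3 → ℂ) => z.1 • z.2)
      contMDiff_pgl_smul_proj.continuous.continuousAt
      (hs1.inv.prodMk (continuous_snd.comp continuous_subtype_val).continuousAt)
  have hq0 : (s (flexProj q)).1⁻¹ • q.1.2 = basePoint := by
    rw [show s (flexProj q) = x from h2]
    exact inv_smul_smul _ _
  -- Pulled back by the section, a nearby flex is a base point close to `p₀`; the other base points
  -- form a closed set missing `p₀`, so it equals `p₀`.
  have hopen : ∀ᶠ z in 𝓝 ((s (flexProj q)).1⁻¹ • q.1.2), z ∉ basePoints \ {basePoint} :=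
    (finite_basePoints.subset sdiff_subset).isClosed.isOpen_compl.mem_nhds (by simp [hq0])
  have h3' : ∀ᶠ r in 𝓝 q, orbitMap (s (flexProj r)) = flexProj r :=
    (hcont.continuousAt (x := q)).eventually h3
  filter_upwards [hc.eventually hopen, h3'] with r hr hr'
  refine ⟨hr', ?_⟩
  have hmem : (s (flexProj r)).1⁻¹ • r.1.2 ∈ basePoints := by
    rw [← mem_FlexPairs_orbitMap_iff, hr']
    exact r.2
  by_contra hne
  exact hr ⟨hmem, fun h => hne (inv_smul_eq_iff.1 h).symm⟩

end FlexManifold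

/-! ### Smoothness tested through local sections -/

section Descent

variable {E E' E'' H H' H'' M N P : Type*} [NormedAddCommGroup E] [NormedSpace ℝ E]
  [TopologicalSpace H] [NormedAddCommGroup E'] [NormedSpace ℝ E'] [TopologicalSpace H']
  [NormedAddCommGroup E''] [NormedSpace ℝ E''] [TopologicalSpace H'']
  {I : ModelWithCorners ℝ E H} {J : ModelWithCorners ℝ E' H'} {K : ModelWithCorners ℝ E'' H''}
  [TopologicalSpace M] [ChartedSpace H M] [TopologicalSpace N] [ChartedSpace H' N]
  [TopologicalSpace P] [ChartedSpace H'' P]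

/-- A map out of the target of a map with smooth local sections is smooth if its composition with
the latter is. -/
theorem contMDiff_of_comp_of_sections {f : M → N} {g : N → P}
    (hsec : ∀ y, ∃ s : N → M, ContMDiffAt J I ∞ s y ∧ ∀ᶠ z in 𝓝 y, f (s z) = z)
    (hg : ContMDiff I K ∞ fun x => g (f x)) : ContMDiff J K ∞ g := by
  intro y
  obtain ⟨s, hs, hfs⟩ := hsec y
  have h : ContMDiffAt J K ∞ (fun z => g (f (s z))) y :=
    ContMDiffAt.comp (I' := I) (g := fun x => g (f x)) (f := s) y hg.contMDiffAt hs
  exact h.congr_of_eventuallyEq (hfs.mono fun z hz => (congrArg g hz).symm)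

theorem exists_section_of_hasSmoothSectionAt {f : M → N} (hf : Function.Surjective f)
    (h : ∀ x, HasSmoothSectionAt I J f x) (y : N) :
    ∃ s : N → M, ContMDiffAt J I ∞ s y ∧ ∀ᶠ z in 𝓝 y, f (s z) = z := by
  obtain ⟨x, rfl⟩ := hf y
  obtain ⟨s, h1, -, h3⟩ := h x
  exact ⟨s, h1, h3⟩

end Descent

/-! ### The flex point as a smooth function, and the flex orbit map -/

section FlexPoint

theorem contMDiff_flexPoint :
    ContMDiff modelCubics modelPlane ∞ fun q : FlexPairs => q.1.2 := by
  intro q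
  obtain ⟨s, hs, h⟩ := exists_section_through_flex q
  have h1 : ContMDiffAt modelCubics modelPGLH ∞ (fun r => s (flexProj r)) q :=
    ContMDiffAt.comp (I' := modelCubics) (g := s) (f := flexProj) q hs
      contMDiff_flexProj.contMDiffAt
  have h2 : ContMDiffAt modelCubics 𝓘(ℝ, AffineModel (Fin 3 × Fin 3)) ∞
      (fun r => (s (flexProj r)).1) q :=
    ContMDiffAt.comp (I' := modelPGLH) (g := fun x : TotalSpace => x.1)
      (f := fun r => s (flexProj r)) q contMDiff_totalSpace_fst.contMDiffAt h1
  have h3 : ContMDiffAt modelCubics modelPlane ∞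
      (fun r => (s (flexProj r)).1 • basePoint) q :=
    ContMDiffAt.comp (I' := 𝓘(ℝ, AffineModel (Fin 3 × Fin 3)).prod modelPlane)
      (g := fun z : PGL(3, ℂ) × ℙ ℂ (Fin 3 → ℂ) => z.1 • z.2)
      (f := fun r => ((s (flexProj r)).1, basePoint)) q contMDiff_pgl_smul_proj.contMDiffAt
      (h2.prodMk contMDiffAt_const)
  exact h3.congr_of_eventuallyEq (h.mono fun r hr => hr.2.symm)

/-- The first component is étale by construction of the charts and the flex point is smooth, so the
inclusion is locally a smooth graph; the topology is already the subspace topology. -/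
theorem isSmoothEmbedding_flexPairs :
    Manifold.IsSmoothEmbedding modelCubics (modelCubics.prod modelPlane) ∞
      (Subtype.val : FlexPairs → SmoothCubics × ℙ ℂ (Fin 3 → ℂ)) := by
  refine ⟨⟨AffineModel (Fin 3), inferInstance, inferInstance, fun q => ?_⟩,
    Topology.IsEmbedding.subtypeVal⟩
  have hf := isCoveringMap_flexProj.isLocalHomeomorph
  exact isImmersionAtOfComplement_of_etale_fst (hf q).choose_spec.1 (hf q).choose_spec.2.symm
    (chart_mem_atlas _ _) (mem_chart_source _ _) (mem_range_self q) contMDiff_flexPoint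

/-- The map `(g, λ) ↦ (g • F_λ, g • p₀)`. -/
noncomputable def flexOrbitMap (x : TotalSpace) : FlexPairs :=
  ⟨(orbitMap x, x.1 • basePoint), smul_mem_FlexPairs_orbitMap x basePoint_mem_basePoints⟩

/-- By the étale criterion it is enough that the map is continuous and that its projection to
cubics, the orbit map, is smooth. -/
theorem contMDiff_flexOrbitMap : ContMDiff modelPGLH modelCubics ∞ flexOrbitMap := by
  intro x
  refine etale_contMDiffAt isCoveringMap_flexProj.isLocalHomeomorph ?_
    contMDiff_orbitMap.contMDiffAt
  refine Continuous.continuousAt (Continuous.subtype_mk ?_ _)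
  exact contMDiff_orbitMap.continuous.prodMk
    (continuous_pgl_smul contMDiff_totalSpace_fst.continuous continuous_const)

theorem flexOrbitMap_surjective : Function.Surjective flexOrbitMap := by
  rintro ⟨⟨F, p⟩, h⟩
  obtain ⟨x, h1, h2⟩ := exists_eq_of_mem_FlexPairs h
  exact ⟨x, Subtype.ext (Prod.ext h1 h2)⟩

theorem exists_section_flexOrbitMap (q : FlexPairs) :
    ∃ s : FlexPairs → TotalSpace, ContMDiffAt modelCubics modelPGLH ∞ s q ∧
      ∀ᶠ r in 𝓝 q, flexOrbitMap (s r) = r := by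
  obtain ⟨s, hs, h⟩ := exists_section_through_flex q
  exact ⟨fun r => s (flexProj r),
    ContMDiffAt.comp (I' := modelCubics) (g := s) (f := flexProj) q hs
      contMDiff_flexProj.contMDiffAt, h.mono fun r hr => Subtype.ext (Prod.ext hr.1 hr.2)⟩

theorem flexOrbitMap_smul (γ : hessianGroup₀) (x : TotalSpace) :
    flexOrbitMap (γ • x) = flexOrbitMap x := by
  refine Subtype.ext (Prod.ext (orbitMap_smul γ.1 x) ?_)
  have h : γ.1.1⁻¹ • basePoint = basePoint := inv_smul_eq_iff.2 γ.2.symm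
  change (x.1 * γ.1.1⁻¹) • basePoint = x.1 • basePoint
  rw [mul_smul, h]

/-- The Hessian group element relating `x` and `y` is `x.1⁻¹ * y.1`, and it fixes `p₀` because `x.1
• p₀ = y.1 • p₀`. -/
theorem exists_smul_eq_of_flexOrbitMap_eq {x y : TotalSpace} (h : flexOrbitMap x = flexOrbitMap y) :
    ∃ γ : hessianGroup₀, γ • y = x := by
  obtain ⟨γ, hγ, hγ'⟩ := exists_smul_eq_of_orbitMap_eq (congrArg (fun q : FlexPairs => q.1.1) h)
  refine ⟨⟨γ, ?_⟩, hγ⟩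
  change γ.1 • basePoint = basePoint
  rw [hγ', mul_smul, inv_smul_eq_iff]
  exact (congrArg (fun q : FlexPairs => q.1.2) h).symm

end FlexPoint

/-! ### The diffeomorphisms and the covering of twisted products -/

section Parametrizations

theorem contMDiff_hessianGroup₀_smul (γ : hessianGroup₀) :
    ContMDiff modelPGLH modelPGLH ∞ fun x : TotalSpace => γ • x :=
  contMDiff_hessianGroup_smul γ.1

/-- A smooth surjection with smooth local sections whose fibres are the orbits of a group induces
a diffeomorphism of the orbit space with the target. -/
noncomputable def orbitDiffeomorph {E E' H H' M N G : Type*} [NormedAddCommGroup E]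
    [NormedSpace ℝ E] [TopologicalSpace H] [NormedAddCommGroup E'] [NormedSpace ℝ E']
    [TopologicalSpace H'] {I : ModelWithCorners ℝ E H} {J : ModelWithCorners ℝ E' H'}
    [TopologicalSpace M] [ChartedSpace H M] [IsManifold I ∞ M] [TopologicalSpace N]
    [ChartedSpace H' N] [Group G] [MulAction G M] [ProperlyDiscontinuousSMul G M]
    [ContinuousConstSMul G M] [IsCancelSMul G M] [T2Space M] [LocallyCompactSpace M]
    (hsmooth : ∀ g : G, ContMDiff I I ∞ fun x : M => g • x) {f : M → N}
    (hf : ContMDiff I J ∞ f) (hsurj : Function.Surjective f)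
    (hsec : ∀ y, ∃ s : N → M, ContMDiffAt J I ∞ s y ∧ ∀ᶠ z in 𝓝 y, f (s z) = z)
    (hG : ∀ (g : G) x, f (g • x) = f x) (hfib : ∀ x y, f x = f y → ∃ g : G, g • y = x) :
    Diffeomorph I J (MulAction.orbitRel.Quotient G M) N ∞ :=
  let F : MulAction.orbitRel.Quotient G M → N :=
    Quotient.lift f (by rintro _ y ⟨g, rfl⟩; exact hG g y)
  have hinj : Function.Injective F := by
    intro a b
    induction a using Quotient.inductionOn
    induction b using Quotient.inductionOn
    exact fun h => Quotient.sound (hfib _ _ h)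
  let e : MulAction.orbitRel.Quotient G M ≃ N :=
    Equiv.ofBijective F ⟨hinj, fun y => (hsurj y).imp' (Quotient.mk _) fun _ h => h⟩
  { toEquiv := e
    contMDiff_toFun := contMDiff_of_comp_of_sections (exists_section_of_hasSmoothSectionAt
      Quotient.mk_surjective (hasSmoothSectionAt_quotientMk hsmooth)) hf
    -- Composed with `f`, the inverse is the quotient map, which is smooth; local sections of `f`
    -- then give smoothness of the inverse itself.
    contMDiff_invFun := contMDiff_of_comp_of_sections hsec <| by
      have h : (fun x => e.symm (f x)) = Quotient.mk _ :=
        funext fun x => e.symm_apply_apply (Quotient.mk _ x)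
      rw [h]
      exact contMDiff_quotientMk hsmooth }

/-- The diffeomorphism `φ [g, λ] = g • F_λ`. -/
noncomputable def cubicDiffeomorph :
    Diffeomorph modelPGLH modelCubics (TwistedProduct hessianGroup) SmoothCubics ∞ :=
  orbitDiffeomorph contMDiff_hessianGroup_smul contMDiff_orbitMap orbitMap_surjective
    (exists_section_of_hasSmoothSectionAt orbitMap_surjective hasSmoothSectionAt_orbitMap)
    orbitMap_smul fun _ _ h => (exists_smul_eq_of_orbitMap_eq h).imp fun _ h => h.1

/-- The diffeomorphism `ψ [g, λ] = (g • F_λ, g • p₀)`. -/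
noncomputable def flexDiffeomorph :
    Diffeomorph modelPGLH modelCubics (TwistedProduct hessianGroup₀) FlexPairs ∞ :=
  orbitDiffeomorph contMDiff_hessianGroup₀_smul contMDiff_flexOrbitMap flexOrbitMap_surjective
    exists_section_flexOrbitMap flexOrbitMap_smul fun _ _ => exists_smul_eq_of_flexOrbitMap_eq

theorem flexProj_flexDiffeomorph (y : TwistedProduct hessianGroup₀) :
    flexProj (flexDiffeomorph y) = cubicDiffeomorph (twistedProj y) := by
  induction y using Quotient.inductionOn
  rfl

/-- Exhibits the natural map as conjugate to `flexProj`, so that the covering and local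
diffeomorphism properties transfer to it. -/
theorem twistedProj_eq :
    twistedProj = cubicDiffeomorph.symm ∘ flexProj ∘ flexDiffeomorph := by
  funext y
  rw [Function.comp_apply, Function.comp_apply, flexProj_flexDiffeomorph,
    Diffeomorph.symm_apply_apply]

theorem isCoveringMap_twistedProj : IsCoveringMap twistedProj := by
  rw [twistedProj_eq]
  exact (isCoveringMap_flexProj.comp_homeomorph flexDiffeomorph.toHomeomorph).homeomorph_comp
    cubicDiffeomorph.symm.toHomeomorph

theorem isLocalDiffeomorph_twistedProj : IsLocalDiffeomorph modelPGLH modelPGLH ∞ twistedProj := by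
  rw [twistedProj_eq]
  intro y
  exact ((flexDiffeomorph.isLocalDiffeomorph y).comp _ _ (isLocalDiffeomorph_flexProj _)).comp _ _
    (cubicDiffeomorph.symm.isLocalDiffeomorph _)

theorem ncard_fiber_twistedProj (z : TwistedProduct hessianGroup) :
    (twistedProj ⁻¹' {z}).ncard = 9 := by
  rw [← ncard_fiber_flexProj (cubicDiffeomorph z)]
  refine Set.ncard_congr (fun y _ => flexDiffeomorph y) ?_ ?_ ?_
  · rintro y rfl
    exact flexProj_flexDiffeomorph y
  · exact fun y y' _ _ h => flexDiffeomorph.injective h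
  · intro q hq
    refine ⟨flexDiffeomorph.symm q, cubicDiffeomorph.injective ?_,
      flexDiffeomorph.apply_symm_apply q⟩
    refine (flexProj_flexDiffeomorph _).symm.trans ?_
    rwa [flexDiffeomorph.apply_symm_apply]

end Parametrizations

end FlexCover

open FlexCover
theorem mainTheorem8 :
    -- the twisted products are smooth manifolds
    IsManifold modelPGLH ∞ (TwistedProduct hessianGroup) ∧
    IsManifold modelPGLH ∞ (TwistedProduct hessianGroup₀) ∧
    -- the smooth structure of the embedded submanifold of flex pairs
    ∃ (_ : ChartedSpace (AffineModel CubicExponent) FlexPairs)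
      (_ : IsManifold modelCubics ∞ FlexPairs),
      Manifold.IsSmoothEmbedding modelCubics
        (modelCubics.prod modelPlane) ∞
        (Subtype.val : FlexPairs →
          SmoothCubics × ℙ ℂ (Fin 3 → ℂ)) ∧
    ∃ (φ : Diffeomorph modelPGLH modelCubics
        (TwistedProduct hessianGroup) SmoothCubics ∞)
      (ψ : Diffeomorph modelPGLH modelCubics
        (TwistedProduct hessianGroup₀) FlexPairs ∞),
      (∀ g l, φ (TwistedProduct.mk hessianGroup g l) =
        g • hesse l) ∧
      (∀ g l, (ψ (TwistedProduct.mk hessianGroup₀ g l)).1 =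
        (g • hesse l, g • basePoint)) ∧
      (∀ y, flexProj (ψ y) = φ (twistedProj y)) ∧
      IsCoveringMap flexProj ∧
      IsLocalDiffeomorph modelCubics modelCubics ∞ flexProj ∧
      (∀ F, (flexProj ⁻¹' {F}).ncard = 9) ∧
      IsCoveringMap twistedProj ∧
      IsLocalDiffeomorph modelPGLH modelPGLH ∞ twistedProj ∧
      (∀ z, (twistedProj ⁻¹' {z}).ncard = 9) :=
  ⟨isManifold_quotient contMDiff_hessianGroup_smul,
    isManifold_quotient contMDiff_hessianGroup₀_smul, inferInstance, inferInstance,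
    isSmoothEmbedding_flexPairs, cubicDiffeomorph, flexDiffeomorph, fun _ _ => rfl,
    fun _ _ => rfl, flexProj_flexDiffeomorph, isCoveringMap_flexProj,
    isLocalDiffeomorph_flexProj, ncard_fiber_flexProj, isCoveringMap_twistedProj,
    isLocalDiffeomorph_twistedProj, ncard_fiber_twistedProj⟩
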